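/- Let $n \ge 1$ be a fixed integer. There are a deterministic algorithm $A$ (a program for a random access machine with logarithmic cost, i.e. every number, address included, that the machine handles is charged its bit length) and a polynomial $P$ with coefficients in $\mathbb{N}$, both depending only on $n$, such that the following holds. Let $p$ be a prime, let $m \in \mathbb{F}_p[t]$ be monic and irreducible of degree $a$, put $q = p^a$ and $\mathbb{F}_q = \mathbb{F}_p[t]/(m)$, and let $f \in \mathbb{F}_q[x_1,\dots,x_n]$ be a polynomial of total degree $d$ (with $d=0$ if $f=0$), defining the affine hypersurface $X : f = 0$. For $k \ge 1$ let $N_k(X)$ be the number of $\mathbb{F}_{q^k}$-rational points of $X$, and let $$Z(X,T) = \exp\left(\sum_{k=1}^{\infty} \frac{N_k(X)}{k} T^k\right) \in \mathbb{Q}[[T]]$$ be its zeta function. Then $Z(X,T)$ has integer coefficients, and its reduction modulo $p$ is a rational function $g(T)/h(T)$ with $g, h \in \mathbb{F}_p[T]$ coprime and $h(0) = 1$. Given $p$, $m$ and $f$, the algorithm $A$ outputs the coefficients of $g$ and $h$ in time at most $$P\left(p \cdot \max\left\{1, \tbinom{d}{n}\right\} \cdot \lfloor \log_2 q \rfloor\right).$$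 In particular, for fixed $n$ and for $p$ small (bounded), $Z(X,T)$ modulo $p$ is computed in time polynomial in $\binom{d}{n} \log q$ (for $d \ge n$). Here $f$ is given by a list of distinct monomials of degree at most $d$ that contains every monomial occurring in $f$ (so the dense and the sparse lists are both allowed), in any order, each written as its exponent vector followed by its coefficient in $f$; elements of $\mathbb{F}_q$ are written as the $a$ coefficients of their representative of degree less than $a$, and elements of $\mathbb{F}_p$ as integers in $[0,p)$. -/

import Mathlib

open Polynomial

/-! ### A random access machine with logarithmic (bit) cost

Deterministic programs act on an infinite memory of natural numbers (all cells initially `0`), a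
read-only input tape and a write-only output tape of natural numbers.  Addresses may be computed
(indirect addressing), and every number that is touched is charged its bit length. -/

namespace RAM

/-- Primitive arithmetic operations (`sub` is truncated, `div` and `mod` are Euclidean). -/
inductive Op
  | add | sub | mul | div | mod

/-- The effect of an arithmetic operation. -/
def Op.apply : Op → ℕ → ℕ → ℕ
  | .add, a, b => a + b
  | .sub, a, b => a - b
  | .mul, a, b => a * b
  | .div, a, b => a / b
  | .mod, a, b => a % b

/-- Expressions: constants, the content of the memory cell whose address is the value of `e`, and
arithmetic operations. -/
inductive Expr
  | const (c : ℕ)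
  | load (e : Expr)
  | op (o : Op) (e₁ e₂ : Expr)

/-- Programs. `assign a e` stores the value of `e` in the cell with address `a`, `read a` moves the
next number of the input to that cell, `write e` appends a number to the output, `ite e c₁ c₂` and
`loop e c` (a while loop) branch on whether the value of `e` is nonzero. -/
inductive Prog
  | skip
  | assign (a e : Expr)
  | read (a : Expr)
  | write (e : Expr)
  | seq (c₁ c₂ : Prog)
  | ite (e : Expr) (c₁ c₂ : Prog)
  | loop (e : Expr) (c : Prog)

/-- A state of the machine: memory, unread part of the input, output written so far. -/
structure State where
  mem : ℕ → ℕ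
  inp : List ℕ
  out : List ℕ

/-- The cost of handling the number `a`: one more than its bit length. -/
def bitCost (a : ℕ) : ℕ := Nat.size a + 1

/-- The value of an expression. -/
def Expr.val (M : ℕ → ℕ) : Expr → ℕ
  | .const c => c
  | .load e => M (e.val M)
  | .op o e₁ e₂ => o.apply (e₁.val M) (e₂.val M)

/-- The cost of evaluating an expression: the total cost of all values, addresses included, that
occur in the evaluation. -/
def Expr.cost (M : ℕ → ℕ) : Expr → ℕ
  | .const c => bitCost c
  | .load e => e.cost M + bitCost (M (e.val M))
  | .op o e₁ e₂ => e₁.cost M + e₂.cost M + bitCost (o.apply (e₁.val M) (e₂.val M))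

/-- `Exec c s t s'`: the program `c`, started in the state `s`, halts in the state `s'` at total
cost `t`. Reading from an exhausted input yields `0`. -/
inductive Exec : Prog → State → ℕ → State → Prop
  | skip (s : State) : Exec .skip s 1 s
  | assign (a e : Expr) (s : State) :
      Exec (.assign a e) s (a.cost s.mem + e.cost s.mem)
        { s with mem := Function.update s.mem (a.val s.mem) (e.val s.mem) }
  | read (a : Expr) (s : State) :
      Exec (.read a) s (a.cost s.mem + bitCost (s.inp.headD 0))
        { s with
          mem := Function.update s.mem (a.val s.mem) (s.inp.headD 0)
          inp := s.inp.tail }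
  | write (e : Expr) (s : State) :
      Exec (.write e) s (e.cost s.mem) { s with out := s.out ++ [e.val s.mem] }
  | seq {c₁ c₂ : Prog} {s s' s'' : State} {t₁ t₂ : ℕ} (h₁ : Exec c₁ s t₁ s')
      (h₂ : Exec c₂ s' t₂ s'') : Exec (.seq c₁ c₂) s (t₁ + t₂) s''
  | ite_true {e : Expr} {c₁ c₂ : Prog} {s s' : State} {t : ℕ} (he : e.val s.mem ≠ 0)
      (h : Exec c₁ s t s') : Exec (.ite e c₁ c₂) s (e.cost s.mem + t) s'
  | ite_false {e : Expr} {c₁ c₂ : Prog} {s s' : State} {t : ℕ} (he : e.val s.mem = 0)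
      (h : Exec c₂ s t s') : Exec (.ite e c₁ c₂) s (e.cost s.mem + t) s'
  | loop_true {e : Expr} {c : Prog} {s s' s'' : State} {t₁ t₂ : ℕ} (he : e.val s.mem ≠ 0)
      (h₁ : Exec c s t₁ s') (h₂ : Exec (.loop e c) s' t₂ s'') :
      Exec (.loop e c) s (e.cost s.mem + t₁ + t₂) s''
  | loop_false {e : Expr} {c : Prog} {s : State} (he : e.val s.mem = 0) :
      Exec (.loop e c) s (e.cost s.mem) s

/-- The program `c`, on the input `w`, halts with output `v` at bit cost at most `B`. -/
def Prog.OutputsWithin (c : Prog) (w v : List ℕ) (B : ℕ) : Prop :=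
  ∃ (t : ℕ) (s : State), Exec c ⟨fun _ => 0, w, []⟩ t s ∧ s.out = v ∧ t ≤ B

end RAM

/-! ### The zeta function of an affine hypersurface over a finite field -/

section Zeta

variable (K : Type) [Field K] [Finite K] (p : ℕ) [Fact p.Prime] [CharP K p] {n : ℕ}

/-- The number `N_k` of points of the affine hypersurface `f = 0` over the extension of degree `k`
of the finite field `K` (of characteristic `p`). -/
noncomputable def hypersurfacePoints (f : MvPolynomial (Fin n) K) (k : ℕ) [NeZero k] : ℕ :=
  Nat.card {x : Fin n → FiniteField.Extension K p k // MvPolynomial.aeval x f = 0}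

/-- The logarithm `∑_{k ≥ 1} (N_k / k) T^k` of the zeta function. -/
noncomputable def hypersurfaceLogZeta (f : MvPolynomial (Fin n) K) : PowerSeries ℚ :=
  PowerSeries.X *
    PowerSeries.mk fun k : ℕ => (hypersurfacePoints K p f (k + 1) : ℚ) / ((k : ℚ) + 1)

/-- The zeta function `Z(T) = exp (∑_{k ≥ 1} (N_k / k) T^k)` as a formal power series. -/
noncomputable def hypersurfaceZeta (f : MvPolynomial (Fin n) K) : PowerSeries ℚ :=
  (PowerSeries.exp ℚ).subst (hypersurfaceLogZeta K p f)

end Zeta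

/-- The formal power series `Z` has integer coefficients, and its reduction modulo `p` is the
rational function `g / h`, written in lowest terms with `h(0) = 1`. -/
def IsReductionModP (p : ℕ) (Z : PowerSeries ℚ) (g h : (ZMod p)[X]) : Prop :=
  ∃ W : PowerSeries ℤ, W.map (Int.castRingHom ℚ) = Z ∧
    IsCoprime g h ∧ h.coeff 0 = 1 ∧
    (h : PowerSeries (ZMod p)) * W.map (Int.castRingHom (ZMod p)) = (g : PowerSeries (ZMod p))

/-! ### Finite fields `𝔽_p[t] / (m)` and encodings -/

section Encoding

variable {p : ℕ} [Fact p.Prime]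

instance adjoinRoot_finite_of_irreducible (m : (ZMod p)[X]) [hm : Fact (Irreducible m)] :
    Finite (AdjoinRoot m) :=
  haveI : Module.Finite (ZMod p) (AdjoinRoot m) := (AdjoinRoot.powerBasis hm.out.ne_zero).finite
  Module.finite_of_finite (ZMod p)

instance adjoinRoot_charP_of_irreducible (m : (ZMod p)[X]) [Fact (Irreducible m)] :
    CharP (AdjoinRoot m) p :=
  charP_of_injective_algebraMap (algebraMap (ZMod p) (AdjoinRoot m)).injective p

/-- A polynomial over `𝔽_p`: the number of its coefficients, then the coefficients from degree `0`
up to its degree, as integers in `[0, p)`. -/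
def polyWord (g : (ZMod p)[X]) : List ℕ :=
  (g.natDegree + 1) :: (List.range (g.natDegree + 1)).map fun i => (g.coeff i).val

/-- An element of `𝔽_p[t] / (m)`: the `deg m` coefficients of its representative of degree less
than `deg m`. -/
noncomputable def elementWord {m : (ZMod p)[X]} (hm : m.Monic) (c : AdjoinRoot m) : List ℕ :=
  (List.range m.natDegree).map fun i => ((AdjoinRoot.modByMonicHom hm c).coeff i).val

/-- `L` is an admissible list of exponent vectors for writing down `f`: no repetitions, every
monomial of `f` is listed, and no listed monomial has degree above the total degree of `f`.
(Extremes: the list of the monomials that occur in `f`, and the list of all monomials of degree at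
most the total degree of `f`.) -/
def IsMonomialList {K : Type} [CommSemiring K] {n : ℕ} (f : MvPolynomial (Fin n) K)
    (L : List (Fin n →₀ ℕ)) : Prop :=
  L.Nodup ∧ (∀ e ∈ f.support, e ∈ L) ∧ ∀ e ∈ L, e.degree ≤ f.totalDegree

/-- The input: the prime `p`, the polynomial `m` that presents the field, the number of listed
monomials, and for each of them its exponents followed by its coefficient in `f`. -/
noncomputable def hypersurfaceWord {m : (ZMod p)[X]} (hm : m.Monic) {n : ℕ}
    (f : MvPolynomial (Fin n) (AdjoinRoot m)) (L : List (Fin n →₀ ℕ)) : List ℕ :=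
  p :: (polyWord m ++ L.length ::
    L.flatMap fun e => List.ofFn (fun i => e i) ++ elementWord hm (f.coeff e))

end Encoding

/-! Write q = p^a and let D bound the partial degrees of f. The core is a trace formula modulo p
over the Witt vectors of an algebraic closure of 𝔽_p. Call a sequence α negligible (`IsExpTrivial`)
if exp(∑ α_k T^k/k) is integral and congruent to 1 mod p. It suffices that p^k divides α_k, because
v_p(k!) < k (`isExpTrivial_of_pow_dvd`).

Lift f to F. The number of points with f ≠ 0 over 𝔽_{q^k} and the sum over Teichmüller points of
∏_{i<k} F(x^{q^i})^{q-1} are both traces of weighted Frobenius maps. Modulo p the two weighted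
matrices are conjugate by a diagonal matrix with entries f(x), since f(x^q) = f(x)^q; hence the two
sequences differ by a negligible one. Orthogonality of characters evaluates the second sum modulo
q^k as (-1)^n tr(A^k), where A is the matrix of h ↦ ψ_q(F^{q-1} h) on the monomials with exponents
in [1, D] (`isExpTrivial_nonzeroCount`). Since exp(-∑ tr(A^k) T^k/k) = det(1 - TA) and q^{nk} is
negligible, Z is congruent to det(1 - TA)^{(-1)^n}: a polynomial of degree at most D^n, or the
inverse of one, according to the parity of n.

The power F^{q-1} is too large to compute. So t becomes an extra variable, and X is replaced by the
set m' = f' = 0 over 𝔽_p in n + 1 variables (`IsPrimeFieldModel`). Over 𝔽_{p^k} this set has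
a·N_{k/a}(X) points if a divides k and none otherwise, so its zeta function is Z(X, T^a). The trace
formula at level p involves only (p-1)-th powers. By inclusion–exclusion the point counts reduce to
those of f' ≠ 0 and m'f' ≠ 0, because the count of m' = 0 is negligible. A negligible multiple of
p^k is added so that the combined trace is a natural number (`modelTrace`). Its exponential H has
natural coefficients and satisfies H ≡ Z(X, T^a)^{(-1)^n} mod p, so the coefficients of H at
multiples of a give the polynomial sought. The trace formula over 𝔽_q serves only to bound its
degree (`IsPrimeFieldModel.isReductionModP`).

Everything is computed with natural numbers. Kronecker substitution x_i ↦ B^{E^i} with a huge base B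
encodes polynomials as numbers; ψ_p, the traces and the exponential recursion become digit
extraction, exact because B exceeds all coefficients involved (`hypersurface_digits`). For fixed n
the parameters D, E, J, K are polynomially bounded in the size and B has polynomially many bits. The
running time is followed by a calculus of families of machine states indexed by all inputs, with one
polynomial for the whole family (`RAM.Runs`). -/

set_option linter.unusedSectionVars false

/-! ### Exponentials of logarithmic derivatives without division -/

section LogDerivative

open PowerSeries in
/-- The power series `∑_{k ≥ 1} α k T^k`. -/
noncomputable def positivePart {R : Type*} [CommRing R] (α : ℕ → R) : PowerSeries R :=
  PowerSeries.mk fun k => if k = 0 then 0 else α k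

/-- `D = exp (∑_{k ≥ 1} α k / k T^k)` up to the term of degree `N`, expressed without division. -/
def IsExpUpTo {R : Type*} [CommRing R] (N : ℕ) (D : PowerSeries R) (α : ℕ → R) : Prop :=
  PowerSeries.constantCoeff D = 1 ∧
    PowerSeries.X ^ (N + 1) ∣
      PowerSeries.X * PowerSeries.derivative R D - D * positivePart α

variable {R S : Type*} [CommRing R] [CommRing S]

theorem positivePart_add (α β : ℕ → R) :
    positivePart (fun k => α k + β k) = positivePart α + positivePart β := by
  ext k
  simp only [positivePart, PowerSeries.coeff_mk, map_add]
  split_ifs <;> simp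

theorem positivePart_neg (α : ℕ → R) :
    positivePart (fun k => -α k) = -positivePart α := by
  ext k
  simp only [positivePart, PowerSeries.coeff_mk, map_neg]
  split_ifs <;> simp

theorem positivePart_congr_dvd {N : ℕ} {α β : ℕ → R} (h : ∀ k, 1 ≤ k → k ≤ N → α k = β k) :
    (PowerSeries.X : PowerSeries R) ^ (N + 1) ∣ positivePart α - positivePart β := by
  rw [PowerSeries.X_pow_dvd_iff]
  intro k hk
  simp only [positivePart, PowerSeries.coeff_mk, map_sub]
  split_ifs with hk0
  · simp
  · rw [h k (Nat.one_le_iff_ne_zero.2 hk0) (by omega), sub_self]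

theorem IsExpUpTo.congr {N : ℕ} {D : PowerSeries R} {α β : ℕ → R} (h : IsExpUpTo N D α)
    (hab : ∀ k, 1 ≤ k → k ≤ N → α k = β k) : IsExpUpTo N D β := by
  refine ⟨h.1, ?_⟩
  have := dvd_add h.2 (Dvd.dvd.mul_left (positivePart_congr_dvd hab) D)
  convert this using 1
  ring

theorem IsExpUpTo.mul {N : ℕ} {D E : PowerSeries R} {α β : ℕ → R} (h : IsExpUpTo N D α)
    (h' : IsExpUpTo N E β) : IsExpUpTo N (D * E) (fun k => α k + β k) := by
  refine ⟨by rw [map_mul, h.1, h'.1, one_mul], ?_⟩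
  have := dvd_add (Dvd.dvd.mul_left h.2 E) (Dvd.dvd.mul_left h'.2 D)
  convert this using 1
  rw [positivePart_add, Derivation.leibniz]
  simp only [smul_eq_mul]
  ring

theorem IsExpUpTo.inv {N : ℕ} {D E : PowerSeries R} {α : ℕ → R} (h : IsExpUpTo N D α)
    (hDE : D * E = 1) : IsExpUpTo N E (fun k => -α k) := by
  have h0 : PowerSeries.constantCoeff E = 1 := by
    have := congrArg PowerSeries.constantCoeff hDE
    rwa [map_mul, h.1, one_mul, map_one] at this
  refine ⟨h0, ?_⟩
  have hd : D * PowerSeries.derivative R E + E * PowerSeries.derivative R D = 0 := by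
    have := congrArg (PowerSeries.derivative R) hDE
    rwa [Derivation.leibniz, smul_eq_mul, smul_eq_mul, Derivation.map_one_eq_zero] at this
  have := Dvd.dvd.mul_left h.2 (-(E * E))
  convert this using 1
  rw [positivePart_neg]
  linear_combination (-PowerSeries.X * PowerSeries.derivative R E + E * (-positivePart α)) * hDE
    + (PowerSeries.X * E) * hd

theorem exists_mul_eq_one_of_constantCoeff {D : PowerSeries R}
    (h : PowerSeries.constantCoeff D = 1) : ∃ E, D * E = 1 :=
  ⟨PowerSeries.invOfUnit D 1, PowerSeries.mul_invOfUnit D 1 (by simpa using h)⟩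

theorem IsExpUpTo.map {N : ℕ} {D : PowerSeries R} {α : ℕ → R} (h : IsExpUpTo N D α)
    (f : R →+* S) : IsExpUpTo N (D.map f) (fun k => f (α k)) := by
  refine ⟨by rw [← PowerSeries.coeff_zero_eq_constantCoeff_apply, PowerSeries.coeff_map,
    PowerSeries.coeff_zero_eq_constantCoeff_apply, h.1, map_one], ?_⟩
  obtain ⟨E, hE⟩ := h.2
  refine ⟨E.map f, ?_⟩
  have := congrArg (PowerSeries.map f) hE
  rw [map_mul, map_pow, PowerSeries.map_X] at this
  rw [← this, map_sub, map_mul, map_mul, PowerSeries.map_X]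
  congr 2
  · ext k
    simp [PowerSeries.coeff_derivative]
  · ext k
    simp only [positivePart, PowerSeries.coeff_mk, PowerSeries.coeff_map]
    split_ifs <;> simp

/-- Comparing coefficients of T^(k+1) in T D' = D · ∑ α_k T^k turns the differential equation into
Newton's recursion. This form is used for uniqueness, for size estimates and by the algorithm. -/
theorem isExpUpTo_iff_coeff {N : ℕ} {D : PowerSeries R} {α : ℕ → R} :
    IsExpUpTo N D α ↔ PowerSeries.coeff 0 D = 1 ∧ ∀ k, k + 1 ≤ N →
      ((k : R) + 1) * PowerSeries.coeff (k + 1) D =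
        ∑ i ∈ Finset.range (k + 1), PowerSeries.coeff i D * α (k + 1 - i) := by
  have key : ∀ k, PowerSeries.coeff (k + 1) (PowerSeries.X * PowerSeries.derivative R D -
      D * positivePart α) = ((k : R) + 1) * PowerSeries.coeff (k + 1) D -
        ∑ i ∈ Finset.range (k + 1), PowerSeries.coeff i D * α (k + 1 - i) := by
    intro k
    rw [map_sub, PowerSeries.coeff_succ_X_mul, PowerSeries.coeff_derivative, mul_comm,
      PowerSeries.coeff_mul, Finset.Nat.sum_antidiagonal_eq_sum_range_succ
        (fun i j => PowerSeries.coeff i D * PowerSeries.coeff j (positivePart α)),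
      Finset.sum_range_succ]
    simp only [positivePart, PowerSeries.coeff_mk, Nat.sub_self, if_true, mul_zero, add_zero]
    congr 1
    refine Finset.sum_congr rfl fun i hi => ?_
    rw [Finset.mem_range] at hi
    rw [if_neg (by omega)]
  rw [IsExpUpTo, PowerSeries.coeff_zero_eq_constantCoeff_apply, PowerSeries.X_pow_dvd_iff]
  refine and_congr_right fun h0 => ⟨fun h k hk => ?_, fun h k hk => ?_⟩
  · have := h (k + 1) (by omega)
    rw [key] at this
    exact sub_eq_zero.1 this
  · cases k with
    | zero => simp [positivePart, h0]
    | succ k => rw [key, h k (by omega), sub_self]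

/-- The recursion determines each coefficient after division by k + 1, which is cancellable in a
domain of characteristic zero. -/
theorem IsExpUpTo.coeff_eq [IsDomain R] [CharZero R] {N : ℕ} {D E : PowerSeries R} {α : ℕ → R}
    (h : IsExpUpTo N D α) (h' : IsExpUpTo N E α) (k : ℕ) (hk : k ≤ N) :
    PowerSeries.coeff k D = PowerSeries.coeff k E := by
  rw [isExpUpTo_iff_coeff] at h h'
  induction k using Nat.strong_induction_on with
  | _ k ih =>
    cases k with
    | zero => rw [h.1, h'.1]
    | succ k =>
      have hk0 : (k : R) + 1 ≠ 0 := by exact_mod_cast Nat.succ_ne_zero k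
      apply mul_left_cancel₀ hk0
      rw [h.2 k hk, h'.2 k hk]
      refine Finset.sum_congr rfl fun i hi => ?_
      rw [Finset.mem_range] at hi
      rw [ih i (by omega) (by omega)]

end LogDerivative

/-! ### Jacobi's formula and det(1 - TA) as an exponential of traces -/

section Determinant

variable {R S : Type*} [CommRing R] [CommRing S] {ι : Type*} [Fintype ι] [DecidableEq ι]

/-- Jacobi's formula for a derivation. -/
theorem Derivation.map_det [Algebra R S] (δ : Derivation R S S) (M : Matrix ι ι S) :
    δ M.det = (M.adjugate * M.map δ).trace := by
  classical
  have h1 : ∀ (s : Finset ι) (f : ι → S),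
      δ (∏ i ∈ s, f i) = ∑ i ∈ s, ∏ j ∈ s, if j = i then δ (f j) else f j := by
    intro s f
    induction s using Finset.induction_on with
    | empty => simp
    | insert a s ha ih =>
      rw [Finset.prod_insert ha, Derivation.leibniz, ih, Finset.sum_insert ha,
        Finset.prod_insert ha, if_pos rfl, smul_eq_mul, smul_eq_mul, add_comm, Finset.mul_sum]
      congr 1
      · rw [mul_comm]
        congr 1
        refine Finset.prod_congr rfl fun j hj => ?_
        rw [if_neg (by rintro rfl; exact ha hj)]
      · refine Finset.sum_congr rfl fun i hi => ?_
        rw [Finset.prod_insert ha, if_neg (by rintro rfl; exact ha hi)]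
  have h2 : ∀ i, (M.updateCol i (fun j => δ (M j i))).det =
      (M.adjugate * M.map δ) i i := by
    intro i
    rw [← Matrix.cramer_apply, Matrix.cramer_eq_adjugate_mulVec]
    rfl
  rw [Matrix.trace]
  simp only [Matrix.diag_apply, ← h2, Matrix.det_apply]
  rw [map_sum, Finset.sum_comm]
  refine Finset.sum_congr rfl fun σ _ => ?_
  rw [Units.smul_def, map_zsmul, h1, Finset.smul_sum]
  refine Finset.sum_congr rfl fun i _ => ?_
  rw [Units.smul_def]
  congr 1
  refine Finset.prod_congr rfl fun j _ => ?_
  rw [Matrix.updateCol_apply]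
  split_ifs with h
  · rw [h]
  · rfl

/-- The reverse characteristic polynomial `det (1 - T A)` as a power series. -/
noncomputable def detSeries (A : Matrix ι ι R) : PowerSeries R :=
  (1 - (PowerSeries.X : PowerSeries R) • A.map PowerSeries.C).det

theorem detSeries_eq_charpolyRev (A : Matrix ι ι R) :
    detSeries A = (A.charpolyRev : PowerSeries R) := by
  rw [Matrix.charpolyRev, detSeries, ← Polynomial.coeToPowerSeries.ringHom_apply, RingHom.map_det]
  congr 1
  ext i j : 2
  rcases eq_or_ne i j with rfl | h
  · simp [mul_comm (PowerSeries.coeff _ _)]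
  · simp [h, mul_comm (PowerSeries.coeff _ _)]

theorem detSeries_map (A : Matrix ι ι R) (f : R →+* S) :
    (detSeries A).map f = detSeries (A.map f) := by
  rw [detSeries, detSeries, RingHom.map_det]
  congr 1
  ext i j : 2
  simp [Matrix.one_apply, apply_ite]

theorem constantCoeff_detSeries (A : Matrix ι ι R) :
    PowerSeries.constantCoeff (detSeries A) = 1 := by
  rw [detSeries, RingHom.map_det]
  convert Matrix.det_one (n := ι) (R := R)
  ext i j
  rcases eq_or_ne i j with rfl | h
  · simp
  · simp [h]

/-- The geometric series G = ∑ A^k T^k inverts 1 - TA, so the adjugate of 1 - TA is det(1 - TA) · G.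
Jacobi's formula then gives T · det' = -det · tr(TAG), and TAG = G - 1 collects the powers A^k with
k ≥ 1. -/
theorem isExpUpTo_detSeries (A : Matrix ι ι R) (N : ℕ) :
    IsExpUpTo N (detSeries A) (fun k => -(A ^ k).trace) := by
  refine ⟨constantCoeff_detSeries A, ?_⟩
  set M : Matrix ι ι (PowerSeries R) :=
    1 - (PowerSeries.X : PowerSeries R) • A.map PowerSeries.C with hM
  let G : Matrix ι ι (PowerSeries R) := Matrix.of fun i j => PowerSeries.mk fun k => (A ^ k) i j
  have hG : (PowerSeries.X : PowerSeries R) • (A.map PowerSeries.C * G) = G - 1 := by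
    ext i j k
    cases k with
    | zero =>
      rcases eq_or_ne i j with rfl | h
      · simp [G]
      · simp [G, h]
    | succ k =>
      rw [Matrix.smul_apply, smul_eq_mul, PowerSeries.coeff_succ_X_mul, Matrix.mul_apply, map_sum]
      simp only [Matrix.map_apply, PowerSeries.coeff_C_mul, G, Matrix.of_apply,
        PowerSeries.coeff_mk, Matrix.sub_apply, map_sub, pow_succ', Matrix.mul_apply]
      rw [Matrix.one_apply]
      split_ifs <;> simp
  have hMG : M * G = 1 := by
    rw [hM, sub_mul, one_mul, smul_mul_assoc, hG, sub_sub_cancel]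
  have hadj : M.adjugate = M.det • G := by
    calc M.adjugate = M.adjugate * (M * G) := by rw [hMG, mul_one]
      _ = M.det • G := by rw [← mul_assoc, Matrix.adjugate_mul, smul_mul_assoc, one_mul]
  have hδ : M.map (PowerSeries.derivative R) = -A.map PowerSeries.C := by
    ext i j : 2
    simp only [hM, Matrix.map_apply, Matrix.sub_apply, Matrix.smul_apply, smul_eq_mul, map_sub,
      Matrix.neg_apply, Derivation.leibniz, PowerSeries.derivative_C, PowerSeries.derivative_X,
      Matrix.one_apply]
    split_ifs <;> simp
  have htr : (G - 1).trace = positivePart fun k => (A ^ k).trace := by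
    ext k
    simp only [positivePart, PowerSeries.coeff_mk, Matrix.trace, Matrix.diag_apply,
      Matrix.sub_apply, map_sum, map_sub, G, Matrix.of_apply, Matrix.one_apply_eq]
    cases k with
    | zero => simp
    | succ k => simp [PowerSeries.coeff_one]
  have : PowerSeries.X * PowerSeries.derivative R (detSeries A) -
      detSeries A * positivePart (fun k => -(A ^ k).trace) = 0 := by
    rw [detSeries, ← hM, Derivation.map_det, hδ, hadj, positivePart_neg, ← htr, ← hG, mul_neg,
      Matrix.trace_neg, smul_mul_assoc, Matrix.trace_smul, Matrix.trace_smul, Matrix.trace_mul_comm]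
    simp only [smul_eq_mul]
    ring
  rw [this]
  exact dvd_zero _

end Determinant

/-! ### Integrality and congruences of exponentials over Witt vectors -/

section WittExp

variable {p : ℕ} [Fact p.Prime] {k : Type} [Field k] [CharP k p]

theorem wittVector_isUnit_natCast {n : ℕ} (h : ¬ p ∣ n) : IsUnit (n : WittVector p k) := by
  apply WittVector.isUnit_of_coeff_zero_ne_zero
  have : (WittVector.constantCoeff : WittVector p k →+* k) n = n := map_natCast _ n
  rw [WittVector.constantCoeff_apply] at this
  rw [this]
  exact fun h0 => h ((CharP.cast_eq_zero_iff k p n).1 h0)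

variable [PerfectRing k p]

theorem wittVector_charZero : CharZero (WittVector p k) := by
  refine charZero_of_inj_zero fun n hn => ?_
  by_contra h0
  obtain ⟨e, n', hn', rfl⟩ := Nat.exists_eq_pow_mul_and_not_dvd h0 p (Fact.out : p.Prime).ne_one
  rw [Nat.cast_mul, Nat.cast_pow] at hn
  rcases mul_eq_zero.1 hn with h | h
  · exact WittVector.p_nonzero p k (eq_zero_of_pow_eq_zero h)
  · exact (wittVector_isUnit_natCast (k := k) hn').ne_zero h

theorem wittVector_constantCoeff_eq_zero_iff (x : WittVector p k) :
    WittVector.constantCoeff x = 0 ↔ (p : WittVector p k) ∣ x := by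
  rw [WittVector.constantCoeff_apply, ← WittVector.mem_span_p_iff_coeff_zero_eq_zero,
    Ideal.mem_span_singleton]

/-- The series `exp (∑ α k / k T^k)` is integral and reduces to `1` modulo `p`. -/
def IsExpTrivial (α : ℕ → WittVector p k) : Prop :=
  ∀ N, ∃ D : PowerSeries (WittVector p k), IsExpUpTo N D α ∧
    D.map (WittVector.constantCoeff : WittVector p k →+* k) = 1

theorem IsExpTrivial.add {α β : ℕ → WittVector p k} (hα : IsExpTrivial α) (hβ : IsExpTrivial β) :
    IsExpTrivial (fun i => α i + β i) := fun N => by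
  obtain ⟨D, hD, hD1⟩ := hα N
  obtain ⟨E, hE, hE1⟩ := hβ N
  exact ⟨D * E, hD.mul hE, by rw [map_mul, hD1, hE1, one_mul]⟩

theorem IsExpTrivial.neg {α : ℕ → WittVector p k} (hα : IsExpTrivial α) :
    IsExpTrivial (fun i => -α i) := fun N => by
  obtain ⟨D, hD, hD1⟩ := hα N
  obtain ⟨E, hE⟩ := exists_mul_eq_one_of_constantCoeff hD.1
  refine ⟨E, hD.inv hE, ?_⟩
  have := congrArg (PowerSeries.map (WittVector.constantCoeff : WittVector p k →+* k)) hE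
  rwa [map_mul, hD1, one_mul, map_one] at this

theorem IsExpTrivial.congr {α β : ℕ → WittVector p k} (hα : IsExpTrivial α)
    (h : ∀ i, 1 ≤ i → α i = β i) : IsExpTrivial β := fun N => by
  obtain ⟨D, hD, hD1⟩ := hα N
  exact ⟨D, hD.congr fun i hi _ => h i hi, hD1⟩

/-- v_p(n!) < n for n ≠ 0, and the part of n! prime to p is a unit. -/
theorem wittVector_exists_factorial_mul {n : ℕ} (hn : n ≠ 0) {x : WittVector p k}
    (hx : (p : WittVector p k) ^ n ∣ x) : ∃ c, (n.factorial : WittVector p k) * c = x := by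
  obtain ⟨z, rfl⟩ := hx
  obtain ⟨e, u, hu, he⟩ := Nat.exists_eq_pow_mul_and_not_dvd n.factorial_ne_zero p
    (Fact.out : p.Prime).ne_one
  have hen : e < n := by
    have h1 := padicValNat_factorial_lt_of_ne_zero p hn
    have h2 : padicValNat p n.factorial = e := by
      rw [he, padicValNat.mul (pow_ne_zero _ (Fact.out : p.Prime).ne_zero)
        (by rintro rfl; exact hu (dvd_zero p)), padicValNat.prime_pow,
        padicValNat.eq_zero_of_not_dvd hu, add_zero]
    omega
  obtain ⟨v, hv⟩ := wittVector_isUnit_natCast (k := k) hu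
  refine ⟨p ^ (n - e) * (↑v⁻¹ * z), ?_⟩
  rw [he, Nat.cast_mul, Nat.cast_pow, ← hv]
  calc (p : WittVector p k) ^ e * v * (p ^ (n - e) * (↑v⁻¹ * z))
      = (p ^ e * p ^ (n - e)) * z * (v * ↑v⁻¹) := by ring
    _ = p ^ n * z := by rw [Units.mul_inv, mul_one, ← pow_add, Nat.add_sub_cancel' hen.le]

theorem wittVector_dvd_of_pow_dvd_factorial_mul {n : ℕ} (hn : n ≠ 0) {c : WittVector p k}
    (hx : (p : WittVector p k) ^ n ∣ n.factorial * c) : (p : WittVector p k) ∣ c := by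
  obtain ⟨z, hz⟩ := hx
  obtain ⟨e, u, hu, he⟩ := Nat.exists_eq_pow_mul_and_not_dvd n.factorial_ne_zero p
    (Fact.out : p.Prime).ne_one
  have hen : e < n := by
    have h1 := padicValNat_factorial_lt_of_ne_zero p hn
    have h2 : padicValNat p n.factorial = e := by
      rw [he, padicValNat.mul (pow_ne_zero _ (Fact.out : p.Prime).ne_zero)
        (by rintro rfl; exact hu (dvd_zero p)), padicValNat.prime_pow,
        padicValNat.eq_zero_of_not_dvd hu, add_zero]
    omega
  have hu' := wittVector_isUnit_natCast (k := k) hu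
  have h3 : (p : WittVector p k) ^ e * (u * c) = p ^ e * (p ^ (n - e) * z) := by
    rw [he, Nat.cast_mul, Nat.cast_pow] at hz
    rw [← mul_assoc, hz, ← mul_assoc, ← pow_add, Nat.add_sub_cancel' hen.le]
  have h4 := mul_left_cancel₀ (pow_ne_zero _ (WittVector.p_nonzero p k)) h3
  rw [← hu'.dvd_mul_left, h4]
  exact Dvd.dvd.mul_right (dvd_pow_self _ (by omega)) z

/-- By the recursion p^k divides k! c_k for the k-th coefficient c_k. Since v_p(k!) < k, the
coefficient is integral and, for k ≥ 1, still divisible by p. -/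
theorem isExpTrivial_of_pow_dvd {α : ℕ → WittVector p k}
    (h : ∀ i, 1 ≤ i → (p : WittVector p k) ^ i ∣ α i) : IsExpTrivial α := by
  have : CharZero (WittVector p k) := wittVector_charZero
  intro N
  -- The series is cut off above N: only its class modulo T^(N+1) is constrained, and the zero tail
  -- makes the reduction exactly 1.
  have main : ∃ C : ℕ → WittVector p k, C 0 = 1 ∧ (∀ j, j + 1 ≤ N →
      ((j : WittVector p k) + 1) * C (j + 1) = ∑ i ∈ Finset.range (j + 1), C i * α (j + 1 - i)) ∧
      (∀ j, j ≤ N → (p : WittVector p k) ^ j ∣ j.factorial * C j) ∧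
      ∀ j, N < j → C j = 0 := by
    induction N with
    | zero =>
      exact ⟨Pi.single 0 1, by simp, by simp, fun j hj => by simp [Nat.le_zero.1 hj],
        fun j hj => by simp [hj.ne']⟩
    | succ N ih =>
      obtain ⟨C, hC0, hC1, hC2, -⟩ := ih
      have h1 : (p : WittVector p k) ^ (N + 1) ∣
          N.factorial * ∑ i ∈ Finset.range (N + 1), C i * α (N + 1 - i) := by
        rw [Finset.mul_sum]
        refine Finset.dvd_sum fun i hi => ?_
        rw [Finset.mem_range] at hi
        obtain ⟨r, hr⟩ := Nat.factorial_dvd_factorial (Nat.lt_succ_iff.1 hi)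
        have := mul_dvd_mul (hC2 i (by omega)) (h (N + 1 - i) (by omega))
        rw [← pow_add, Nat.add_sub_cancel' hi.le] at this
        refine this.trans ⟨r, ?_⟩
        rw [hr, Nat.cast_mul]
        ring
      obtain ⟨c, hc⟩ := wittVector_exists_factorial_mul (Nat.succ_ne_zero N) h1
      refine ⟨fun j => if j ≤ N then C j else if j = N + 1 then c else 0, by simp [hC0],
        fun j hj => ?_, fun j hj => ?_, fun j hj => ?_⟩
      · have hsum : ∑ i ∈ Finset.range (j + 1),
            (if i ≤ N then C i else if i = N + 1 then c else 0) * α (j + 1 - i) =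
            ∑ i ∈ Finset.range (j + 1), C i * α (j + 1 - i) := by
          refine Finset.sum_congr rfl fun i hi => ?_
          rw [Finset.mem_range] at hi
          rw [if_pos (by omega)]
        dsimp only
        rw [hsum]
        rcases Nat.lt_or_ge j N with hjN | hjN
        · rw [if_pos (by omega), hC1 j hjN]
        · obtain rfl : j = N := by omega
          rw [if_neg (by omega), if_pos rfl]
          apply mul_left_cancel₀ (Nat.cast_ne_zero.2 j.factorial_ne_zero)
          rw [← hc, Nat.factorial_succ]
          push_cast
          ring
      · dsimp only
        rcases Nat.lt_or_ge N j with hjN | hjN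
        · obtain rfl : j = N + 1 := by omega
          rw [if_neg (by omega), if_pos rfl, hc]
          exact h1
        · rw [if_pos hjN]
          exact hC2 j hjN
      · dsimp only
        rw [if_neg (by omega), if_neg (by omega)]
  obtain ⟨C, hC0, hC1, hC2, hC3⟩ := main
  refine ⟨PowerSeries.mk C, isExpUpTo_iff_coeff.2 ⟨by simpa using hC0, fun j hj => ?_⟩, ?_⟩
  · simpa only [PowerSeries.coeff_mk] using hC1 j hj
  · ext j
    rw [PowerSeries.coeff_map, PowerSeries.coeff_mk, PowerSeries.coeff_one]
    split_ifs with hj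
    · rw [hj, hC0, map_one]
    · rw [wittVector_constantCoeff_eq_zero_iff]
      rcases Nat.lt_or_ge N j with hjN | hjN
      · rw [hC3 j hjN]
        exact dvd_zero _
      · exact wittVector_dvd_of_pow_dvd_factorial_mul hj (hC2 j hjN)

/-- If `α - β` is trivial, the exponentials of `α` and `β` agree modulo `p`. -/
theorem IsExpTrivial.map_coeff_eq {α β : ℕ → WittVector p k}
    (h : IsExpTrivial fun i => α i - β i) {D E : PowerSeries (WittVector p k)}
    (hD : ∀ N, IsExpUpTo N D α) (hE : ∀ N, IsExpUpTo N E β) :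
    D.map (WittVector.constantCoeff : WittVector p k →+* k) =
      E.map (WittVector.constantCoeff : WittVector p k →+* k) := by
  have : CharZero (WittVector p k) := wittVector_charZero
  ext j
  obtain ⟨G, hG, hG1⟩ := h j
  have h1 := (hD j).coeff_eq ((hG.mul (hE j)).congr fun i _ _ => sub_add_cancel _ _) j le_rfl
  rw [PowerSeries.coeff_map, h1, ← PowerSeries.coeff_map, map_mul, hG1, one_mul]

end WittExp

/-! ### Weighted matrices of self-maps -/

section Weighted

variable {R : Type*} [CommRing R] {Y : Type*} [Fintype Y] [DecidableEq Y]

/-- The matrix of the self-map `s`, with weights `w`. -/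
def weightedMap (s : Y → Y) (w : Y → R) : Matrix Y Y R :=
  Matrix.of fun x y => if y = s x then w x else 0

theorem weightedMap_pow (s : Y → Y) (w : Y → R) (k : ℕ) (x y : Y) :
    (weightedMap s w ^ k) x y =
      if y = s^[k] x then ∏ i ∈ Finset.range k, w (s^[i] x) else 0 := by
  induction k generalizing x with
  | zero =>
    rcases eq_or_ne y x with rfl | h
    · simp
    · simp [h, h.symm]
  | succ k ih =>
    rw [pow_succ', Matrix.mul_apply, Finset.sum_eq_single (s x)]
    · rw [ih, Function.iterate_succ_apply, Finset.prod_range_succ']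
      simp only [weightedMap, Matrix.of_apply, if_true, Function.iterate_succ_apply,
        Function.iterate_zero_apply]
      split_ifs
      · ring
      · ring
    · intro z _ hz
      simp [weightedMap, hz]
    · simp

theorem trace_weightedMap_pow (s : Y → Y) (w : Y → R) (k : ℕ) :
    (weightedMap s w ^ k).trace =
      ∑ x ∈ Finset.univ.filter (fun x => s^[k] x = x), ∏ i ∈ Finset.range k, w (s^[i] x) := by
  rw [Matrix.trace, Finset.sum_filter]
  refine Finset.sum_congr rfl fun x _ => ?_
  rw [Matrix.diag_apply, weightedMap_pow]
  simp only [eq_comm]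

theorem weightedMap_map {S : Type*} [CommRing S] (f : R →+* S) (s : Y → Y) (w : Y → R) :
    (weightedMap s w).map f = weightedMap s (fun x => f (w x)) := by
  ext x y
  simp only [weightedMap, Matrix.map_apply, Matrix.of_apply]
  split_ifs <;> simp

end Weighted

/-! ### Rational points inside an algebraic closure, and Frobenius -/

section Points

variable (p : ℕ) [hp : Fact p.Prime]

/-- An algebraic closure of the prime field. -/
abbrev Fbar : Type := AlgebraicClosure (ZMod p)

/-- The elements of the field with `p ^ j` elements (none for `j = 0`). -/
noncomputable def frobFixed (j : ℕ) : Finset (Fbar p) :=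
  open Classical in (X ^ p ^ j - X : (Fbar p)[X]).roots.toFinset

variable {p}

theorem mem_frobFixed {j : ℕ} (hj : j ≠ 0) {x : Fbar p} : x ∈ frobFixed p j ↔ x ^ p ^ j = x := by
  classical
  rw [frobFixed, Multiset.mem_toFinset, Polynomial.mem_roots
    (FiniteField.X_pow_card_pow_sub_X_ne_zero _ hj hp.out.one_lt)]
  simp [sub_eq_zero]

theorem map_mem_frobFixed {G : Type*} [Field G] [Fintype G] {j : ℕ} (hj : j ≠ 0)
    (hG : Fintype.card G = p ^ j) (φ : G →+* Fbar p) (y : G) : φ y ∈ frobFixed p j := by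
  rw [mem_frobFixed hj, ← map_pow, ← hG, FiniteField.pow_card]

theorem frobFixed_eq_map {G : Type*} [Field G] [Fintype G] {j : ℕ} (hj : j ≠ 0)
    (hG : Fintype.card G = p ^ j) (φ : G →+* Fbar p) :
    frobFixed p j = Finset.univ.map ⟨φ, φ.injective⟩ := by
  classical
  symm
  apply Finset.eq_of_subset_of_card_le
  · intro x hx
    obtain ⟨y, -, rfl⟩ := Finset.mem_map.1 hx
    exact map_mem_frobFixed hj hG φ y
  · rw [Finset.card_map, Finset.card_univ, hG, frobFixed]
    refine (Multiset.toFinset_card_le _).trans ((Polynomial.card_roots' _).trans ?_)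
    rw [FiniteField.X_pow_card_pow_sub_X_natDegree_eq _ hj hp.out.one_lt]

theorem exists_ringHom_fbar {j : ℕ} (hj : j ≠ 0) :
    ∃ (G : Type) (_ : Field G) (_ : Fintype G) (_ : G →+* Fbar p), Fintype.card G = p ^ j := by
  classical
  refine ⟨GaloisField p j, inferInstance, Fintype.ofFinite _,
    (IsAlgClosed.lift : GaloisField p j →ₐ[ZMod p] Fbar p).toRingHom, ?_⟩
  rw [Fintype.card_eq_nat_card, GaloisField.card p j hj]

theorem card_frobFixed {j : ℕ} (hj : j ≠ 0) : (frobFixed p j).card = p ^ j := by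
  obtain ⟨G, _, _, φ, hG⟩ := exists_ringHom_fbar (p := p) hj
  rw [frobFixed_eq_map hj hG φ, Finset.card_map, Finset.card_univ, hG]

variable (p) in
/-- The points of affine `n`-space over the field with `p ^ j` elements. -/
noncomputable def frobPoints (n j : ℕ) : Finset (Fin n → Fbar p) :=
  Fintype.piFinset fun _ => frobFixed p j

theorem mem_frobPoints {n j : ℕ} (hj : j ≠ 0) {x : Fin n → Fbar p} :
    x ∈ frobPoints p n j ↔ ∀ i, x i ^ p ^ j = x i := by
  simp only [frobPoints, Fintype.mem_piFinset, mem_frobFixed hj]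

theorem card_frobPoints {n j : ℕ} (hj : j ≠ 0) : (frobPoints p n j).card = p ^ (j * n) := by
  simp [frobPoints, Fintype.card_piFinset, card_frobFixed hj, pow_mul]

theorem pow_mem_frobPoints {n j : ℕ} (hj : j ≠ 0) {x : Fin n → Fbar p}
    (hx : x ∈ frobPoints p n j) (m : ℕ) : (fun i => x i ^ m) ∈ frobPoints p n j := by
  rw [mem_frobPoints hj] at hx ⊢
  intro i
  rw [← pow_mul, mul_comm, pow_mul, hx]

theorem frobPoints_subset {n j l : ℕ} (hj : j ≠ 0) (hl : l ≠ 0) (h : j ∣ l) :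
    frobPoints p n j ⊆ frobPoints p n l := by
  intro x hx
  rw [mem_frobPoints hj] at hx
  rw [mem_frobPoints hl]
  intro i
  obtain ⟨c, rfl⟩ := h
  have : ∀ c, x i ^ p ^ (j * c) = x i := by
    intro c
    induction c with
    | zero => simp
    | succ c ih => rw [Nat.mul_succ, pow_add, pow_mul, ih, hx]
  exact this c

open Classical in
/-- The `q`-power Frobenius on the points of affine space over the field with `p ^ j` elements. -/
noncomputable def frobMap (n j q : ℕ) (hj : j ≠ 0) (x : frobPoints p n j) : frobPoints p n j :=
  ⟨fun i => x.1 i ^ q, pow_mem_frobPoints hj x.2 q⟩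

theorem frobMap_iterate {n j q : ℕ} (hj : j ≠ 0) (k : ℕ) (x : frobPoints p n j) :
    ((frobMap n j q hj)^[k] x).1 = fun i => x.1 i ^ q ^ k := by
  induction k with
  | zero => simp
  | succ k ih =>
    rw [Function.iterate_succ_apply']
    funext i
    simp only [frobMap, ih]
    rw [← pow_mul, ← pow_succ]

-- The points over 𝔽_{p^(r·N!)} contain those over 𝔽_{p^(rk)} for every k ≤ N, and the latter are
-- the fixed points of the k-th iterate of Frobenius. So one finite matrix has all the wanted sums
-- as traces of its first N powers.
open Classical in
theorem trace_weightedMap_frobMap {R : Type*} [CommRing R] {n r : ℕ} (hr : r ≠ 0) {N : ℕ}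
    (hj : r * N.factorial ≠ 0) (w : (Fin n → Fbar p) → R) {k : ℕ} (hk : 1 ≤ k) (hkN : k ≤ N) :
    (weightedMap (frobMap n (r * N.factorial) (p ^ r) hj) (fun x => w x.1) ^ k).trace =
      ∑ x ∈ frobPoints p n (r * k), ∏ i ∈ Finset.range k, w (fun l => x l ^ (p ^ r) ^ i) := by
  have hrk : r * k ≠ 0 := mul_ne_zero hr (by omega)
  rw [trace_weightedMap_pow]
  refine Finset.sum_bij (fun x _ => x.1) ?_ ?_ ?_ ?_
  · intro x hx
    rw [Finset.mem_filter] at hx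
    have := congrArg Subtype.val hx.2
    rw [frobMap_iterate] at this
    rw [mem_frobPoints hrk]
    intro i
    rw [pow_mul]
    exact congrFun this i
  · intro x _ y _ h
    exact Subtype.ext h
  · intro x hx
    refine ⟨⟨x, frobPoints_subset hrk hj (mul_dvd_mul_left r (Nat.dvd_factorial hk hkN)) hx⟩,
      ?_, rfl⟩
    rw [Finset.mem_filter]
    refine ⟨Finset.mem_univ _, Subtype.ext ?_⟩
    rw [frobMap_iterate]
    funext i
    dsimp only
    rw [← pow_mul]
    exact (mem_frobPoints hrk).1 hx i
  · intro x _
    refine Finset.prod_congr rfl fun i _ => ?_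
    rw [frobMap_iterate]

/-- The numbers of points of a Frobenius-stable set define an integral exponential series. -/
theorem exists_isExpUpTo_card {n r : ℕ} (hr : r ≠ 0) (S : Set (Fin n → Fbar p))
    (hS : ∀ x ∈ S, (fun i => x i ^ p ^ r) ∈ S) [DecidablePred (· ∈ S)] (N : ℕ) :
    ∃ D : PowerSeries ℤ, IsExpUpTo N D
      (fun k => (((frobPoints p n (r * k)).filter (· ∈ S)).card : ℤ)) := by
  classical
  have hj : r * N.factorial ≠ 0 := mul_ne_zero hr N.factorial_ne_zero
  -- With the indicator of S as weight, the product along an orbit is the indicator at its start, as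
  -- S is stable. The exponential is therefore the inverse of det(1 - TA), which is integral.
  set A := weightedMap (frobMap n (r * N.factorial) (p ^ r) hj)
    (fun x => if x.1 ∈ S then (1 : ℤ) else 0) with hA
  obtain ⟨E, hE⟩ := exists_mul_eq_one_of_constantCoeff (constantCoeff_detSeries A)
  refine ⟨E, ((isExpUpTo_detSeries A N).inv hE).congr fun k hk hkN => ?_⟩
  rw [neg_neg, hA, trace_weightedMap_frobMap hr hj (fun x => if x ∈ S then (1 : ℤ) else 0) hk hkN,
    Finset.card_filter, Nat.cast_sum]
  refine Finset.sum_congr rfl fun x _ => ?_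
  have hit : ∀ i, x ∈ S → (fun l => x l ^ (p ^ r) ^ i) ∈ S := by
    intro i hx
    induction i with
    | zero => simpa using hx
    | succ i ih =>
      have := hS _ ih
      simp only [← pow_mul] at this ⊢
      rwa [Nat.mul_succ, pow_add]
  by_cases hx : x ∈ S
  · rw [if_pos hx, Nat.cast_one]
    exact Finset.prod_eq_one fun i _ => if_pos (hit i hx)
  · rw [if_neg hx, Nat.cast_zero]
    refine Finset.prod_eq_zero (Finset.mem_range.2 hk) ?_
    rw [if_neg]
    simpa using hx

end Points

/-! ### The operator ψ_q, its matrix and its powers -/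

section Cartier

variable {R S : Type*} [CommSemiring R] [CommSemiring S] {n : ℕ}

/-- The exponent vector with the positive entries `u i + 1`. -/
noncomputable def boxExponent {D : ℕ} (u : Fin n → Fin D) : Fin n →₀ ℕ :=
  Finsupp.equivFunOnFinite.symm fun i => (u i : ℕ) + 1

@[simp] theorem boxExponent_apply {D : ℕ} (u : Fin n → Fin D) (i : Fin n) :
    boxExponent u i = u i + 1 := rfl

theorem boxExponent_injective {D : ℕ} :
    Function.Injective (boxExponent : (Fin n → Fin D) → Fin n →₀ ℕ) := by
  intro u v h
  funext i
  have := DFunLike.congr_fun h i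
  simp only [boxExponent_apply] at this
  exact Fin.ext (by omega)

theorem exists_boxExponent_eq {D : ℕ} {e : Fin n →₀ ℕ} (h0 : ∀ i, 0 < e i) (hD : ∀ i, e i ≤ D) :
    ∃ u : Fin n → Fin D, boxExponent u = e := by
  refine ⟨fun i => ⟨e i - 1, by have := h0 i; have := hD i; omega⟩, ?_⟩
  ext i
  have := h0 i
  simp only [boxExponent_apply]
  omega

/-- The matrix of `h ↦ ψ_q (G h)` on the span of the monomials with exponents in `[1, D]`, where
`ψ_q` keeps the monomials that are `q`-th powers and takes their roots. -/
noncomputable def cartierMatrix (q D : ℕ) (G : MvPolynomial (Fin n) R) :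
    Matrix (Fin n → Fin D) (Fin n → Fin D) R :=
  Matrix.of fun v u =>
    MvPolynomial.coeff (q • boxExponent v) (G * MvPolynomial.monomial (boxExponent u) 1)

theorem cartierMatrix_map (q D : ℕ) (G : MvPolynomial (Fin n) R) (f : R →+* S) :
    (cartierMatrix q D G).map f = cartierMatrix q D (MvPolynomial.map f G) := by
  ext v u
  simp only [cartierMatrix, Matrix.map_apply, Matrix.of_apply]
  rw [← MvPolynomial.coeff_map, map_mul, MvPolynomial.map_monomial, map_one]

/-- The product `∏_{i < k} G(x^{q^i})`. -/
noncomputable def frobProduct (q : ℕ) (G : MvPolynomial (Fin n) R) (k : ℕ) :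
    MvPolynomial (Fin n) R :=
  ∏ i ∈ Finset.range k, MvPolynomial.expand (q ^ i) G

theorem frobProduct_succ (q : ℕ) (G : MvPolynomial (Fin n) R) (k : ℕ) :
    frobProduct q G (k + 1) = MvPolynomial.expand q (frobProduct q G k) * G := by
  rw [frobProduct, Finset.prod_range_succ', frobProduct, map_prod]
  simp only [pow_zero, MvPolynomial.expand_one_apply, pow_succ', MvPolynomial.expand_mul]

/-- This is the projection formula ψ_q(g(x^q) h) = g ψ_q(h), read off coefficient by coefficient. -/
theorem coeff_expand_mul_eq_sum {q : ℕ} (hq : q ≠ 0) (g h : MvPolynomial (Fin n) R)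
    (m : Fin n →₀ ℕ) :
    MvPolynomial.coeff (q • m) (MvPolynomial.expand q g * h) =
      ∑ a ∈ g.support, if a ≤ m then
        MvPolynomial.coeff a g * MvPolynomial.coeff (q • (m - a)) h else 0 := by
  conv_lhs => rw [MvPolynomial.as_sum g, map_sum, Finset.sum_mul, MvPolynomial.coeff_sum]
  refine Finset.sum_congr rfl fun a _ => ?_
  rw [MvPolynomial.expand_monomial, MvPolynomial.coeff_monomial_mul']
  have hle : q • a ≤ q • m ↔ a ≤ m := by
    simp only [Finsupp.le_def, Finsupp.smul_apply, smul_eq_mul]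
    exact forall_congr' fun i => Nat.mul_le_mul_left_iff (Nat.pos_of_ne_zero hq)
  simp only [hle]
  split_ifs with h1
  · congr 2
    ext i
    simp [Nat.mul_sub]
  · rfl

/-- The span of the monomials with exponents in [1, D] is stable under h ↦ ψ_q(G h): if q w occurs,
then q w_i ≥ u_i + 1 > 0, and q w_i ≤ (q - 1) D + D. -/
theorem exists_boxExponent_of_coeff_ne_zero {q D : ℕ} (hq : q ≠ 0) {G : MvPolynomial (Fin n) R}
    (hG : ∀ i, G.degreeOf i ≤ (q - 1) * D) (u : Fin n → Fin D) {w : Fin n →₀ ℕ}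
    (h : MvPolynomial.coeff (q • w) (G * MvPolynomial.monomial (boxExponent u) 1) ≠ 0) :
    ∃ v : Fin n → Fin D, boxExponent v = w := by
  rw [MvPolynomial.coeff_mul_monomial'] at h
  split_ifs at h with hle
  swap
  · exact absurd rfl h
  rw [mul_one] at h
  have hle' : ∀ i, (u i : ℕ) + 1 ≤ q * w i := fun i => by simpa using hle i
  apply exists_boxExponent_eq
  · intro i
    rcases Nat.eq_zero_or_pos (w i) with h0 | h0
    · have := hle' i
      rw [h0, mul_zero] at this
      omega
    · exact h0
  · intro i
    have h1 := (MvPolynomial.degreeOf_le_iff.1 (hG i)) _ (MvPolynomial.mem_support_iff.2 h)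
    simp only [Finsupp.coe_tsub, Pi.sub_apply, Finsupp.smul_apply, smul_eq_mul,
      boxExponent_apply] at h1
    have h2 := (u i).2
    have h3 : q * D = (q - 1) * D + D := by
      obtain ⟨q, rfl⟩ := Nat.exists_eq_succ_of_ne_zero hq
      simp [Nat.succ_mul]
    have h4 : q * w i ≤ q * D := by omega
    exact Nat.le_of_mul_le_mul_left h4 (Nat.pos_of_ne_zero hq)

theorem sum_support_eq_sum_box {D : ℕ} (g : MvPolynomial (Fin n) R) (c : (Fin n →₀ ℕ) → R)
    (hc : ∀ w, c w ≠ 0 → ∃ v : Fin n → Fin D, boxExponent v = w) (M : Fin n →₀ ℕ) :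
    ∑ w : Fin n → Fin D, (if boxExponent w ≤ M then MvPolynomial.coeff (M - boxExponent w) g
      else 0) * c (boxExponent w) =
    ∑ a ∈ g.support, if a ≤ M then MvPolynomial.coeff a g * c (M - a) else 0 := by
  have hle : ∀ w : Fin n → Fin D, (if boxExponent w ≤ M then
      MvPolynomial.coeff (M - boxExponent w) g else 0) * c (boxExponent w) ≠ 0 →
      boxExponent w ≤ M := fun w hw => by
    by_contra h0
    exact hw (by rw [if_neg h0, zero_mul])
  refine Finset.sum_bij_ne_zero (fun w _ _ => M - boxExponent w) ?_ ?_ ?_ ?_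
  · intro w _ hw
    rw [if_pos (hle w hw)] at hw
    exact MvPolynomial.mem_support_iff.2 (left_ne_zero_of_mul hw)
  · intro w _ hw v _ hv h
    apply boxExponent_injective
    rw [← tsub_tsub_cancel_of_le (hle w hw), h, tsub_tsub_cancel_of_le (hle v hv)]
  · intro a _ ha
    have haM : a ≤ M := by
      by_contra h0
      exact ha (if_neg h0)
    rw [if_pos haM] at ha
    obtain ⟨w, hw⟩ := hc _ (right_ne_zero_of_mul ha)
    refine ⟨w, Finset.mem_univ _, ?_, ?_⟩
    · rw [hw, if_pos tsub_le_self, tsub_tsub_cancel_of_le haM]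
      exact ha
    · rw [hw, tsub_tsub_cancel_of_le haM]
  · intro w _ hw
    rw [if_pos (hle w hw), if_pos tsub_le_self, tsub_tsub_cancel_of_le (hle w hw)]

/-- Iterating the projection formula collects the factors G(x^{q^i}) into a single product followed
by ψ_{q^k}. Stability of the box ensures that the matrix product misses no intermediate monomial. -/
theorem cartierMatrix_pow {q D : ℕ} (hq : q ≠ 0) {G : MvPolynomial (Fin n) R}
    (hG : ∀ i, G.degreeOf i ≤ (q - 1) * D) (k : ℕ) (v u : Fin n → Fin D) :
    (cartierMatrix q D G ^ k) v u = MvPolynomial.coeff (q ^ k • boxExponent v)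
      (frobProduct q G k * MvPolynomial.monomial (boxExponent u) 1) := by
  induction k generalizing u with
  | zero =>
    rw [pow_zero, frobProduct, Finset.prod_range_zero, one_mul, pow_zero, one_smul,
      MvPolynomial.coeff_monomial, Matrix.one_apply]
    exact if_congr ⟨fun h => by rw [h], fun h => (boxExponent_injective h).symm⟩ rfl rfl
  | succ k ih =>
    rw [pow_succ, Matrix.mul_apply, frobProduct_succ, mul_assoc, pow_succ', mul_smul,
      coeff_expand_mul_eq_sum hq, ← sum_support_eq_sum_box (D := D) (frobProduct q G k)
        (fun w => MvPolynomial.coeff (q • w) (G * MvPolynomial.monomial (boxExponent u) 1))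
        (fun w hw => exists_boxExponent_of_coeff_ne_zero hq hG u hw)]
    refine Finset.sum_congr rfl fun w _ => ?_
    rw [ih, MvPolynomial.coeff_mul_monomial', mul_one]
    rfl

theorem trace_cartierMatrix_pow {q D : ℕ} (hq : q ≠ 0) {G : MvPolynomial (Fin n) R}
    (hG : ∀ i, G.degreeOf i ≤ (q - 1) * D) (k : ℕ) :
    (cartierMatrix q D G ^ k).trace = ∑ u : Fin n → Fin D,
      MvPolynomial.coeff ((q ^ k - 1) • boxExponent u) (frobProduct q G k) := by
  rw [Matrix.trace]
  refine Finset.sum_congr rfl fun u _ => ?_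
  rw [Matrix.diag_apply, cartierMatrix_pow hq hG, MvPolynomial.coeff_mul_monomial', mul_one]
  have h1 : 1 ≤ q ^ k := Nat.one_le_pow _ _ (Nat.pos_of_ne_zero hq)
  rw [if_pos]
  · congr 1
    ext i
    simp [Nat.sub_mul]
  · intro i
    simp only [Finsupp.smul_apply, smul_eq_mul]
    exact Nat.le_mul_of_pos_left _ h1

theorem degreeOf_frobProduct {q D : ℕ} (hq : q ≠ 0) {G : MvPolynomial (Fin n) R}
    (hG : ∀ i, G.degreeOf i ≤ (q - 1) * D) (k : ℕ) (i : Fin n) :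
    (frobProduct q G k).degreeOf i ≤ (q ^ k - 1) * D := by
  classical
  induction k with
  | zero => simp [frobProduct]
  | succ k ih =>
    rw [frobProduct_succ]
    refine (MvPolynomial.degreeOf_mul_le _ _ _).trans ?_
    have h1 : (MvPolynomial.expand q (frobProduct q G k)).degreeOf i ≤
        q * ((q ^ k - 1) * D) := by
      rw [MvPolynomial.degreeOf_le_iff]
      intro m hm
      obtain ⟨a, ha, rfl⟩ := Finset.mem_image.1 (MvPolynomial.support_expand_subset _ hm)
      have := MvPolynomial.degreeOf_le_iff.1 ih a ha
      simp only [Finsupp.smul_apply, smul_eq_mul]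
      exact Nat.mul_le_mul_left q this
    refine (add_le_add h1 (hG i)).trans (le_of_eq ?_)
    rw [← mul_assoc, ← add_mul]
    congr 1
    have h2 : 1 ≤ q ^ k := Nat.one_le_pow _ _ (Nat.pos_of_ne_zero hq)
    rw [Nat.mul_sub, mul_one, pow_succ', Nat.sub_add_sub_cancel]
    · exact Nat.le_mul_of_pos_right _ h2
    · omega

end Cartier

/-! ### Invariance of det(1 - TA) under conjugation -/

section Conjugation

/-- Taking determinants of P(1 - TA) = (1 - TB)P, the factor det P cancels in a domain of power
series; P need not be invertible over R. -/
theorem detSeries_eq_of_conj {R : Type*} [CommRing R] [IsDomain R] {ι : Type*} [Fintype ι]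
    [DecidableEq ι] {A B P : Matrix ι ι R} (hP : P.det ≠ 0) (h : P * A = B * P) :
    detSeries A = detSeries B := by
  have hmap : ∀ M N : Matrix ι ι R, (M * N).map (PowerSeries.C : R →+* PowerSeries R) =
      M.map PowerSeries.C * N.map PowerSeries.C := fun M N => Matrix.map_mul
  have h1 : P.map PowerSeries.C * (1 - (PowerSeries.X : PowerSeries R) • A.map PowerSeries.C) =
      (1 - (PowerSeries.X : PowerSeries R) • B.map PowerSeries.C) * P.map PowerSeries.C := by
    rw [mul_sub, sub_mul, mul_one, one_mul, mul_smul_comm, smul_mul_assoc, ← hmap, ← hmap, h]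
  have h2 := congrArg Matrix.det h1
  rw [Matrix.det_mul, Matrix.det_mul, mul_comm] at h2
  have h3 : (P.map (PowerSeries.C : R →+* PowerSeries R)).det ≠ 0 := by
    have := RingHom.map_det (PowerSeries.C : R →+* PowerSeries R) P
    rw [RingHom.mapMatrix_apply] at this
    rw [← this]
    exact fun h0 => hP (by simpa using congrArg PowerSeries.constantCoeff h0)
  exact mul_right_cancel₀ h3 h2

end Conjugation

/-! ### Character sums over Teichmüller points -/

section Teichmuller

variable {p : ℕ} [hp : Fact p.Prime]

/-- The coordinatewise Teichmüller lift. -/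
noncomputable def teichPoint {n : ℕ} (x : Fin n → Fbar p) : Fin n → WittVector p (Fbar p) :=
  fun i => WittVector.teichmuller p (x i)

theorem constantCoeff_teichmuller (x : Fbar p) :
    WittVector.constantCoeff (WittVector.teichmuller p x) = x := by
  rw [WittVector.constantCoeff_apply, WittVector.teichmuller_coeff_zero]

/-- Orthogonality: u ↦ [u]^e is a character of a cyclic group of order p^j - 1, trivial exactly when
p^j - 1 divides e. The point 0 contributes only for e = 0. -/
theorem sum_teichmuller_pow {j : ℕ} (hj : j ≠ 0) (e : ℕ) :
    ∑ x ∈ frobFixed p j, WittVector.teichmuller p x ^ e =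
      if e = 0 then (p : WittVector p (Fbar p)) ^ j else
        if (p ^ j - 1) ∣ e then (p : WittVector p (Fbar p)) ^ j - 1 else 0 := by
  classical
  obtain ⟨G, _, _, φ, hG⟩ := exists_ringHom_fbar (p := p) hj
  rw [frobFixed_eq_map hj hG φ, Finset.sum_map]
  simp only [Function.Embedding.coeFn_mk]
  rcases eq_or_ne e 0 with rfl | he
  · simp [hG]
  rw [if_neg he]
  let f : Gˣ →* WittVector p (Fbar p) :=
    { toFun := fun u => WittVector.teichmuller p (φ (u : G)) ^ e
      map_one' := by simp
      map_mul' := fun u v => by simp [mul_pow] }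
  have hsum : ∑ x : G, WittVector.teichmuller p (φ x) ^ e = ∑ u : Gˣ, f u := by
    symm
    refine Finset.sum_of_injOn (fun u : Gˣ => (u : G)) (fun u _ v _ h => Units.ext h)
      (fun _ _ => Finset.mem_coe.2 (Finset.mem_univ _)) ?_ (fun _ _ => rfl)
    intro x _ hx
    rcases eq_or_ne x 0 with rfl | h0
    · rw [map_zero, WittVector.teichmuller_zero, zero_pow he]
    · exact absurd ⟨Units.mk0 x h0, by simp, rfl⟩ hx
  have hinj : Function.Injective (WittVector.teichmuller p : Fbar p → WittVector p (Fbar p)) :=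
    fun x y h => by rw [← constantCoeff_teichmuller x, h, constantCoeff_teichmuller]
  have hf : f = 1 ↔ (p ^ j - 1) ∣ e := by
    rw [← hG, ← FiniteField.forall_pow_eq_one_iff G e, DFunLike.ext_iff]
    refine forall_congr' fun u => ?_
    change WittVector.teichmuller p (φ (u : G)) ^ e = 1 ↔ _
    rw [← map_pow, ← map_pow, ← map_one (WittVector.teichmuller p), hinj.eq_iff,
      ← map_one φ, φ.injective.eq_iff, ← Units.val_pow_eq_pow_val, Units.val_eq_one]
  rw [hsum, sum_hom_units, Fintype.card_units, hG]
  simp only [hf]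
  split_ifs
  · rw [Nat.cast_sub (Nat.one_le_pow _ _ hp.out.pos)]
    simp
  · simp

/-- The sum of the values of a polynomial at the Teichmüller points, modulo the cardinality of the
field. -/
theorem dvd_sum_eval_teichPoint {n j : ℕ} (hj : j ≠ 0)
    (G : MvPolynomial (Fin n) (WittVector p (Fbar p))) {D : ℕ}
    (hD : ∀ i, G.degreeOf i ≤ (p ^ j - 1) * D) :
    (p : WittVector p (Fbar p)) ^ j ∣ ∑ x ∈ frobPoints p n j, MvPolynomial.eval (teichPoint x) G -
      (-1) ^ n * ∑ u : Fin n → Fin D, MvPolynomial.coeff ((p ^ j - 1) • boxExponent u) G := by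
  classical
  set Q : WittVector p (Fbar p) := (p : WittVector p (Fbar p)) ^ j with hQ
  rw [← Ideal.mem_span_singleton, ← Ideal.Quotient.eq]
  set π := Ideal.Quotient.mk (Ideal.span {Q}) with hπ
  have hπQ : π Q = 0 := Ideal.Quotient.eq_zero_iff_mem.2 (Ideal.mem_span_singleton_self Q)
  -- Modulo p^j the power sum is -1 at positive multiples of p^j - 1 and 0 elsewhere: the case e = 0
  -- vanishes too. Hence only strictly positive exponents survive, which is why the box starts at 1.
  let c : ℕ → WittVector p (Fbar p) ⧸ Ideal.span {Q} := fun e =>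
    if 0 < e ∧ (p ^ j - 1) ∣ e then -1 else 0
  have hc : ∀ e, π (∑ x ∈ frobFixed p j, WittVector.teichmuller p x ^ e) = c e := by
    intro e
    rw [sum_teichmuller_pow hj e]
    simp only [c, ← hQ]
    rcases Nat.eq_zero_or_pos e with rfl | he
    · simp [hπQ]
    · by_cases h : (p ^ j - 1) ∣ e
      · simp [he, he.ne', h, hπQ]
      · simp [he.ne', h]
  have hp1 : 1 < p ^ j := Nat.one_lt_pow hj hp.out.one_lt
  have key : ∀ e ∈ G.support, π (MvPolynomial.coeff e G) * ∏ i, c (e i) =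
      if ∃ u : Fin n → Fin D, (p ^ j - 1) • boxExponent u = e then
        (-1) ^ n * π (MvPolynomial.coeff e G) else 0 := by
    intro e he
    by_cases hall : ∀ i, 0 < e i ∧ (p ^ j - 1) ∣ e i
    · have h1 : ∏ i, c (e i) = (-1) ^ n := by
        rw [Finset.prod_congr rfl fun i _ => if_pos (hall i)]
        simp
      have h2 : ∃ u : Fin n → Fin D, (p ^ j - 1) • boxExponent u = e := by
        choose w hw using fun i => (hall i).2
        have h3 := exists_boxExponent_eq (D := D) (e := Finsupp.equivFunOnFinite.symm w)
          (fun i => by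
            have := (hall i).1
            rw [hw i] at this
            exact Nat.pos_of_mul_pos_left this)
          (fun i => by
            have := MvPolynomial.degreeOf_le_iff.1 (hD i) e he
            rw [hw i] at this
            exact Nat.le_of_mul_le_mul_left this (by omega))
        obtain ⟨u, hu⟩ := h3
        refine ⟨u, ?_⟩
        rw [hu]
        ext i
        simp [hw i]
      rw [h1, if_pos h2, mul_comm]
    · rw [if_neg]
      · obtain ⟨i, hi⟩ := not_forall.1 hall
        rw [Finset.prod_eq_zero (Finset.mem_univ i) (if_neg hi), mul_zero]
      · rintro ⟨u, rfl⟩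
        apply hall
        intro i
        simp only [Finsupp.smul_apply, smul_eq_mul, boxExponent_apply]
        exact ⟨Nat.mul_pos (by omega) (Nat.succ_pos _), dvd_mul_right _ _⟩
  have hl : π (∑ x ∈ frobPoints p n j, MvPolynomial.eval (teichPoint x) G) =
      ∑ e ∈ G.support, π (MvPolynomial.coeff e G) * ∏ i, c (e i) := by
    simp only [MvPolynomial.eval_eq', ← hc]
    rw [Finset.sum_comm, map_sum]
    refine Finset.sum_congr rfl fun e _ => ?_
    rw [← Finset.mul_sum, map_mul, ← map_prod, Finset.prod_univ_sum]
    rfl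
  rw [hl, Finset.sum_congr rfl key, ← Finset.sum_filter, map_mul, map_pow, map_neg, map_one,
    map_sum, Finset.mul_sum]
  symm
  refine Finset.sum_bij_ne_zero (fun u _ _ => (p ^ j - 1) • boxExponent u) ?_ ?_ ?_ ?_
  · intro u _ hu
    refine Finset.mem_filter.2 ⟨MvPolynomial.mem_support_iff.2 fun h0 => hu ?_, u, rfl⟩
    rw [h0, map_zero, mul_zero]
  · intro u _ _ v _ _ h
    apply boxExponent_injective
    ext i
    have := DFunLike.congr_fun h i
    simp only [Finsupp.smul_apply, smul_eq_mul] at this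
    exact Nat.eq_of_mul_eq_mul_left (by omega) this
  · intro e he hne
    obtain ⟨-, u, rfl⟩ := Finset.mem_filter.1 he
    exact ⟨u, Finset.mem_univ _, hne, rfl⟩
  · intro u _ _
    rfl

end Teichmuller

/-! ### The trace formula modulo p -/

section PointCount

variable {p : ℕ} [hp : Fact p.Prime] {n : ℕ}

/-- The number of points outside the zero set of `g` over the field with `p ^ j` elements. -/
noncomputable def nonzeroCount (g : MvPolynomial (Fin n) (Fbar p)) (j : ℕ) : ℕ :=
  open Classical in ((frobPoints p n j).filter fun x => MvPolynomial.eval x g ≠ 0).card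

theorem eval_constantCoeff_teichPoint (F : MvPolynomial (Fin n) (WittVector p (Fbar p)))
    (x : Fin n → Fbar p) : WittVector.constantCoeff (MvPolynomial.eval (teichPoint x) F) =
      MvPolynomial.eval x (MvPolynomial.map WittVector.constantCoeff F) := by
  have h := MvPolynomial.eval₂_comp_left (WittVector.constantCoeff : WittVector p (Fbar p) →+* _)
    (RingHom.id _) (teichPoint x) F
  have hx : WittVector.constantCoeff ∘ teichPoint x = x :=
    funext fun i => constantCoeff_teichmuller (x i)
  rw [RingHom.comp_id, hx] at h
  rw [MvPolynomial.eval_map, ← h]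
  rfl

/-- The trace formula: the number of points outside a hypersurface, in the sense of the exponential
series modulo `p`. -/
theorem isExpTrivial_nonzeroCount {r : ℕ} (hr : r ≠ 0)
    (F : MvPolynomial (Fin n) (WittVector p (Fbar p)))
    (hF : ∀ x : Fin n → Fbar p,
      MvPolynomial.eval (fun i => x i ^ p ^ r) (MvPolynomial.map WittVector.constantCoeff F) =
        MvPolynomial.eval x (MvPolynomial.map WittVector.constantCoeff F) ^ p ^ r)
    {D : ℕ} (hD : ∀ i, F.degreeOf i ≤ D) :
    IsExpTrivial fun k =>
      (nonzeroCount (MvPolynomial.map WittVector.constantCoeff F) (r * k) :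
        WittVector p (Fbar p)) -
      (-1) ^ n * (cartierMatrix (p ^ r) D (F ^ (p ^ r - 1)) ^ k).trace := by
  classical
  set f := MvPolynomial.map WittVector.constantCoeff F with hf
  set G := F ^ (p ^ r - 1) with hG
  have hq1 : 1 < p ^ r := Nat.one_lt_pow hr hp.out.one_lt
  have hq0 : p ^ r ≠ 0 := by omega
  have hGD : ∀ i, G.degreeOf i ≤ (p ^ r - 1) * D := fun i =>
    (MvPolynomial.degreeOf_pow_le _ _ _).trans (Nat.mul_le_mul_left _ (hD i))
  let a : ℕ → WittVector p (Fbar p) := fun k =>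
    ∑ x ∈ frobPoints p n (r * k), ∏ i ∈ Finset.range k,
      MvPolynomial.eval (teichPoint fun l => x l ^ (p ^ r) ^ i) F ^ (p ^ r - 1)
  -- For x in 𝔽_{q^k} the product of the factors F(x^{q^i})^{q-1} reduces to the norm of f(x) raised
  -- to q - 1, the indicator of f(x) ≠ 0. A congruence of the terms mod p is not enough to make the
  -- difference negligible, so the comparison is made between the determinants.
  have h1 : IsExpTrivial fun k => (nonzeroCount f (r * k) : WittVector p (Fbar p)) + -a k := by
    intro N
    have hj : r * N.factorial ≠ 0 := mul_ne_zero hr N.factorial_ne_zero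
    set s := frobMap (p := p) n (r * N.factorial) (p ^ r) hj with hs
    set A := weightedMap s
      (fun x => MvPolynomial.eval (teichPoint x.1) F ^ (p ^ r - 1)) with hA
    set U := weightedMap s
      (fun x => if MvPolynomial.eval x.1 f ≠ 0 then (1 : WittVector p (Fbar p)) else 0) with hU
    obtain ⟨E, hE⟩ := exists_mul_eq_one_of_constantCoeff (constantCoeff_detSeries U)
    refine ⟨E * detSeries A,
      (((isExpUpTo_detSeries U N).inv hE).mul (isExpUpTo_detSeries A N)).congr fun k hk hkN => ?_,
      ?_⟩
    · rw [neg_neg, hA, hU, trace_weightedMap_frobMap hr hj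
        (fun x => if MvPolynomial.eval x f ≠ 0 then (1 : WittVector p (Fbar p)) else 0) hk hkN,
        trace_weightedMap_frobMap hr hj
        (fun x => MvPolynomial.eval (teichPoint x) F ^ (p ^ r - 1)) hk hkN]
      congr 1
      rw [nonzeroCount, Finset.card_filter, Nat.cast_sum]
      refine Finset.sum_congr rfl fun x _ => ?_
      have hit : ∀ i, MvPolynomial.eval (fun l => x l ^ (p ^ r) ^ i) f =
          MvPolynomial.eval x f ^ (p ^ r) ^ i := by
        intro i
        induction i with
        | zero => simp
        | succ i ih =>
          have h := hF fun l => x l ^ (p ^ r) ^ i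
          rw [ih] at h
          simpa only [pow_succ, pow_mul] using h
      by_cases hx : MvPolynomial.eval x f = 0
      · rw [if_neg (not_not.2 hx), Nat.cast_zero]
        refine Finset.prod_eq_zero (Finset.mem_range.2 hk) ?_
        rw [if_neg]
        rw [not_not, hit, hx, zero_pow (by simp)]
      · rw [if_pos hx, Nat.cast_one]
        refine Finset.prod_eq_one fun i _ => if_pos ?_
        rw [hit]
        exact pow_ne_zero _ hx
    -- Diagonal entries f(x), replaced by 1 where f vanishes, intertwine the two matrices: f(x) ·
    -- f(x)^{q-1} = f(x^q). Pointwise equality of the weights fails, since f(x) lies in a larger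
    -- field than 𝔽_q.
    · have hconj : detSeries (A.map (WittVector.constantCoeff : WittVector p (Fbar p) →+* Fbar p)) =
          detSeries (U.map (WittVector.constantCoeff : WittVector p (Fbar p) →+* Fbar p)) := by
        let w : frobPoints p n (r * N.factorial) → Fbar p := fun x =>
          if MvPolynomial.eval x.1 f ≠ 0 then MvPolynomial.eval x.1 f else 1
        refine detSeries_eq_of_conj (P := Matrix.diagonal w) ?_ ?_
        · rw [Matrix.det_diagonal, Finset.prod_ne_zero_iff]
          intro x _
          simp only [w]
          split_ifs with h
          · exact h
          · exact one_ne_zero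
        · rw [hA, hU, weightedMap_map, weightedMap_map]
          ext x y
          rw [Matrix.diagonal_mul, Matrix.mul_diagonal]
          simp only [weightedMap, Matrix.of_apply]
          by_cases hy : y = s x
          · have hsx : MvPolynomial.eval (s x).1 f = MvPolynomial.eval x.1 f ^ p ^ r := hF x.1
            rw [if_pos hy, if_pos hy, hy, map_pow, eval_constantCoeff_teichPoint, ← hf]
            simp only [w, hsx]
            by_cases hx : MvPolynomial.eval x.1 f = 0
            · rw [hx, zero_pow (by omega)]
              simp
            · rw [if_pos hx, if_pos hx, if_pos (pow_ne_zero _ hx), map_one, one_mul,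
                ← pow_succ', Nat.sub_add_cancel hq1.le]
          · rw [if_neg hy, if_neg hy, mul_zero, zero_mul]
      rw [map_mul, detSeries_map, hconj, ← detSeries_map, mul_comm, ← map_mul, hE, map_one]
  -- The character sum formula gives the congruence modulo q^k = p^(rk), hence modulo p^k, as
  -- negligibility requires.
  have h2 : IsExpTrivial fun k => a k -
      (-1) ^ n * (cartierMatrix (p ^ r) D G ^ k).trace := by
    refine isExpTrivial_of_pow_dvd fun k hk => ?_
    have hrk : r * k ≠ 0 := mul_ne_zero hr (by omega)
    refine (pow_dvd_pow _ (Nat.le_mul_of_pos_left k (Nat.pos_of_ne_zero hr))).trans ?_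
    have h3 := dvd_sum_eval_teichPoint hrk (frobProduct (p ^ r) G k) (D := D)
      (by rw [pow_mul]; exact degreeOf_frobProduct hq0 hGD k)
    have h4 : a k = ∑ x ∈ frobPoints p n (r * k),
        MvPolynomial.eval (teichPoint x) (frobProduct (p ^ r) G k) := by
      refine Finset.sum_congr rfl fun x _ => ?_
      rw [frobProduct, map_prod]
      refine Finset.prod_congr rfl fun i _ => ?_
      rw [MvPolynomial.eval_expand, hG, map_pow]
      congr 2
      congr 1
      funext l
      simp [teichPoint]
    rw [trace_cartierMatrix_pow hq0 hGD, h4, ← pow_mul]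
    exact h3
  exact (h1.add h2).congr fun k _ => by ring

end PointCount

/-! ### Descent to the field 𝔽_p[t]/(m) -/

section FieldOfDefinition

variable {p : ℕ} [hp : Fact p.Prime] {n : ℕ}

/-- The number of points of the zero set of `g` over the field with `p ^ j` elements. -/
noncomputable def zeroCount (g : MvPolynomial (Fin n) (Fbar p)) (j : ℕ) : ℕ :=
  open Classical in ((frobPoints p n j).filter fun x => MvPolynomial.eval x g = 0).card

theorem zeroCount_add_nonzeroCount (g : MvPolynomial (Fin n) (Fbar p)) {j : ℕ} (hj : j ≠ 0) :
    zeroCount g j + nonzeroCount g j = p ^ (j * n) := by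
  classical
  rw [← card_frobPoints hj, zeroCount, nonzeroCount]
  exact Finset.card_filter_add_card_filter_not _

variable (m : (ZMod p)[X]) [hm : Fact (Irreducible m)]

theorem natDegree_ne_zero_of_fact_irreducible : m.natDegree ≠ 0 :=
  hm.out.natDegree_pos.ne'

theorem natCard_adjoinRoot : Nat.card (AdjoinRoot m) = p ^ m.natDegree := by
  have : Module.Finite (ZMod p) (AdjoinRoot m) := (AdjoinRoot.powerBasis hm.out.ne_zero).finite
  rw [Module.natCard_eq_pow_finrank (K := ZMod p), (AdjoinRoot.powerBasis hm.out.ne_zero).finrank,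
    AdjoinRoot.powerBasis_dim, Nat.card_zmod]

variable {m}

theorem ringHom_adjoinRoot_pow (ψ : AdjoinRoot m →+* Fbar p) (c : AdjoinRoot m) :
    ψ c ^ p ^ m.natDegree = ψ c := by
  classical
  let _ := Fintype.ofFinite (AdjoinRoot m)
  rw [← map_pow, ← natCard_adjoinRoot m, Nat.card_eq_fintype_card, FiniteField.pow_card]

theorem eval_pow_map (ψ : AdjoinRoot m →+* Fbar p) (f : MvPolynomial (Fin n) (AdjoinRoot m))
    (x : Fin n → Fbar p) :
    MvPolynomial.eval (fun i => x i ^ p ^ m.natDegree) (MvPolynomial.map ψ f) =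
      MvPolynomial.eval x (MvPolynomial.map ψ f) ^ p ^ m.natDegree := by
  have h := MvPolynomial.eval₂_comp_left (iterateFrobenius (Fbar p) p m.natDegree) ψ x f
  have hψ : (iterateFrobenius (Fbar p) p m.natDegree).comp ψ = ψ :=
    RingHom.ext fun c => ringHom_adjoinRoot_pow ψ c
  rw [hψ, iterateFrobenius_def] at h
  rw [MvPolynomial.eval_map, MvPolynomial.eval_map, h]
  rfl

theorem hypersurfacePoints_eq_zeroCount (ψ : AdjoinRoot m →+* Fbar p)
    (f : MvPolynomial (Fin n) (AdjoinRoot m)) (k : ℕ) [NeZero k] :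
    hypersurfacePoints (AdjoinRoot m) p f k =
      zeroCount (MvPolynomial.map ψ f) (m.natDegree * k) := by
  classical
  let _ := ψ.toAlgebra
  let E := FiniteField.Extension (AdjoinRoot m) p k
  let _ : Fintype E := Fintype.ofFinite E
  let θ : E →ₐ[AdjoinRoot m] Fbar p := IsAlgClosed.lift
  have hj : m.natDegree * k ≠ 0 :=
    mul_ne_zero (natDegree_ne_zero_of_fact_irreducible m) (NeZero.ne k)
  have hE : Fintype.card E = p ^ (m.natDegree * k) := by
    rw [Fintype.card_eq_nat_card, FiniteField.natCard_extension, natCard_adjoinRoot, pow_mul]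
  have heval : ∀ x : Fin n → E, MvPolynomial.eval (fun i => θ (x i)) (MvPolynomial.map ψ f) =
      θ (MvPolynomial.aeval x f) := by
    intro x
    have h := MvPolynomial.eval₂_comp_left (θ : E →+* Fbar p) (algebraMap (AdjoinRoot m) E) x f
    rw [AlgHom.comp_algebraMap] at h
    rw [MvPolynomial.eval_map, MvPolynomial.aeval_def]
    exact h.symm
  rw [hypersurfacePoints, Nat.card_eq_fintype_card, Fintype.card_subtype, zeroCount]
  refine Finset.card_bij (fun x _ i => θ (x i)) ?_ ?_ ?_
  · intro x hx
    rw [Finset.mem_filter] at hx ⊢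
    refine ⟨?_, by rw [heval, hx.2, map_zero]⟩
    rw [frobPoints, Fintype.mem_piFinset]
    exact fun i => map_mem_frobFixed hj hE θ.toRingHom (x i)
  · intro x _ y _ h
    funext i
    exact θ.toRingHom.injective (congrFun h i)
  · intro y hy
    rw [Finset.mem_filter, frobPoints, Fintype.mem_piFinset, frobFixed_eq_map hj hE θ.toRingHom]
      at hy
    have h1 : ∀ i, ∃ x : E, θ x = y i := fun i => by
      obtain ⟨x, -, hx⟩ := Finset.mem_map.1 (hy.1 i)
      exact ⟨x, hx⟩
    choose x hx using h1
    have hxy : (fun i => θ (x i)) = y := funext hx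
    refine ⟨x, ?_, hxy⟩
    rw [Finset.mem_filter]
    refine ⟨Finset.mem_univ _, ?_⟩
    have h2 := hy.2
    rw [← hxy, heval] at h2
    exact (map_eq_zero_iff θ θ.toRingHom.injective).1 h2

/-- Lifting coefficients by Teichmüller representatives does not enlarge the support, so the same
box of exponents serves the lift. -/
theorem exists_lift_degreeOf_le (g : MvPolynomial (Fin n) (Fbar p)) :
    ∃ F : MvPolynomial (Fin n) (WittVector p (Fbar p)),
      MvPolynomial.map WittVector.constantCoeff F = g ∧ ∀ i, F.degreeOf i ≤ g.degreeOf i := by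
  classical
  refine ⟨∑ e ∈ g.support, MvPolynomial.monomial e
    (WittVector.teichmuller p (MvPolynomial.coeff e g)), ?_, fun i => ?_⟩
  · conv_rhs => rw [g.as_sum]
    rw [map_sum]
    refine Finset.sum_congr rfl fun e _ => ?_
    rw [MvPolynomial.map_monomial, constantCoeff_teichmuller]
  · rw [MvPolynomial.degreeOf_le_iff]
    intro e he
    have h1 := MvPolynomial.support_sum he
    rw [Finset.mem_biUnion] at h1
    obtain ⟨e', he', h2⟩ := h1
    have h3 := Finset.mem_singleton.1 (MvPolynomial.support_monomial_subset h2)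
    rw [h3]
    exact MvPolynomial.degreeOf_le_iff.1 le_rfl e' he'

/-- The trace formula over the field of definition. -/
theorem exists_isExpTrivial_zeroCount (hn : 1 ≤ n) (ψ : AdjoinRoot m →+* Fbar p)
    (f : MvPolynomial (Fin n) (AdjoinRoot m)) {D : ℕ} (hD : ∀ i, f.degreeOf i ≤ D) :
    ∃ A : Matrix (Fin n → Fin D) (Fin n → Fin D) (WittVector p (Fbar p)),
      IsExpTrivial fun k => (zeroCount (MvPolynomial.map ψ f) (m.natDegree * k) :
        WittVector p (Fbar p)) + (-1) ^ n * (A ^ k).trace := by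
  have ha := natDegree_ne_zero_of_fact_irreducible m
  obtain ⟨F, hF, hFD⟩ := exists_lift_degreeOf_le (MvPolynomial.map ψ f)
  have h1 := isExpTrivial_nonzeroCount ha F (by rw [hF]; exact eval_pow_map ψ f)
    (D := D) (fun i => (hFD i).trans (le_trans ?_ (hD i)))
  swap
  · rw [MvPolynomial.degreeOf_le_iff]
    intro e he
    exact MvPolynomial.degreeOf_le_iff.1 le_rfl e (MvPolynomial.support_map_subset _ _ he)
  rw [hF] at h1
  -- The number of all points, q^(kn), is divisible by p^k because n ≥ 1, so passing to the
  -- complement costs only a sign.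
  have h2 : IsExpTrivial fun k =>
      ((p ^ (m.natDegree * k * n) : ℕ) : WittVector p (Fbar p)) := by
    refine isExpTrivial_of_pow_dvd fun k _ => ?_
    rw [Nat.cast_pow]
    refine pow_dvd_pow _ ?_
    calc k = 1 * k * 1 := by ring
      _ ≤ _ := Nat.mul_le_mul (Nat.mul_le_mul_right _ (Nat.one_le_iff_ne_zero.2 ha)) hn
  refine ⟨cartierMatrix (p ^ m.natDegree) D (F ^ (p ^ m.natDegree - 1)),
    (h2.add h1.neg).congr fun k hk => ?_⟩
  have h3 := zeroCount_add_nonzeroCount (MvPolynomial.map ψ f)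
    (mul_ne_zero ha (show k ≠ 0 by omega))
  rw [← h3, Nat.cast_add]
  ring

end FieldOfDefinition

/-! ### A model over the prime field in one more variable -/

section PrimeFieldModel

variable {p : ℕ} [hp : Fact p.Prime] {n : ℕ}

theorem card_filter_frobPoints_succ {j : ℕ} (P : (Fin (n + 1) → Fbar p) → Prop)
    [DecidablePred P] :
    ((frobPoints p (n + 1) j).filter P).card =
      ∑ t ∈ frobFixed p j, ((frobPoints p n j).filter fun x => P (Fin.cons t x)).card := by
  classical
  rw [Finset.card_eq_sum_card_fiberwise (f := fun z => z 0) (t := frobFixed p j)]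
  · refine Finset.sum_congr rfl fun t ht => ?_
    symm
    refine Finset.card_bij (fun x _ => Fin.cons t x) ?_ ?_ ?_
    · intro x hx
      simp only [Finset.mem_filter, frobPoints, Fintype.mem_piFinset] at hx ⊢
      refine ⟨⟨fun i => ?_, hx.2⟩, rfl⟩
      refine Fin.cases ?_ (fun i => ?_) i
      · simpa using ht
      · simpa using hx.1 i
    · intro x _ y _ h
      exact (Fin.cons_injective2 h).2
    · intro z hz
      simp only [Finset.mem_filter, frobPoints, Fintype.mem_piFinset] at hz ⊢
      obtain ⟨⟨h1, h2⟩, rfl⟩ := hz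
      refine ⟨Fin.tail z, ⟨fun i => h1 i.succ, ?_⟩, Fin.cons_self_tail z⟩
      rwa [Fin.cons_self_tail]
  · intro z hz
    simp only [Finset.coe_filter, Set.mem_ofPred_eq, frobPoints, Fintype.mem_piFinset] at hz
    exact hz.1 0

variable {m : (ZMod p)[X]} [hm : Fact (Irreducible m)]

/-- The embedding of `𝔽_p[t] / (m)` that sends `t` to a root of `m`. -/
noncomputable def rootHom (t : Fbar p) (h : m.eval₂ (algebraMap (ZMod p) (Fbar p)) t = 0) :
    AdjoinRoot m →+* Fbar p :=
  AdjoinRoot.lift (algebraMap (ZMod p) (Fbar p)) t h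

theorem root_mem_frobFixed {t : Fbar p} (h : m.eval₂ (algebraMap (ZMod p) (Fbar p)) t = 0) {j : ℕ}
    (hj : j ≠ 0) (hd : m.natDegree ∣ j) : t ∈ frobFixed p j := by
  have ha := natDegree_ne_zero_of_fact_irreducible m
  have h1 := ringHom_adjoinRoot_pow (rootHom t h) (AdjoinRoot.root m)
  rw [rootHom, AdjoinRoot.lift_root] at h1
  have h2 : (fun _ : Fin 1 => t) ∈ frobPoints p 1 m.natDegree := by
    rw [mem_frobPoints ha]
    exact fun _ => h1
  have h3 := frobPoints_subset ha hj hd h2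
  rw [mem_frobFixed hj]
  exact (mem_frobPoints hj).1 h3 0

theorem natDegree_dvd_of_root_mem_frobFixed {t : Fbar p}
    (h : m.eval₂ (algebraMap (ZMod p) (Fbar p)) t = 0) {j : ℕ}
    (hj : j ≠ 0) (ht : t ∈ frobFixed p j) : m.natDegree ∣ j := by
  rw [mem_frobFixed hj] at ht
  have h1 : m ∣ X ^ p ^ j - X := by
    have h2 : minpoly (ZMod p) t ∣ X ^ p ^ j - X :=
      minpoly.dvd _ _ (by simp [ht])
    have h3 : minpoly (ZMod p) t ∣ m := minpoly.dvd _ _ h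
    have h4 : Associated (minpoly (ZMod p) t) m :=
      (minpoly.irreducible (Algebra.IsIntegral.isIntegral t)).associated_of_dvd hm.out h3
    exact h4.symm.dvd.trans h2
  refine Irreducible.natDegree_dvd_of_dvd_X_pow_card_pow_sub_X hm.out (n := j) ?_
  rwa [Nat.card_zmod]

/-- The roots of m are simple and conjugate over 𝔽_p, each generating 𝔽_{p^a}: they lie in 𝔽_{p^j}
all together or not at all. -/
theorem card_roots_frobFixed {j : ℕ} (hj : j ≠ 0) [DecidablePred fun t : Fbar p =>
    m.eval₂ (algebraMap (ZMod p) (Fbar p)) t = 0] :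
    ((frobFixed p j).filter fun t => m.eval₂ (algebraMap (ZMod p) (Fbar p)) t = 0).card =
      if m.natDegree ∣ j then m.natDegree else 0 := by
  classical
  split_ifs with hd
  · have hsep : m.Separable := PerfectField.separable_of_irreducible hm.out
    have h1 := Polynomial.card_rootSet_eq_natDegree hsep
      (IsAlgClosed.splits (m.map (algebraMap (ZMod p) (Fbar p))))
    rw [← h1, ← Set.toFinset_card]
    congr 1
    ext t
    rw [Finset.mem_filter, Set.mem_toFinset, Polynomial.mem_rootSet_of_ne hm.out.ne_zero]
    exact ⟨fun h => h.2, fun h => ⟨root_mem_frobFixed h hj hd, h⟩⟩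
  · rw [Finset.card_eq_zero, Finset.filter_eq_empty_iff]
    exact fun t ht h => hd (natDegree_dvd_of_root_mem_frobFixed h hj ht)

/-- Both sides equal the intrinsic count over the extension of 𝔽_p[t]/(m) of degree j/a, so all
conjugates of f have equally many zeros. -/
theorem zeroCount_map_eq (ψ ψ' : AdjoinRoot m →+* Fbar p)
    (f : MvPolynomial (Fin n) (AdjoinRoot m)) {j : ℕ} (hj : j ≠ 0) (hd : m.natDegree ∣ j) :
    zeroCount (MvPolynomial.map ψ f) j = zeroCount (MvPolynomial.map ψ' f) j := by
  obtain ⟨k, rfl⟩ := hd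
  have : NeZero k := ⟨right_ne_zero_of_mul hj⟩
  rw [← hypersurfacePoints_eq_zeroCount, ← hypersurfacePoints_eq_zeroCount]

/-- The reduction of an integral polynomial to the algebraic closure of the prime field. -/
noncomputable abbrev redPoly (p : ℕ) [Fact p.Prime] {n : ℕ} (g : MvPolynomial (Fin n) ℤ) :
    MvPolynomial (Fin n) (Fbar p) :=
  MvPolynomial.map (Int.castRingHom (Fbar p)) g

/-- The case r = 1 with integral coefficients: the Cartier matrix is already defined over ℤ, so its
traces can be computed there. -/
theorem isExpTrivial_nonzeroCount_redPoly (g : MvPolynomial (Fin n) ℤ) {D : ℕ}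
    (hD : ∀ i, g.degreeOf i ≤ D) :
    IsExpTrivial fun k => (nonzeroCount (redPoly p g) k : WittVector p (Fbar p)) -
      (-1) ^ n * (((cartierMatrix p D (g ^ (p - 1)) ^ k).trace : ℤ) : WittVector p (Fbar p)) := by
  set F := MvPolynomial.map (Int.castRingHom (WittVector p (Fbar p))) g with hF
  have hFg : MvPolynomial.map WittVector.constantCoeff F = redPoly p g := by
    rw [hF, MvPolynomial.map_map, RingHom.ext_int (RingHom.comp _ _) (Int.castRingHom (Fbar p))]
  have hFD : ∀ i, F.degreeOf i ≤ D := fun i => by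
    refine le_trans ?_ (hD i)
    rw [MvPolynomial.degreeOf_le_iff]
    intro e he
    exact MvPolynomial.degreeOf_le_iff.1 le_rfl e (MvPolynomial.support_map_subset _ _ he)
  have h1 := isExpTrivial_nonzeroCount one_ne_zero F (by
    rw [hFg]
    intro x
    have h := MvPolynomial.eval₂_comp_left (iterateFrobenius (Fbar p) p 1)
      (Int.castRingHom (Fbar p)) x g
    rw [RingHom.ext_int ((iterateFrobenius (Fbar p) p 1).comp _) (Int.castRingHom (Fbar p)),
      iterateFrobenius_def] at h
    rw [MvPolynomial.eval_map, MvPolynomial.eval_map, h]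
    rfl) hFD
  refine h1.congr fun k _ => ?_
  rw [hFg, one_mul, pow_one]
  congr 2
  have h2 : cartierMatrix p D (F ^ (p - 1)) =
      (Int.castRingHom (WittVector p (Fbar p))).mapMatrix (cartierMatrix p D (g ^ (p - 1))) := by
    rw [RingHom.mapMatrix_apply, cartierMatrix_map, map_pow]
  rw [h2, ← map_pow, RingHom.mapMatrix_apply]
  exact (AddMonoidHom.map_trace (Int.castRingHom (WittVector p (Fbar p))).toAddMonoidHom _).symm

theorem IsExpTrivial.neg_one_pow_mul {α : ℕ → WittVector p (Fbar p)}
    (h : IsExpTrivial α) (e : ℕ) : IsExpTrivial fun i => (-1) ^ e * α i := by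
  rcases neg_one_pow_eq_or (WittVector p (Fbar p)) e with h1 | h1
  · simpa only [h1, one_mul] using h
  · simpa only [h1, neg_one_mul] using h.neg

/-- A model of the hypersurface `f = 0` over the prime field, cut out by integral polynomials
`m' = f' = 0` in one more variable. -/
structure IsPrimeFieldModel (f : MvPolynomial (Fin n) (AdjoinRoot m))
    (m' f' : MvPolynomial (Fin (n + 1)) ℤ) : Prop where
  eval_modulus : ∀ z : Fin (n + 1) → Fbar p,
    MvPolynomial.eval z (redPoly p m') = m.eval₂ (algebraMap (ZMod p) (Fbar p)) (z 0)
  eval_equation : ∀ (z : Fin (n + 1) → Fbar p)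
    (h : m.eval₂ (algebraMap (ZMod p) (Fbar p)) (z 0) = 0),
    MvPolynomial.eval z (redPoly p f') =
      MvPolynomial.eval (Fin.tail z) (MvPolynomial.map (rootHom (z 0) h) f)

/-- Fibre over the first coordinate t: nothing lies over t unless it is a root of m, and over each
root lies a conjugate of X. The result is the k-th logarithmic coefficient of Z(X, T^a). -/
theorem IsPrimeFieldModel.card_zeros {f : MvPolynomial (Fin n) (AdjoinRoot m)}
    {m' f' : MvPolynomial (Fin (n + 1)) ℤ} (h : IsPrimeFieldModel f m' f')
    (ψ : AdjoinRoot m →+* Fbar p) {j : ℕ} (hj : j ≠ 0)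
    [DecidablePred fun z : Fin (n + 1) → Fbar p =>
      MvPolynomial.eval z (redPoly p m') = 0 ∧ MvPolynomial.eval z (redPoly p f') = 0] :
    ((frobPoints p (n + 1) j).filter fun z =>
      MvPolynomial.eval z (redPoly p m') = 0 ∧ MvPolynomial.eval z (redPoly p f') = 0).card =
    if m.natDegree ∣ j then m.natDegree * zeroCount (MvPolynomial.map ψ f) j else 0 := by
  classical
  have hval : ∀ t ∈ frobFixed p j, ((frobPoints p n j).filter fun x =>
      MvPolynomial.eval (Fin.cons t x : Fin (n + 1) → Fbar p) (redPoly p m') = 0 ∧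
        MvPolynomial.eval (Fin.cons t x : Fin (n + 1) → Fbar p) (redPoly p f') = 0).card =
      if m.eval₂ (algebraMap (ZMod p) (Fbar p)) t = 0 then
        zeroCount (MvPolynomial.map ψ f) j else 0 := by
    intro t ht
    split_ifs with ht0
    · rw [zeroCount_map_eq ψ (rootHom t ht0) f hj (natDegree_dvd_of_root_mem_frobFixed ht0 hj ht),
        zeroCount]
      congr 1
      refine Finset.filter_congr fun x _ => ?_
      rw [h.eval_modulus, h.eval_equation _ (by simpa using ht0)]
      simp [ht0]
    · rw [Finset.card_eq_zero, Finset.filter_eq_empty_iff]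
      intro x _ hx
      rw [h.eval_modulus] at hx
      exact ht0 (by simpa using hx.1)
  rw [card_filter_frobPoints_succ, Finset.sum_congr rfl hval, ← Finset.sum_filter,
    Finset.sum_const, card_roots_frobFixed hj, smul_eq_mul]
  split_ifs
  · rfl
  · rw [zero_mul]

/-- The set m' = 0 is a disjoint union of affine n-spaces. -/
theorem IsPrimeFieldModel.dvd_card_modulus {f : MvPolynomial (Fin n) (AdjoinRoot m)}
    {m' f' : MvPolynomial (Fin (n + 1)) ℤ} (h : IsPrimeFieldModel f m' f') {j : ℕ} (hj : j ≠ 0)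
    [DecidablePred fun z : Fin (n + 1) → Fbar p => MvPolynomial.eval z (redPoly p m') = 0] :
    p ^ (j * n) ∣ ((frobPoints p (n + 1) j).filter fun z =>
      MvPolynomial.eval z (redPoly p m') = 0).card := by
  classical
  rw [card_filter_frobPoints_succ]
  refine Finset.dvd_sum fun t _ => ?_
  simp only [h.eval_modulus, Fin.cons_zero]
  by_cases ht : m.eval₂ (algebraMap (ZMod p) (Fbar p)) t = 0
  · simp [ht, card_frobPoints hj]
  · simp [ht]

/-- The trace formula over the prime field. -/
theorem IsPrimeFieldModel.isExpTrivial (hn : 1 ≤ n) {f : MvPolynomial (Fin n) (AdjoinRoot m)}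
    {m' f' : MvPolynomial (Fin (n + 1)) ℤ} (h : IsPrimeFieldModel f m' f')
    (ψ : AdjoinRoot m →+* Fbar p) {D : ℕ} (hD : ∀ i, f'.degreeOf i ≤ D)
    (hD' : ∀ i, (m' * f').degreeOf i ≤ D) :
    IsExpTrivial fun k => (((cartierMatrix p D (f' ^ (p - 1)) ^ k).trace +
        ((p : ℤ) ^ k - 1) * (cartierMatrix p D ((m' * f') ^ (p - 1)) ^ k).trace : ℤ) :
        WittVector p (Fbar p)) -
      (-1) ^ n * ((if m.natDegree ∣ k then m.natDegree * zeroCount (MvPolynomial.map ψ f) k else 0 :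
        ℕ) : WittVector p (Fbar p)) := by
  classical
  have h1 := (isExpTrivial_nonzeroCount_redPoly (p := p) f' hD).neg_one_pow_mul n
  have h2 := (isExpTrivial_nonzeroCount_redPoly (p := p) (m' * f') hD').neg_one_pow_mul (n + 1)
  -- Adding p^k times the second trace is harmless modulo p, and turns the difference of two traces
  -- into a nonnegative combination.
  have h3 : IsExpTrivial fun k => (p : WittVector p (Fbar p)) ^ k *
      (((cartierMatrix p D ((m' * f') ^ (p - 1)) ^ k).trace : ℤ) : WittVector p (Fbar p)) :=
    isExpTrivial_of_pow_dvd fun k _ => dvd_mul_right _ _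
  have h4 : IsExpTrivial fun k => (-1) ^ (n + 1) *
      ((((frobPoints p (n + 1) k).filter fun z =>
        MvPolynomial.eval z (redPoly p m') = 0).card : ℕ) : WittVector p (Fbar p)) := by
    refine isExpTrivial_of_pow_dvd fun k hk => Dvd.dvd.mul_left ?_ _
    have h5 : p ^ k ∣ _ := (pow_dvd_pow p (Nat.le_mul_of_pos_right k hn)).trans
      (h.dvd_card_modulus (j := k) (by omega))
    exact_mod_cast Nat.cast_dvd_cast (α := WittVector p (Fbar p)) h5
  refine (((h1.add h2).add h3).add h4).congr fun k hk => ?_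
  rw [← h.card_zeros ψ (show k ≠ 0 by omega)]
  -- Inclusion–exclusion: both sides count the points where f' ≠ 0 or m' = 0, the right-hand side
  -- splitting them by m'.
  have h6 : nonzeroCount (redPoly p f') k + ((frobPoints p (n + 1) k).filter fun z =>
      MvPolynomial.eval z (redPoly p m') = 0 ∧ MvPolynomial.eval z (redPoly p f') = 0).card =
      nonzeroCount (redPoly p (m' * f')) k + ((frobPoints p (n + 1) k).filter fun z =>
        MvPolynomial.eval z (redPoly p m') = 0).card := by
    simp only [nonzeroCount, Finset.card_filter]
    rw [← Finset.sum_add_distrib, ← Finset.sum_add_distrib]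
    refine Finset.sum_congr rfl fun z _ => ?_
    rw [show redPoly p (m' * f') = redPoly p m' * redPoly p f' from map_mul _ _ _, map_mul]
    generalize MvPolynomial.eval z (redPoly p m') = s
    generalize MvPolynomial.eval z (redPoly p f') = t
    by_cases h7 : s = 0 <;> by_cases h8 : t = 0 <;> simp [h7, h8]
  have h9 : (nonzeroCount (redPoly p f') k : WittVector p (Fbar p)) +
      (((frobPoints p (n + 1) k).filter fun z => MvPolynomial.eval z (redPoly p m') = 0 ∧
        MvPolynomial.eval z (redPoly p f') = 0).card : ℕ) =
      nonzeroCount (redPoly p (m' * f')) k + (((frobPoints p (n + 1) k).filter fun z =>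
        MvPolynomial.eval z (redPoly p m') = 0).card : ℕ) := by
    exact_mod_cast congrArg (Nat.cast : ℕ → WittVector p (Fbar p)) h6
  have h10 : ((-1 : WittVector p (Fbar p)) ^ n) ^ 2 = 1 := by
    rw [← pow_mul, mul_comm, pow_mul, neg_one_sq, one_pow]
  push_cast
  rw [pow_succ]
  linear_combination ((-1) ^ n) * h9 +
    (-(((cartierMatrix p D (f' ^ (p - 1)) ^ k).trace : ℤ) : WittVector p (Fbar p)) * (-1) -
      (((cartierMatrix p D ((m' * f') ^ (p - 1)) ^ k).trace : ℤ) : WittVector p (Fbar p))) * h10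

end PrimeFieldModel

/-! ### Integrality of the zeta function and its reduction modulo p -/

section ZetaModP

theorem isExpUpTo_exp_subst (α : ℕ → ℚ) (L : PowerSeries ℚ)
    (hL0 : PowerSeries.constantCoeff L = 0)
    (hL : PowerSeries.X * PowerSeries.derivative ℚ L = positivePart α) (N : ℕ) :
    IsExpUpTo N ((PowerSeries.exp ℚ).subst L) α := by
  have hs : PowerSeries.HasSubst L := PowerSeries.HasSubst.of_constantCoeff_zero' hL0
  constructor
  · have h1 : (PowerSeries.exp ℚ).subst L = 1 + (PowerSeries.exp ℚ - 1).subst L := by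
      rw [← PowerSeries.coe_substAlgHom hs, map_sub, map_one, add_sub_cancel]
    have h2 : PowerSeries.constantCoeff ((PowerSeries.exp ℚ - 1).subst L) = 0 :=
      PowerSeries.constantCoeff_subst_eq_zero (a := L) hL0 _ (by simp)
    rw [h1, map_add, h2, map_one, add_zero]
  · rw [PowerSeries.derivative_subst hs, PowerSeries.derivative_exp, ← hL]
    convert dvd_zero _ using 1
    ring

theorem isExpUpTo_of_map {R S : Type*} [CommRing R] [CommRing S] {f : R →+* S}
    (hf : Function.Injective f) {N : ℕ} {D : PowerSeries R} {α : ℕ → R}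
    (h : IsExpUpTo N (D.map f) (fun k => f (α k))) : IsExpUpTo N D α := by
  rw [isExpUpTo_iff_coeff] at h ⊢
  refine ⟨hf ?_, fun k hk => hf ?_⟩
  · simpa using h.1
  · simpa using h.2 k hk

/-- Under T ↦ T^a the operator T d/dT picks up a factor a, whence the coefficient a · α(k/a). -/
theorem IsExpUpTo.expand {R : Type*} [CommRing R] {D : PowerSeries R} {α : ℕ → R} {N a : ℕ}
    (ha : a ≠ 0) (h : IsExpUpTo N D α) :
    IsExpUpTo N (PowerSeries.expand a ha D) (fun k => if a ∣ k then a * α (k / a) else 0) := by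
  refine ⟨by rw [PowerSeries.constantCoeff_expand, h.1], ?_⟩
  have h1 : PowerSeries.X * PowerSeries.derivative R (PowerSeries.expand a ha D) =
      (a : PowerSeries R) * PowerSeries.expand a ha (PowerSeries.X * PowerSeries.derivative R D) := by
    have hX : ∀ (E : PowerSeries R) (k : ℕ),
        PowerSeries.coeff k (PowerSeries.X * PowerSeries.derivative R E) =
          k * PowerSeries.coeff k E := by
      intro E k
      cases k with
      | zero => simp
      | succ k =>
        rw [PowerSeries.coeff_succ_X_mul, PowerSeries.coeff_derivative, mul_comm]
        push_cast
        rfl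
    ext k
    rw [hX, ← map_natCast (PowerSeries.C (R := R)), PowerSeries.coeff_C_mul,
      PowerSeries.coeff_expand, PowerSeries.coeff_expand]
    split_ifs with hk
    · obtain ⟨l, rfl⟩ := hk
      rw [Nat.mul_div_cancel_left _ (Nat.pos_of_ne_zero ha), hX]
      push_cast
      ring
    · simp
  have h2 : positivePart (fun k => if a ∣ k then (a : R) * α (k / a) else 0) =
      (a : PowerSeries R) * PowerSeries.expand a ha (positivePart α) := by
    ext k
    rw [← map_natCast (PowerSeries.C (R := R)), PowerSeries.coeff_C_mul, PowerSeries.coeff_expand]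
    simp only [positivePart, PowerSeries.coeff_mk]
    rcases eq_or_ne k 0 with rfl | hk0
    · simp
    · rw [if_neg hk0]
      split_ifs with hk hk'
      · obtain ⟨l, rfl⟩ := hk
        rw [Nat.mul_div_cancel_left _ (Nat.pos_of_ne_zero ha)] at hk'
        exact absurd (by rw [hk', mul_zero]) hk0
      · rfl
      · rw [mul_zero]
  rw [h1, h2]
  obtain ⟨E, hE⟩ := h.2
  have h3 := congrArg (PowerSeries.expand a ha) hE
  rw [map_sub, map_mul _ D, map_mul _ (PowerSeries.X ^ (N + 1)), map_pow,
    PowerSeries.expand_X, ← pow_mul] at h3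
  have h4 : (PowerSeries.X : PowerSeries R) ^ (N + 1) ∣ PowerSeries.X ^ (a * (N + 1)) :=
    pow_dvd_pow _ (Nat.le_mul_of_pos_left _ (Nat.pos_of_ne_zero ha))
  have h5 := Dvd.dvd.mul_left (Dvd.dvd.mul_right h4 (PowerSeries.expand a ha E)) (a : PowerSeries R)
  rw [← h3] at h5
  convert h5 using 1
  ring

variable {p : ℕ} [hp : Fact p.Prime] {n : ℕ} {m : (ZMod p)[X]} [hm : Fact (Irreducible m)]

theorem exists_integral_zeta (ψ : AdjoinRoot m →+* Fbar p)
    (f : MvPolynomial (Fin n) (AdjoinRoot m)) :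
    ∃ W : PowerSeries ℤ, W.map (Int.castRingHom ℚ) = hypersurfaceZeta (AdjoinRoot m) p f ∧
      ∀ N, IsExpUpTo N W fun k => (zeroCount (MvPolynomial.map ψ f) (m.natDegree * k) : ℤ) := by
  classical
  set α : ℕ → ℤ := fun k => (zeroCount (MvPolynomial.map ψ f) (m.natDegree * k) : ℤ) with hα
  have hZ : ∀ N, IsExpUpTo N (hypersurfaceZeta (AdjoinRoot m) p f)
      (fun k => Int.castRingHom ℚ (α k)) := by
    intro N
    refine isExpUpTo_exp_subst _ _ (by simp [hypersurfaceLogZeta]) ?_ N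
    ext k
    cases k with
    | zero => simp [positivePart]
    | succ k =>
      rw [PowerSeries.coeff_succ_X_mul, PowerSeries.coeff_derivative, hypersurfaceLogZeta,
        PowerSeries.coeff_succ_X_mul, PowerSeries.coeff_mk,
        hypersurfacePoints_eq_zeroCount ψ, div_mul_cancel₀ _ (by positivity)]
      simp [positivePart, hα]
  have hD : ∀ N, ∃ D : PowerSeries ℤ, IsExpUpTo N D α := fun N => by
    obtain ⟨D, hD⟩ := exists_isExpUpTo_card (p := p) (natDegree_ne_zero_of_fact_irreducible m)
      {x : Fin n → Fbar p | MvPolynomial.eval x (MvPolynomial.map ψ f) = 0} (fun x hx => by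
        change MvPolynomial.eval _ _ = 0
        have hx' : MvPolynomial.eval x (MvPolynomial.map ψ f) = 0 := hx
        rw [eval_pow_map, hx', zero_pow (pow_ne_zero _ hp.out.ne_zero)]) N
    exact ⟨D, hD.congr fun k _ _ => by simp only [hα, zeroCount]; congr⟩
  choose D hD using hD
  -- The integral series are known only up to degree N. The coefficient of degree k is taken from
  -- level k, and over ℚ uniqueness identifies it with that of the zeta function.
  have hW : (PowerSeries.mk fun k => PowerSeries.coeff k (D k)).map (Int.castRingHom ℚ) =
      hypersurfaceZeta (AdjoinRoot m) p f := by
    ext k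
    rw [PowerSeries.coeff_map, PowerSeries.coeff_mk, ← PowerSeries.coeff_map]
    exact ((hD k).map (Int.castRingHom ℚ)).coeff_eq (hZ k) k le_rfl
  refine ⟨_, hW, fun N => isExpUpTo_of_map (f := Int.castRingHom ℚ) Int.cast_injective ?_⟩
  rw [hW]
  exact hZ N

/-- The integral traces whose exponential series is computed. -/
noncomputable def modelTrace (p D : ℕ) (m' f' : MvPolynomial (Fin (n + 1)) ℤ) (k : ℕ) : ℤ :=
  (cartierMatrix p D (f' ^ (p - 1)) ^ k).trace +
    ((p : ℤ) ^ k - 1) * (cartierMatrix p D ((m' * f') ^ (p - 1)) ^ k).trace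

theorem exists_isExpUpTo_modelTrace (p D : ℕ) (m' f' : MvPolynomial (Fin (n + 1)) ℤ) :
    ∃ H : PowerSeries ℤ, ∀ N, IsExpUpTo N H (modelTrace p D m' f') := by
  set A := cartierMatrix p D (f' ^ (p - 1))
  set B := cartierMatrix p D ((m' * f') ^ (p - 1))
  obtain ⟨E, hE⟩ := exists_mul_eq_one_of_constantCoeff (constantCoeff_detSeries A)
  obtain ⟨G, hG⟩ := exists_mul_eq_one_of_constantCoeff (constantCoeff_detSeries ((p : ℤ) • B))
  -- H = det(1 - TB) / (det(1 - TA) det(1 - pTB)).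
  refine ⟨detSeries B * (E * G), fun N => ((isExpUpTo_detSeries B N).mul
    (((isExpUpTo_detSeries A N).inv hE).mul
      ((isExpUpTo_detSeries ((p : ℤ) • B) N).inv hG))).congr fun k _ _ => ?_⟩
  rw [modelTrace, _root_.smul_pow, Matrix.trace_smul, smul_eq_mul]
  ring

/-- The number `∑_{j ≤ J} h_{a j} T^j` with coefficients reduced modulo `p`. -/
noncomputable def sectionPoly (p a J : ℕ) (H : PowerSeries ℤ) : (ZMod p)[X] :=
  ∑ j ∈ Finset.range (J + 1),
    Polynomial.monomial j ((PowerSeries.coeff (a * j) H : ℤ) : ZMod p)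

theorem coeff_sectionPoly (p a J : ℕ) (H : PowerSeries ℤ) (j : ℕ) :
    (sectionPoly p a J H).coeff j =
      if j ≤ J then ((PowerSeries.coeff (a * j) H : ℤ) : ZMod p) else 0 := by
  rw [sectionPoly, Polynomial.finsetSum_coeff]
  simp only [Polynomial.coeff_monomial]
  rw [Finset.sum_ite_eq' (Finset.range (J + 1))]
  simp

theorem coeff_detSeries_eq_zero {R : Type*} [CommRing R] {ι : Type*} [Fintype ι] [DecidableEq ι]
    (A : Matrix ι ι R) {j : ℕ} (hj : Fintype.card ι < j) :
    PowerSeries.coeff j (detSeries A) = 0 := by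
  nontriviality R
  rw [detSeries_eq_charpolyRev, Polynomial.coeff_coe]
  apply Polynomial.coeff_eq_zero_of_natDegree_lt
  rw [← Matrix.reverse_charpoly]
  refine lt_of_le_of_lt (Polynomial.reverse_natDegree_le _) ?_
  rwa [Matrix.charpoly_natDegree_eq_dim]

theorem map_castRingHom_map {R S : Type*} [CommRing R] [CommRing S] (φ : R →+* S)
    (H : PowerSeries ℤ) :
    (H.map (Int.castRingHom R)).map φ = H.map (Int.castRingHom S) := by
  ext k
  simp

theorem map_castRingHom_injective {H H' : PowerSeries ℤ}
    (h : H.map (Int.castRingHom (Fbar p)) = H'.map (Int.castRingHom (Fbar p))) :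
    H.map (Int.castRingHom (ZMod p)) = H'.map (Int.castRingHom (ZMod p)) := by
  rw [← map_castRingHom_map (algebraMap (ZMod p) (Fbar p)) H,
    ← map_castRingHom_map (algebraMap (ZMod p) (Fbar p)) H'] at h
  exact PowerSeries.map_injective _ (algebraMap (ZMod p) (Fbar p)).injective h

/-- The section `∑ h_{a j} T^j` of a power series. -/
noncomputable def sectionSeries (a : ℕ) (H : PowerSeries ℤ) : PowerSeries ℤ :=
  PowerSeries.mk fun j => PowerSeries.coeff (a * j) H

/-- Extracting the exponents divisible by a is linear over the series in T^a. For odd n this turns H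
· Z(T^a) ≡ 1 into (section of H) · Z ≡ 1. -/
theorem sectionSeries_mul_expand {a : ℕ} (ha : a ≠ 0) (H W : PowerSeries ℤ) :
    sectionSeries a (H * PowerSeries.expand a ha W) = sectionSeries a H * W := by
  ext j
  rw [sectionSeries, PowerSeries.coeff_mk, PowerSeries.coeff_mul, PowerSeries.coeff_mul]
  symm
  have hinj : Function.Injective fun x : ℕ × ℕ => (a * x.1, a * x.2) := fun x y h => by
    simp only [Prod.mk.injEq, mul_eq_mul_left_iff, ha, or_false] at h
    exact Prod.ext h.1 h.2
  refine Finset.sum_of_injOn (fun x => (a * x.1, a * x.2)) hinj.injOn ?_ ?_ ?_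
  · intro x hx
    have hx' := Finset.HasAntidiagonal.mem_antidiagonal.1 (Finset.mem_coe.1 hx)
    rw [Finset.mem_coe, Finset.HasAntidiagonal.mem_antidiagonal, ← mul_add, hx']
  · rintro ⟨y, z⟩ hx hne
    rw [Finset.HasAntidiagonal.mem_antidiagonal] at hx
    rw [PowerSeries.coeff_expand_of_not_dvd, mul_zero]
    rintro ⟨c, rfl⟩
    have h1 : a ∣ y := (Nat.dvd_add_left (dvd_mul_right a c)).1 ⟨j, hx⟩
    obtain ⟨b, rfl⟩ := h1
    refine hne ⟨(b, c), ?_, rfl⟩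
    rw [Finset.mem_coe, Finset.HasAntidiagonal.mem_antidiagonal]
    rw [← mul_add] at hx
    exact Nat.eq_of_mul_eq_mul_left (Nat.pos_of_ne_zero ha) hx
  · intro x _
    rw [PowerSeries.coeff_expand_mul, sectionSeries, PowerSeries.coeff_mk]

/-- Two trace formulas meet. The one over 𝔽_p shows that the section of H reduces to Z or to its
inverse, according to the parity of n. The one over 𝔽_q identifies the same series with det(1 - TA)
for a matrix of size D^n, so it is a polynomial of degree at most D^n and truncation at J loses
nothing. -/
theorem IsPrimeFieldModel.isReductionModP (hn : 1 ≤ n) {f : MvPolynomial (Fin n) (AdjoinRoot m)}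
    {m' f' : MvPolynomial (Fin (n + 1)) ℤ} (h : IsPrimeFieldModel f m' f') {D : ℕ}
    (hD : ∀ i, f'.degreeOf i ≤ D) (hD' : ∀ i, (m' * f').degreeOf i ≤ D)
    (hfD : ∀ i, f.degreeOf i ≤ D) {H : PowerSeries ℤ}
    (hH : ∀ N, IsExpUpTo N H (modelTrace p D m' f')) {J : ℕ} (hJ : D ^ n ≤ J) :
    if Even n then
      IsReductionModP p (hypersurfaceZeta (AdjoinRoot m) p f) (sectionPoly p m.natDegree J H) 1
    else IsReductionModP p (hypersurfaceZeta (AdjoinRoot m) p f) 1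
      (sectionPoly p m.natDegree J H) := by
  classical
  set a := m.natDegree with ha'
  have ha : a ≠ 0 := natDegree_ne_zero_of_fact_irreducible m
  let ψ : AdjoinRoot m →+* Fbar p :=
    rootHom (IsAlgClosed.exists_eval₂_eq_zero (algebraMap (ZMod p) (Fbar p)) m
      (Polynomial.degree_pos_of_irreducible hm.out).ne').choose
    (IsAlgClosed.exists_eval₂_eq_zero (algebraMap (ZMod p) (Fbar p)) m
      (Polynomial.degree_pos_of_irreducible hm.out).ne').choose_spec
  obtain ⟨W, hWZ, hW⟩ := exists_integral_zeta ψ f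
  obtain ⟨A, hA⟩ := exists_isExpTrivial_zeroCount hn ψ f hfD
  have hs := h.isExpTrivial hn ψ hD hD'
  let c : PowerSeries ℤ →+* PowerSeries (WittVector p (Fbar p)) :=
    PowerSeries.map (Int.castRingHom (WittVector p (Fbar p)))
  let r : PowerSeries (WittVector p (Fbar p)) →+* PowerSeries (Fbar p) :=
    PowerSeries.map WittVector.constantCoeff
  have hrc : ∀ V, r (c V) = V.map (Int.castRingHom (Fbar p)) := fun V =>
    map_castRingHom_map _ V
  have hcW : ∀ N, IsExpUpTo N (c W)
      fun k => (zeroCount (MvPolynomial.map ψ f) (a * k) : WittVector p (Fbar p)) := fun N =>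
    ((hW N).map (Int.castRingHom (WittVector p (Fbar p)))).congr fun k _ _ => by simp [ha']
  have hcX : ∀ N, IsExpUpTo N (c (PowerSeries.expand a ha W))
      fun k => ((if a ∣ k then a * zeroCount (MvPolynomial.map ψ f) k else 0 : ℕ) :
        WittVector p (Fbar p)) := fun N =>
    (((hW N).expand ha).map (Int.castRingHom (WittVector p (Fbar p)))).congr fun k _ _ => by
      by_cases hk : a ∣ k
      · simp only [hk, if_true, ← ha', Nat.mul_div_cancel' hk]
        simp
      · simp [hk]
  have hcH : ∀ N, IsExpUpTo N (c H)
      fun k => ((modelTrace p D m' f' k : ℤ) : WittVector p (Fbar p)) := fun N =>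
    (hH N).map (Int.castRingHom (WittVector p (Fbar p)))
  have h1e : ∀ N, IsExpUpTo N (1 : PowerSeries (WittVector p (Fbar p))) (fun _ => 0) := fun N =>
    isExpUpTo_iff_coeff.2 ⟨by simp, fun k _ => by simp [PowerSeries.coeff_one]⟩
  -- the section of `H` modulo `p` is the coefficient list of a polynomial
  have hpoly : ∀ V : PowerSeries ℤ, r (c V) = r (detSeries A) →
      (sectionSeries a H).map (Int.castRingHom (ZMod p)) = V.map (Int.castRingHom (ZMod p)) →
      ((sectionPoly p a J H : (ZMod p)[X]) : PowerSeries (ZMod p)) =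
        (sectionSeries a H).map (Int.castRingHom (ZMod p)) := by
    intro V hV hHV
    ext j
    rw [Polynomial.coeff_coe, coeff_sectionPoly]
    split_ifs with hj
    · simp [sectionSeries]
    · rw [hHV]
      have h2 := congrArg (PowerSeries.coeff j) hV
      have h3 : PowerSeries.coeff j (r (detSeries A)) = 0 := by
        rw [PowerSeries.coeff_map, coeff_detSeries_eq_zero, map_zero]
        rw [Fintype.card_fun, Fintype.card_fin, Fintype.card_fin]
        omega
      rw [h3, hrc, ← map_castRingHom_map (algebraMap (ZMod p) (Fbar p)) V,
        PowerSeries.coeff_map] at h2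
      exact ((map_eq_zero_iff _ (algebraMap (ZMod p) (Fbar p)).injective).1 h2).symm
  split_ifs with hpar
  · -- `n` even
    simp only [hpar.neg_one_pow, one_mul] at hA hs
    have hWA : r (c W) = r (detSeries A) :=
      IsExpTrivial.map_coeff_eq (hA.congr fun k _ => by rw [sub_neg_eq_add]) hcW
        (isExpUpTo_detSeries A)
    have hHX : r (c H) = r (c (PowerSeries.expand a ha W)) :=
      IsExpTrivial.map_coeff_eq hs hcH hcX
    rw [hrc, hrc] at hHX
    have hsec : (sectionSeries a H).map (Int.castRingHom (ZMod p)) =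
        W.map (Int.castRingHom (ZMod p)) := by
      have h2 := map_castRingHom_injective hHX
      ext j
      have h3 := congrArg (PowerSeries.coeff (a * j)) h2
      rw [PowerSeries.coeff_map, PowerSeries.coeff_map, PowerSeries.coeff_expand_mul] at h3
      rwa [PowerSeries.coeff_map, PowerSeries.coeff_map, sectionSeries, PowerSeries.coeff_mk]
    refine ⟨W, hWZ, isCoprime_one_right, Polynomial.coeff_one_zero, ?_⟩
    rw [hpoly W hWA hsec, hsec, Polynomial.coe_one, one_mul]
  · -- `n` odd
    have hpar' : Odd n := Nat.not_even_iff_odd.1 hpar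
    simp only [hpar'.neg_one_pow, neg_one_mul] at hA hs
    have hWA : r (c W * detSeries A) = r 1 :=
      IsExpTrivial.map_coeff_eq (hA.congr fun k _ => by rw [sub_zero])
        (fun N => (hcW N).mul (isExpUpTo_detSeries A N)) h1e
    have hHX : r (c H * c (PowerSeries.expand a ha W)) = r 1 :=
      IsExpTrivial.map_coeff_eq (hs.congr fun k _ => by rw [sub_neg_eq_add, sub_zero]; rfl)
        (fun N => (hcH N).mul (hcX N)) h1e
    rw [← map_mul, hrc, map_one] at hHX
    have hHX' : (H * PowerSeries.expand a ha W).map (Int.castRingHom (Fbar p)) =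
        (1 : PowerSeries ℤ).map (Int.castRingHom (Fbar p)) := by rw [hHX, map_one]
    have hsec : (sectionSeries a H * W).map (Int.castRingHom (ZMod p)) = 1 := by
      rw [← sectionSeries_mul_expand ha]
      have h2 := map_castRingHom_injective hHX'
      ext j
      have h3 := congrArg (PowerSeries.coeff (a * j)) h2
      rw [map_one, PowerSeries.coeff_map, PowerSeries.coeff_one] at h3
      rw [PowerSeries.coeff_map, sectionSeries, PowerSeries.coeff_mk, h3, PowerSeries.coeff_one]
      exact if_congr (by simp [ha]) rfl rfl
    have hsecA : r (c (sectionSeries a H)) = r (detSeries A) := by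
      have h2 : r (c (sectionSeries a H)) * r (c W) = 1 := by
        rw [← map_mul, ← map_mul, hrc,
          ← map_castRingHom_map (algebraMap (ZMod p) (Fbar p)), hsec, map_one]
      rw [map_mul, map_one] at hWA
      calc r (c (sectionSeries a H)) = r (c (sectionSeries a H)) * (r (c W) * r (detSeries A)) := by
            rw [hWA, mul_one]
        _ = r (detSeries A) := by rw [← mul_assoc, h2, one_mul]
    have hP := hpoly _ hsecA rfl
    refine ⟨W, hWZ, isCoprime_one_left, ?_, ?_⟩
    · rw [coeff_sectionPoly, if_pos (Nat.zero_le _), mul_zero,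
        (isExpUpTo_iff_coeff.1 (hH 0)).1, Int.cast_one]
    · rw [hP, ← map_mul, hsec, Polynomial.coe_one]

end ZetaModP

/-! ### Coefficients as digits -/

section Digits

theorem polynomial_coeff_le_eval_one (Q : ℕ[X]) (j : ℕ) : Q.coeff j ≤ Q.eval 1 := by
  by_cases hj : j ∈ Q.support
  · rw [Polynomial.eval_eq_sum, Polynomial.sum]
    simp only [one_pow, mul_one]
    exact Finset.single_le_sum (f := fun e => Q.coeff e) (fun _ _ => Nat.zero_le _) hj
  · rw [Polynomial.notMem_support_iff.1 hj]
    exact Nat.zero_le _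

/-- Digits below the position `j` inclusive determine the digit at `j`. -/
theorem eval_div_pow_mod_of_le {B : ℕ} (Q : ℕ[X]) (j : ℕ) (hQ : ∀ i ≤ j, Q.coeff i < B) :
    Q.eval B / B ^ j % B = Q.coeff j := by
  have hB : 0 < B := (Nat.zero_le _).trans_lt (hQ 0 (Nat.zero_le _))
  have hdiv : ∀ Q : ℕ[X], Q.eval B = Q.coeff 0 + B * Q.divX.eval B := by
    intro Q
    conv_lhs => rw [← Polynomial.divX_mul_X_add Q]
    simp only [Polynomial.eval_add, Polynomial.eval_mul, Polynomial.eval_X, Polynomial.eval_C]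
    ring
  induction j generalizing Q with
  | zero =>
    rw [pow_zero, Nat.div_one, hdiv, Nat.add_mul_mod_self_left, Nat.mod_eq_of_lt (hQ 0 le_rfl)]
  | succ j ih =>
    rw [pow_succ', ← Nat.div_div_eq_div_mul, hdiv, Nat.add_mul_div_left _ _ hB,
      Nat.div_eq_of_lt (hQ 0 (Nat.zero_le _)), zero_add, ih _ (fun i hi => by
        rw [Polynomial.coeff_divX]; exact hQ _ (by omega)), Polynomial.coeff_divX]

theorem eval_div_pow_mod {B : ℕ} (Q : ℕ[X]) (hQ : ∀ j, Q.coeff j < B) (j : ℕ) :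
    Q.eval B / B ^ j % B = Q.coeff j :=
  eval_div_pow_mod_of_le Q j fun i _ => hQ i

end Digits

/-! ### Kronecker substitution -/

section Kronecker

variable {n : ℕ}

/-- The number with base `E` digits `d`. -/
def digitCode (E : ℕ) (d : Fin n → ℕ) : ℕ := ∑ i, d i * E ^ (i : ℕ)

theorem digitCode_eq_finFunctionFinEquiv {E : ℕ} (d : Fin n → Fin E) :
    digitCode E (fun i => (d i : ℕ)) = (finFunctionFinEquiv d : ℕ) :=
  (finFunctionFinEquiv_apply d).symm

theorem digitCode_lt {E : ℕ} {d : Fin n → ℕ} (hd : ∀ i, d i < E) : digitCode E d < E ^ n := by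
  rw [show d = fun i => ((⟨d i, hd i⟩ : Fin E) : ℕ) from rfl, digitCode_eq_finFunctionFinEquiv]
  exact Fin.is_lt _

theorem digitCode_div_mod {E : ℕ} {d : Fin n → ℕ} (hd : ∀ i, d i < E) (i : Fin n) :
    digitCode E d / E ^ (i : ℕ) % E = d i := by
  have h := finFunctionFinEquiv_symm_apply_val
    (finFunctionFinEquiv fun i => (⟨d i, hd i⟩ : Fin E)) i
  rw [Equiv.symm_apply_apply, ← digitCode_eq_finFunctionFinEquiv] at h
  exact h.symm

theorem digitCode_inj {E : ℕ} {d d' : Fin n → ℕ} (hd : ∀ i, d i < E) (hd' : ∀ i, d' i < E)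
    (h : digitCode E d = digitCode E d') : d = d' := by
  funext i
  rw [← digitCode_div_mod hd i, h, digitCode_div_mod hd' i]

theorem mul_digitCode (E c : ℕ) (d : Fin n → ℕ) :
    digitCode E (fun i => c * d i) = c * digitCode E d := by
  rw [digitCode, digitCode, Finset.mul_sum]
  exact Finset.sum_congr rfl fun i _ => by ring

/-- Kronecker substitution `x_i ↦ y^{E^i}`. -/
noncomputable def kronecker (E : ℕ) : MvPolynomial (Fin n) ℕ →+* ℕ[X] :=
  MvPolynomial.eval₂Hom Polynomial.C fun i => Polynomial.X ^ E ^ (i : ℕ)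

theorem kronecker_monomial (E : ℕ) (e : Fin n →₀ ℕ) (c : ℕ) :
    kronecker E (MvPolynomial.monomial e c) = Polynomial.monomial (digitCode E e) c := by
  rw [kronecker, MvPolynomial.coe_eval₂Hom, MvPolynomial.eval₂_monomial, Finsupp.prod_fintype _ _
    (by simp)]
  simp only [← pow_mul]
  rw [Finset.prod_pow_eq_pow_sum, ← Polynomial.C_mul_X_pow_eq_monomial, digitCode]
  simp only [mul_comm]

theorem eval_kronecker (E B : ℕ) (P : MvPolynomial (Fin n) ℕ) :
    (kronecker E P).eval B = MvPolynomial.eval (fun i : Fin n => B ^ E ^ (i : ℕ)) P := by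
  have h := MvPolynomial.eval₂_comp_left (Polynomial.evalRingHom B) Polynomial.C
    (fun i : Fin n => Polynomial.X ^ E ^ (i : ℕ)) P
  rw [kronecker, MvPolynomial.coe_eval₂Hom]
  refine h.trans ?_
  rw [MvPolynomial.eval, MvPolynomial.coe_eval₂Hom]
  congr 1
  · exact RingHom.ext fun x => by simp
  · funext i
    simp

/-- With all partial degrees below E, distinct exponent vectors have distinct base E codes, so no
two monomials merge. -/
theorem coeff_kronecker {E : ℕ} (P : MvPolynomial (Fin n) ℕ) (hP : ∀ i, P.degreeOf i < E)
    (d : Fin n →₀ ℕ) (hd : ∀ i, d i < E) :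
    (kronecker E P).coeff (digitCode E d) = MvPolynomial.coeff d P := by
  conv_lhs => rw [P.as_sum, map_sum, Polynomial.finsetSum_coeff]
  simp only [kronecker_monomial, Polynomial.coeff_monomial]
  by_cases hdP : d ∈ P.support
  · rw [Finset.sum_eq_single_of_mem d hdP, if_pos rfl]
    intro e he hne
    rw [if_neg]
    intro h
    apply hne
    refine DFunLike.coe_injective (digitCode_inj (fun i => ?_) hd h)
    exact lt_of_le_of_lt (MvPolynomial.degreeOf_le_iff.1 le_rfl e he) (hP i)
  · rw [MvPolynomial.notMem_support_iff.1 hdP]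
    refine Finset.sum_eq_zero fun e he => ?_
    rw [if_neg]
    intro h
    have : (e : Fin n → ℕ) = d := digitCode_inj (fun i =>
      lt_of_le_of_lt (MvPolynomial.degreeOf_le_iff.1 le_rfl e he) (hP i)) hd h
    exact hdP (DFunLike.coe_injective this ▸ he)

/-- Reading off a coefficient from a value at a large point. -/
theorem eval_div_pow_digitCode_mod {E B : ℕ} (P : MvPolynomial (Fin n) ℕ)
    (hP : ∀ i, P.degreeOf i < E) (hB : MvPolynomial.eval (fun _ => 1) P < B)
    (d : Fin n →₀ ℕ) (hd : ∀ i, d i < E) :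
    MvPolynomial.eval (fun i : Fin n => B ^ E ^ (i : ℕ)) P / B ^ digitCode E d % B =
      MvPolynomial.coeff d P := by
  rw [← eval_kronecker, eval_div_pow_mod, coeff_kronecker P hP d hd]
  intro j
  refine (polynomial_coeff_le_eval_one _ j).trans_lt ?_
  rw [eval_kronecker]
  simpa using hB

/-- The indicator of the numbers whose `n + 1` lowest base `E` digits lie in `[1, D]`. -/
def boxIndicator (n D E j : ℕ) : ℕ :=
  -- Subtraction is truncated: 1 - (1 - x) is 1 if x > 0 and 0 if x = 0, and the factor d · (D + 1 -
  -- d) is nonzero exactly for 1 ≤ d ≤ D.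
  1 - (1 - ∏ i ∈ Finset.range (n + 1), (j / E ^ i % E) * (D + 1 - j / E ^ i % E))

theorem boxIndicator_le_one (n D E j : ℕ) : boxIndicator n D E j ≤ 1 := Nat.sub_le _ _

theorem boxIndicator_eq_one {n D E j : ℕ} (h : ∀ i ≤ n, 1 ≤ j / E ^ i % E ∧ j / E ^ i % E ≤ D) :
    boxIndicator n D E j = 1 := by
  have : 0 < ∏ i ∈ Finset.range (n + 1), (j / E ^ i % E) * (D + 1 - j / E ^ i % E) := by
    refine Finset.prod_pos fun i hi => ?_
    have := h i (Nat.lt_succ_iff.1 (Finset.mem_range.1 hi))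
    exact Nat.mul_pos (by omega) (by omega)
  rw [boxIndicator]
  omega

theorem boxIndicator_eq_zero {n D E j : ℕ}
    (h : ¬ ∀ i ≤ n, 1 ≤ j / E ^ i % E ∧ j / E ^ i % E ≤ D) :
    boxIndicator n D E j = 0 := by
  simp only [not_forall] at h
  obtain ⟨i, hi, h⟩ := h
  have : ∏ i ∈ Finset.range (n + 1), (j / E ^ i % E) * (D + 1 - j / E ^ i % E) = 0 := by
    refine Finset.prod_eq_zero (Finset.mem_range.2 (Nat.lt_succ_of_le hi)) ?_
    rw [Nat.mul_eq_zero]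
    omega
  rw [boxIndicator, this]

theorem digitCode_boxExponent_lt {D E : ℕ} (hDE : D < E) (u : Fin (n + 1) → Fin D) :
    digitCode E (boxExponent u) < E ^ (n + 1) :=
  digitCode_lt fun i => by have := (u i).2; simp only [boxExponent_apply]; omega

/-- This lets a single loop over the E^(n+1) codes replace nested loops over exponent vectors. -/
theorem sum_boxIndicator_mul {R : Type*} [Semiring R] {D E : ℕ} (hDE : D < E) (φ : ℕ → R) :
    ∑ j ∈ Finset.range (E ^ (n + 1)), (boxIndicator n D E j : R) * φ j =
      ∑ u : Fin (n + 1) → Fin D, φ (digitCode E (boxExponent u)) := by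
  have hlt : ∀ (u : Fin (n + 1) → Fin D) i, boxExponent u i < E := fun u i => by
    have := (u i).2
    simp only [boxExponent_apply]
    omega
  symm
  refine Finset.sum_of_injOn (fun u => digitCode E (boxExponent u)) ?_ ?_ ?_ ?_
  · intro u _ v _ h
    exact boxExponent_injective (DFunLike.coe_injective (digitCode_inj (hlt u) (hlt v) h))
  · intro u _
    exact Finset.mem_coe.2 (Finset.mem_range.2 (digitCode_boxExponent_lt hDE u))
  · intro j hj hne
    rw [Finset.mem_range] at hj
    rw [boxIndicator_eq_zero, Nat.cast_zero, zero_mul]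
    intro h
    apply hne
    obtain ⟨d, hd⟩ := (finFunctionFinEquiv (m := E) (n := n + 1)).surjective ⟨j, hj⟩
    have hdj : digitCode E (fun i => (d i : ℕ)) = j := by
      rw [digitCode_eq_finFunctionFinEquiv, hd]
    have hdi : ∀ i, 1 ≤ (d i : ℕ) ∧ (d i : ℕ) ≤ D := fun i => by
      have h1 := h i (Nat.lt_succ_iff.1 i.2)
      rwa [← hdj, digitCode_div_mod (fun i => (d i).2) i] at h1
    obtain ⟨u, hu⟩ := exists_boxExponent_eq (D := D)
      (e := Finsupp.equivFunOnFinite.symm fun i => (d i : ℕ))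
      (fun i => (hdi i).1) (fun i => (hdi i).2)
    refine ⟨u, Finset.mem_coe.2 (Finset.mem_univ _), ?_⟩
    dsimp only
    rw [hu]
    exact hdj
  · intro u _
    rw [boxIndicator_eq_one, Nat.cast_one, one_mul]
    intro i hi
    have h1 := digitCode_div_mod (hlt u) ⟨i, Nat.lt_succ_of_le hi⟩
    dsimp only at h1
    rw [h1, boxExponent_apply]
    have := (u ⟨i, Nat.lt_succ_of_le hi⟩).2
    omega

end Kronecker

/-! ### The Cartier operator on encoded polynomials -/

section CartierNumbers

variable {n : ℕ}

/-- The operator `ψ_p` on numbers that encode polynomials in base `B`. -/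
def cartierNum (n D E B p g : ℕ) : ℕ :=
  ∑ j ∈ Finset.range (E ^ (n + 1)), boxIndicator n D E j * (g / (B ^ p) ^ j % B) * B ^ j

/-- The iterates of `h ↦ ψ_p (G h)`, started with the monomial of degree `l`. -/
def cartierIter (n D E B p G l : ℕ) : ℕ → ℕ
  | 0 => B ^ l
  | i + 1 => cartierNum n D E B p (G * cartierIter n D E B p G l i)

/-- The number that encodes a vector. -/
noncomputable def encodeVec (D E B : ℕ) (c : (Fin (n + 1) → Fin D) → ℕ) : ℕ :=
  ∑ v, c v * B ^ digitCode E (boxExponent v)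

theorem eval_one_mul_sum (P : MvPolynomial (Fin n) ℕ) {D : ℕ} (c : (Fin n → Fin D) → ℕ) :
    MvPolynomial.eval (fun _ => 1) (P * ∑ w, MvPolynomial.monomial (boxExponent w) (c w)) =
      MvPolynomial.eval (fun _ => 1) P * ∑ w, c w := by
  rw [map_mul, map_sum]
  congr 1
  refine Finset.sum_congr rfl fun w _ => ?_
  rw [MvPolynomial.eval_monomial]
  simp

theorem coeff_mul_sum_monomial {p D : ℕ} (P : MvPolynomial (Fin n) ℕ)
    (c : (Fin n → Fin D) → ℕ) (v : Fin n → Fin D) :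
    MvPolynomial.coeff (p • boxExponent v)
      (P * ∑ w, MvPolynomial.monomial (boxExponent w) (c w)) =
      (cartierMatrix p D P).mulVec c v := by
  rw [Finset.mul_sum, MvPolynomial.coeff_sum]
  refine Finset.sum_congr rfl fun w _ => ?_
  change _ = MvPolynomial.coeff (p • boxExponent v) (P * MvPolynomial.monomial (boxExponent w) 1) *
    c w
  rw [MvPolynomial.coeff_mul_monomial', MvPolynomial.coeff_mul_monomial', mul_one]
  split_ifs
  · rfl
  · rw [zero_mul]

theorem degreeOf_mul_sum_monomial_le {p D : ℕ} (hp : 1 ≤ p) {P : MvPolynomial (Fin n) ℕ}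
    (hP : ∀ i, P.degreeOf i ≤ (p - 1) * D) (c : (Fin n → Fin D) → ℕ) (i : Fin n) :
    (P * ∑ w, MvPolynomial.monomial (boxExponent w) (c w)).degreeOf i ≤ p * D := by
  classical
  have h1 : (∑ w, MvPolynomial.monomial (boxExponent w) (c w)).degreeOf i ≤ D := by
    rw [MvPolynomial.degreeOf_le_iff]
    intro e he
    obtain ⟨w, -, hw⟩ := Finset.mem_biUnion.1 (MvPolynomial.support_sum he)
    rw [Finset.mem_singleton.1 (MvPolynomial.support_monomial_subset hw), boxExponent_apply]
    exact (w i).2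
  refine (MvPolynomial.degreeOf_mul_le _ _ _).trans ((add_le_add (hP i) h1).trans (le_of_eq ?_))
  obtain ⟨q, rfl⟩ := Nat.exists_eq_add_of_le' hp
  simp [Nat.succ_mul]

theorem mvPolynomial_sum_coeff_le_eval_one (P : MvPolynomial (Fin n) ℕ) {ι : Type*} [Fintype ι]
    {e : ι → Fin n →₀ ℕ} (he : Function.Injective e) :
    ∑ v, MvPolynomial.coeff (e v) P ≤ MvPolynomial.eval (fun _ => 1) P := by
  classical
  rw [MvPolynomial.eval_eq']
  simp only [one_pow, Finset.prod_const_one, mul_one]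
  calc ∑ v, MvPolynomial.coeff (e v) P
      = ∑ d ∈ Finset.univ.image e, MvPolynomial.coeff d P :=
        (Finset.sum_image fun x _ y _ h => he h).symm
    _ ≤ ∑ d ∈ Finset.univ.image e ∪ P.support, MvPolynomial.coeff d P :=
        Finset.sum_le_sum_of_subset Finset.subset_union_left
    _ = ∑ d ∈ P.support, MvPolynomial.coeff d P := by
        symm
        refine Finset.sum_subset Finset.subset_union_right fun d _ hd => ?_
        exact MvPolynomial.notMem_support_iff.1 hd

/-- For natural coefficients, the value at (1, …, 1) is the sum of the coefficients. It is
multiplicative, and ψ_p only discards terms. This measure controls all carries. -/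
theorem sum_mulVec_cartierMatrix_le {p D : ℕ} (hp : 1 ≤ p) (P : MvPolynomial (Fin n) ℕ)
    (c : (Fin n → Fin D) → ℕ) :
    ∑ v, (cartierMatrix p D P).mulVec c v ≤ MvPolynomial.eval (fun _ => 1) P * ∑ w, c w := by
  rw [← eval_one_mul_sum]
  simp only [← coeff_mul_sum_monomial]
  refine mvPolynomial_sum_coeff_le_eval_one _ fun u v h => boxExponent_injective ?_
  ext i
  have := DFunLike.congr_fun h i
  simp only [Finsupp.smul_apply, smul_eq_mul] at this
  exact Nat.eq_of_mul_eq_mul_left hp this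

/-- The digit of the product at position p · code(v) is its coefficient at p v. No monomials merge,
since the exponents of the product are at most p D < E, and no carry occurs, since the sum of its
coefficients is below B. -/
theorem cartierNum_encodeVec {p D E B : ℕ} (hp : 1 ≤ p) (hE : p * D < E)
    {P : MvPolynomial (Fin (n + 1)) ℕ} (hP : ∀ i, P.degreeOf i ≤ (p - 1) * D)
    (c : (Fin (n + 1) → Fin D) → ℕ)
    (hB : MvPolynomial.eval (fun _ => 1) P * ∑ w, c w < B) :
    cartierNum n D E B p (MvPolynomial.eval (fun i : Fin (n + 1) => B ^ E ^ (i : ℕ)) P * encodeVec D E B c) =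
      encodeVec D E B ((cartierMatrix p D P).mulVec c) := by
  have hDE : D < E := lt_of_le_of_lt (Nat.le_mul_of_pos_left D hp) hE
  have h1 : MvPolynomial.eval (fun i : Fin (n + 1) => B ^ E ^ (i : ℕ)) P * encodeVec D E B c =
      MvPolynomial.eval (fun i : Fin (n + 1) => B ^ E ^ (i : ℕ))
        (P * ∑ w, MvPolynomial.monomial (boxExponent w) (c w)) := by
    rw [map_mul, map_sum, encodeVec]
    congr 1
    refine Finset.sum_congr rfl fun w _ => ?_
    rw [MvPolynomial.eval_monomial, Finsupp.prod_fintype _ _ (by simp)]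
    simp only [← pow_mul]
    rw [Finset.prod_pow_eq_pow_sum, digitCode]
    simp only [mul_comm]
  rw [cartierNum]
  simp only [mul_assoc]
  have := sum_boxIndicator_mul (n := n) (R := ℕ) hDE fun j =>
    (MvPolynomial.eval (fun i : Fin (n + 1) => B ^ E ^ (i : ℕ)) P * encodeVec D E B c) / (B ^ p) ^ j % B * B ^ j
  simp only [Nat.cast_id] at this
  rw [this]
  refine Finset.sum_congr rfl fun v _ => ?_
  congr 1
  have hcode : p * digitCode E (boxExponent v) = digitCode E (p • boxExponent v) := by
    rw [← mul_digitCode]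
    rfl
  rw [← pow_mul, hcode, h1, eval_div_pow_digitCode_mod, coeff_mul_sum_monomial]
  · exact fun i => lt_of_le_of_lt (degreeOf_mul_sum_monomial_le hp hP c i) hE
  · rw [eval_one_mul_sum]
    exact hB
  · intro i
    have h2 : (v i : ℕ) + 1 ≤ D := (v i).2
    simp only [Finsupp.smul_apply, smul_eq_mul, boxExponent_apply]
    exact lt_of_le_of_lt (Nat.mul_le_mul_left p h2) hE

theorem cartierIter_eq_encodeVec {p D E B K Γ : ℕ} (hp : 1 ≤ p) (hE : p * D < E)
    {P : MvPolynomial (Fin (n + 1)) ℕ} (hP : ∀ i, P.degreeOf i ≤ (p - 1) * D)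
    (hΓ : MvPolynomial.eval (fun _ => 1) P ≤ Γ) (hB : Γ ^ K < B) (u : Fin (n + 1) → Fin D)
    (hΓ1 : 1 ≤ Γ) (i : ℕ) (hi : i ≤ K) :
    cartierIter n D E B p (MvPolynomial.eval (fun i : Fin (n + 1) => B ^ E ^ (i : ℕ)) P)
      (digitCode E (boxExponent u)) i =
      encodeVec D E B (fun v => (cartierMatrix p D P ^ i) v u) ∧
    ∑ v, (cartierMatrix p D P ^ i) v u ≤ Γ ^ i := by
  induction i with
  | zero =>
    simp [cartierIter, encodeVec, Matrix.one_apply]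
  | succ i ih =>
    obtain ⟨h1, h2⟩ := ih (by omega)
    have hpow : (fun v => (cartierMatrix p D P ^ (i + 1)) v u) =
        (cartierMatrix p D P).mulVec fun v => (cartierMatrix p D P ^ i) v u := by
      funext v
      rw [pow_succ', Matrix.mul_apply]
      rfl
    have h3 : MvPolynomial.eval (fun _ => 1) P * ∑ v, (cartierMatrix p D P ^ i) v u ≤
        Γ ^ (i + 1) := by
      rw [pow_succ']
      exact Nat.mul_le_mul hΓ h2
    constructor
    · rw [cartierIter, h1, hpow, cartierNum_encodeVec hp hE hP]
      exact h3.trans_lt ((Nat.pow_le_pow_right hΓ1 hi).trans_lt hB)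
    · refine le_trans (le_of_eq ?_) ((sum_mulVec_cartierMatrix_le hp P _).trans h3)
      exact Finset.sum_congr rfl fun v _ => congrFun hpow v

theorem encodeVec_div_mod {D E B : ℕ} (hDE : D < E) (c : (Fin (n + 1) → Fin D) → ℕ)
    (hc : ∑ v, c v < B) (u : Fin (n + 1) → Fin D) :
    encodeVec D E B c / B ^ digitCode E (boxExponent u) % B = c u := by
  have hlt : ∀ (u : Fin (n + 1) → Fin D) i, boxExponent u i < E := fun u i => by
    have := (u i).2
    simp only [boxExponent_apply]
    omega
  let Q : ℕ[X] := ∑ v, Polynomial.monomial (digitCode E (boxExponent v)) (c v)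
  have hQ : encodeVec D E B c = Q.eval B := by
    simp only [Q, encodeVec, Polynomial.eval_finsetSum, Polynomial.eval_monomial]
  have hQ1 : Q.eval 1 = ∑ v, c v := by
    simp only [Q, Polynomial.eval_finsetSum, Polynomial.eval_monomial, one_pow, mul_one]
  rw [hQ, eval_div_pow_mod]
  · simp only [Q, Polynomial.finsetSum_coeff, Polynomial.coeff_monomial]
    rw [Finset.sum_eq_single_of_mem u (Finset.mem_univ _), if_pos rfl]
    intro v _ hne
    rw [if_neg]
    exact fun h => hne
      (boxExponent_injective (DFunLike.coe_injective (digitCode_inj (hlt v) (hlt u) h)))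
  · intro j
    exact (polynomial_coeff_le_eval_one _ j).trans_lt (hQ1 ▸ hc)

end CartierNumbers

/-! ### The exponential recursion on digits -/

section ExponentialNumbers

/-- The truncated exponential of a logarithmic derivative, on numbers in base `B`. -/
def expNum (B S : ℕ) : ℕ → ℕ
  | 0 => 1
  | k + 1 => expNum B S k + S * expNum B S k / B ^ (k + 1) % B / (k + 1) * B ^ (k + 1)

theorem le_pow_of_recursion {s h : ℕ → ℕ} {Γ : ℕ} (h0 : h 0 = 1)
    (hrec : ∀ k, (k + 1) * h (k + 1) = ∑ i ∈ Finset.range (k + 1), h i * s (k + 1 - i))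
    (hs : ∀ k, 1 ≤ k → s k ≤ Γ ^ k) (k : ℕ) : h k ≤ Γ ^ k := by
  induction k using Nat.strong_induction_on with
  | _ k ih =>
    cases k with
    | zero => rw [h0, pow_zero]
    | succ k =>
      refine le_of_mul_le_mul_left (a := k + 1) ?_ (Nat.succ_pos k)
      rw [hrec]
      calc ∑ i ∈ Finset.range (k + 1), h i * s (k + 1 - i)
          ≤ ∑ i ∈ Finset.range (k + 1), Γ ^ (k + 1) := by
            refine Finset.sum_le_sum fun i hi => ?_
            rw [Finset.mem_range] at hi
            calc h i * s (k + 1 - i) ≤ Γ ^ i * Γ ^ (k + 1 - i) :=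
                  Nat.mul_le_mul (ih i hi) (hs _ (by omega))
              _ = Γ ^ (k + 1) := by rw [← pow_add]; congr 1; omega
        _ = (k + 1) * Γ ^ (k + 1) := by simp

/-- The digit of (∑ s_i B^i)(∑ h_i B^i) at position k + 1 is the right-hand side of Newton's
recursion, that is (k + 1) h_{k+1}. The h-sum stops at k, which is harmless because s has no term of
degree 0. Only positions up to k + 1 ≤ K must be free of carries; higher ones may overflow. -/
theorem expNum_eq {s h : ℕ → ℕ} {Γ K B : ℕ} (h0 : h 0 = 1)
    (hrec : ∀ k, (k + 1) * h (k + 1) = ∑ i ∈ Finset.range (k + 1), h i * s (k + 1 - i))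
    (hs : ∀ k, 1 ≤ k → s k ≤ Γ ^ k) (hΓ : 1 ≤ Γ) (hB : (K + 1) * Γ ^ K < B) (k : ℕ)
    (hk : k ≤ K) :
    expNum B (∑ i ∈ Finset.range K, s (i + 1) * B ^ (i + 1)) k =
      ∑ i ∈ Finset.range (k + 1), h i * B ^ i := by
  have hh := le_pow_of_recursion h0 hrec hs
  induction k with
  | zero => simp [expNum, h0]
  | succ k ih =>
    rw [expNum, ih (by omega), Finset.sum_range_succ _ (k + 1)]
    congr 2
    let P : ℕ[X] := ∑ i ∈ Finset.range K, Polynomial.monomial (i + 1) (s (i + 1))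
    let Q : ℕ[X] := ∑ i ∈ Finset.range (k + 1), Polynomial.monomial i (h i)
    have hP : ∀ j, P.coeff j = if 1 ≤ j ∧ j ≤ K then s j else 0 := by
      intro j
      simp only [P, Polynomial.finsetSum_coeff, Polynomial.coeff_monomial]
      cases j with
      | zero => simp
      | succ j =>
        simp only [Nat.add_right_cancel_iff]
        rw [Finset.sum_ite_eq' (Finset.range K) j fun i => s (i + 1)]
        simp only [Finset.mem_range]
        congr 1
        simp
    have hQ : ∀ j, Q.coeff j = if j ≤ k then h j else 0 := by
      intro j
      simp only [Q, Polynomial.finsetSum_coeff, Polynomial.coeff_monomial]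
      rw [Finset.sum_ite_eq' (Finset.range (k + 1)) j]
      simp only [Finset.mem_range, Nat.lt_succ_iff]
    have hev : (∑ i ∈ Finset.range K, s (i + 1) * B ^ (i + 1)) *
        ∑ i ∈ Finset.range (k + 1), h i * B ^ i = (Q * P).eval B := by
      rw [mul_comm (Finset.sum _ _)]
      simp only [P, Q, Polynomial.eval_mul, Polynomial.eval_finsetSum, Polynomial.eval_monomial]
    rw [hev, eval_div_pow_mod_of_le]
    · rw [Polynomial.coeff_mul, Finset.Nat.sum_antidiagonal_eq_sum_range_succ
        (fun a b => Q.coeff a * P.coeff b), Finset.sum_range_succ, hQ (k + 1),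
        if_neg (by omega), zero_mul, add_zero]
      have : ∑ i ∈ Finset.range (k + 1), Q.coeff i * P.coeff (k + 1 - i) =
          (k + 1) * h (k + 1) := by
        rw [hrec]
        refine Finset.sum_congr rfl fun i hi => ?_
        rw [Finset.mem_range] at hi
        rw [hQ, hP, if_pos (by omega), if_pos (by omega)]
      rw [this, Nat.mul_div_cancel_left _ (Nat.succ_pos k)]
    · intro j hj
      rw [Polynomial.coeff_mul]
      refine lt_of_le_of_lt ?_ hB
      calc ∑ x ∈ Finset.HasAntidiagonal.antidiagonal j, Q.coeff x.1 * P.coeff x.2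
          ≤ ∑ x ∈ Finset.HasAntidiagonal.antidiagonal j, Γ ^ j := by
            refine Finset.sum_le_sum fun x hx => ?_
            rw [Finset.HasAntidiagonal.mem_antidiagonal] at hx
            rw [hP, hQ, ← hx, pow_add]
            refine Nat.mul_le_mul ?_ ?_
            · split_ifs
              · exact hh _
              · exact Nat.zero_le _
            · split_ifs with hc
              · exact hs _ hc.1
              · exact Nat.zero_le _
        _ = (j + 1) * Γ ^ j := by simp
        _ ≤ (K + 1) * Γ ^ K :=
            Nat.mul_le_mul (by omega) (Nat.pow_le_pow_right hΓ (by omega))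

theorem expNum_div_mod {s h : ℕ → ℕ} {Γ K B : ℕ} (h0 : h 0 = 1)
    (hrec : ∀ k, (k + 1) * h (k + 1) = ∑ i ∈ Finset.range (k + 1), h i * s (k + 1 - i))
    (hs : ∀ k, 1 ≤ k → s k ≤ Γ ^ k) (hΓ : 1 ≤ Γ) (hB : (K + 1) * Γ ^ K < B) (j : ℕ)
    (hj : j ≤ K) :
    expNum B (∑ i ∈ Finset.range K, s (i + 1) * B ^ (i + 1)) K / B ^ j % B = h j := by
  have hh := le_pow_of_recursion h0 hrec hs
  let Q : ℕ[X] := ∑ i ∈ Finset.range (K + 1), Polynomial.monomial i (h i)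
  have hQ : ∀ j, Q.coeff j = if j ≤ K then h j else 0 := by
    intro j
    simp only [Q, Polynomial.finsetSum_coeff, Polynomial.coeff_monomial]
    rw [Finset.sum_ite_eq' (Finset.range (K + 1)) j]
    simp only [Finset.mem_range, Nat.lt_succ_iff]
  have hev : ∑ i ∈ Finset.range (K + 1), h i * B ^ i = Q.eval B := by
    simp only [Q, Polynomial.eval_finsetSum, Polynomial.eval_monomial]
  rw [expNum_eq h0 hrec hs hΓ hB K le_rfl, hev, eval_div_pow_mod_of_le, hQ, if_pos hj]
  intro i hi
  rw [hQ, if_pos (by omega)]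
  refine ((hh i).trans (Nat.pow_le_pow_right hΓ (by omega : i ≤ K))).trans_lt (lt_of_le_of_lt ?_ hB)
  exact Nat.le_mul_of_pos_left _ (Nat.succ_pos K)

end ExponentialNumbers

/-! ### Traces of the iterates as digits -/

section TraceNumbers

variable {n : ℕ}

/-- The number that encodes the combined traces of the iterates. -/
def traceNum (n D E B p K G₁ G₂ : ℕ) : ℕ :=
  ∑ l ∈ Finset.range (E ^ (n + 1)), ∑ i ∈ Finset.range K,
    boxIndicator n D E l *
      (cartierIter n D E B p G₁ l (i + 1) / B ^ l % B +
        (p ^ (i + 1) - 1) * (cartierIter n D E B p G₂ l (i + 1) / B ^ l % B)) * B ^ (i + 1)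

/-- The combined trace. -/
noncomputable def natTrace (p D : ℕ) (P₁ P₂ : MvPolynomial (Fin n) ℕ) (k : ℕ) : ℕ :=
  (cartierMatrix p D P₁ ^ k).trace + (p ^ k - 1) * (cartierMatrix p D P₂ ^ k).trace

theorem sum_cartierIter_div_mod {p D E B K Γ : ℕ} (hp : 1 ≤ p) (hE : p * D < E)
    {P : MvPolynomial (Fin (n + 1)) ℕ} (hP : ∀ i, P.degreeOf i ≤ (p - 1) * D)
    (hΓ : MvPolynomial.eval (fun _ => 1) P ≤ Γ) (hB : Γ ^ K < B) (hΓ1 : 1 ≤ Γ) (i : ℕ)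
    (hi : i ≤ K) :
    ∑ l ∈ Finset.range (E ^ (n + 1)), boxIndicator n D E l *
      (cartierIter n D E B p (MvPolynomial.eval (fun i : Fin (n + 1) => B ^ E ^ (i : ℕ)) P) l i /
        B ^ l % B) = (cartierMatrix p D P ^ i).trace := by
  have hDE : D < E := lt_of_le_of_lt (Nat.le_mul_of_pos_left D hp) hE
  have := sum_boxIndicator_mul (n := n) (R := ℕ) hDE fun l =>
    cartierIter n D E B p (MvPolynomial.eval (fun i : Fin (n + 1) => B ^ E ^ (i : ℕ)) P) l i /
        B ^ l % B
  simp only [Nat.cast_id] at this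
  rw [this, Matrix.trace]
  refine Finset.sum_congr rfl fun u _ => ?_
  obtain ⟨h1, h2⟩ := cartierIter_eq_encodeVec hp hE hP hΓ hB u hΓ1 i hi
  rw [h1, encodeVec_div_mod hDE _ (h2.trans_lt ((Nat.pow_le_pow_right hΓ1 hi).trans_lt hB))]
  rfl

theorem trace_cartierMatrix_pow_le {p D : ℕ} (hp : 1 ≤ p) (P : MvPolynomial (Fin n) ℕ) {Γ : ℕ}
    (hΓ : MvPolynomial.eval (fun _ => 1) P ≤ Γ) (k : ℕ) :
    (cartierMatrix p D P ^ k).trace ≤ D ^ n * Γ ^ k := by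
  have hcol : ∀ u, ∑ v, (cartierMatrix p D P ^ k) v u ≤ Γ ^ k := by
    intro u
    induction k with
    | zero => simp [Matrix.one_apply]
    | succ k ih =>
      have hpow : ∀ v, (cartierMatrix p D P ^ (k + 1)) v u =
          (cartierMatrix p D P).mulVec (fun v => (cartierMatrix p D P ^ k) v u) v := by
        intro v
        rw [pow_succ', Matrix.mul_apply]
        rfl
      simp only [hpow]
      refine (sum_mulVec_cartierMatrix_le hp P _).trans ?_
      rw [pow_succ']
      exact Nat.mul_le_mul hΓ ih
  calc (cartierMatrix p D P ^ k).trace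
      = ∑ u, (cartierMatrix p D P ^ k) u u := rfl
    _ ≤ ∑ _u : Fin n → Fin D, Γ ^ k := Finset.sum_le_sum fun u _ =>
        (Finset.single_le_sum (f := fun v => (cartierMatrix p D P ^ k) v u)
          (fun _ _ => Nat.zero_le _) (Finset.mem_univ u)).trans (hcol u)
    _ = D ^ n * Γ ^ k := by simp

theorem natTrace_le {p D : ℕ} (hp : 1 ≤ p) {P₁ P₂ : MvPolynomial (Fin n) ℕ} {Γ J : ℕ}
    (h₁ : MvPolynomial.eval (fun _ => 1) P₁ ≤ Γ) (h₂ : MvPolynomial.eval (fun _ => 1) P₂ ≤ Γ)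
    (hJ : D ^ n ≤ J) (k : ℕ) (hk : 1 ≤ k) :
    natTrace p D P₁ P₂ k ≤ (p * J * Γ) ^ k := by
  have hpk : 1 ≤ p ^ k := Nat.one_le_pow _ _ hp
  calc natTrace p D P₁ P₂ k ≤ D ^ n * Γ ^ k + (p ^ k - 1) * (D ^ n * Γ ^ k) :=
        add_le_add (trace_cartierMatrix_pow_le hp _ h₁ k)
          (Nat.mul_le_mul_left _ (trace_cartierMatrix_pow_le hp _ h₂ k))
    _ = p ^ k * D ^ n * Γ ^ k := by
        obtain ⟨c, hc⟩ := Nat.exists_eq_add_of_le' hpk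
        rw [hc, Nat.add_sub_cancel]
        ring
    _ ≤ p ^ k * J ^ k * Γ ^ k := by
        refine Nat.mul_le_mul_right _ (Nat.mul_le_mul_left _ (hJ.trans ?_))
        exact Nat.le_self_pow (by omega) J
    _ = (p * J * Γ) ^ k := by rw [mul_pow, mul_pow]

theorem traceNum_eq {p D E B K Γ : ℕ} (hp : 1 ≤ p) (hE : p * D < E)
    {P₁ P₂ : MvPolynomial (Fin (n + 1)) ℕ} (hP₁ : ∀ i, P₁.degreeOf i ≤ (p - 1) * D)
    (hP₂ : ∀ i, P₂.degreeOf i ≤ (p - 1) * D)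
    (hΓ₁ : MvPolynomial.eval (fun _ => 1) P₁ ≤ Γ) (hΓ₂ : MvPolynomial.eval (fun _ => 1) P₂ ≤ Γ)
    (hB : Γ ^ K < B) (hΓ1 : 1 ≤ Γ) :
    traceNum n D E B p K (MvPolynomial.eval (fun i : Fin (n + 1) => B ^ E ^ (i : ℕ)) P₁)
      (MvPolynomial.eval (fun i : Fin (n + 1) => B ^ E ^ (i : ℕ)) P₂) =
    ∑ i ∈ Finset.range K, natTrace p D P₁ P₂ (i + 1) * B ^ (i + 1) := by
  rw [traceNum, Finset.sum_comm]
  refine Finset.sum_congr rfl fun i hi => ?_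
  rw [← Finset.sum_mul, natTrace]
  congr 1
  have hi : i + 1 ≤ K := Finset.mem_range.1 hi
  rw [← sum_cartierIter_div_mod hp hE hP₁ hΓ₁ hB hΓ1 (i + 1) hi,
    ← sum_cartierIter_div_mod hp hE hP₂ hΓ₂ hB hΓ1 (i + 1) hi, Finset.mul_sum,
    ← Finset.sum_add_distrib]
  refine Finset.sum_congr rfl fun l _ => ?_
  ring

theorem modelTrace_map (p D : ℕ) (hp : 1 ≤ p) (M F : MvPolynomial (Fin (n + 1)) ℕ) (k : ℕ) :
    modelTrace p D (MvPolynomial.map (Nat.castRingHom ℤ) M)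
      (MvPolynomial.map (Nat.castRingHom ℤ) F) k =
    (natTrace p D (F ^ (p - 1)) ((M * F) ^ (p - 1)) k : ℤ) := by
  have htr : ∀ P : MvPolynomial (Fin (n + 1)) ℕ,
      ((cartierMatrix p D (MvPolynomial.map (Nat.castRingHom ℤ) P) ^ k).trace : ℤ) =
        ((cartierMatrix p D P ^ k).trace : ℕ) := by
    intro P
    rw [← cartierMatrix_map, ← Matrix.map_pow, Matrix.trace, Matrix.trace]
    simp [Matrix.diag]
  rw [modelTrace, natTrace, ← map_mul, ← map_pow, ← map_pow, htr, htr]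
  rw [Nat.cast_add, Nat.cast_mul, Nat.cast_sub (Nat.one_le_pow k p hp), Nat.cast_pow, Nat.cast_one]

/-- The digits computed from the encoded equation are the coefficients of the integral series. -/
theorem expNum_traceNum_div_mod {p D E B K Γ J : ℕ} (hp : 1 ≤ p) (hE : p * D < E)
    {M F : MvPolynomial (Fin (n + 1)) ℕ} (hF : ∀ i, F.degreeOf i ≤ D)
    (hMF : ∀ i, (M * F).degreeOf i ≤ D)
    (hΓ₁ : MvPolynomial.eval (fun _ => 1) F ^ (p - 1) ≤ Γ)
    (hΓ₂ : MvPolynomial.eval (fun _ => 1) (M * F) ^ (p - 1) ≤ Γ)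
    (hΓ1 : 1 ≤ Γ) (hJ : D ^ (n + 1) ≤ J) (hJ1 : 1 ≤ J) (hB : (K + 1) * (p * J * Γ) ^ K < B)
    {H : PowerSeries ℤ} (hH : ∀ N, IsExpUpTo N H (modelTrace p D
      (MvPolynomial.map (Nat.castRingHom ℤ) M) (MvPolynomial.map (Nat.castRingHom ℤ) F)))
    (j : ℕ) (hj : j ≤ K) :
    ((expNum B (traceNum n D E B p K
      (MvPolynomial.eval (fun i : Fin (n + 1) => B ^ E ^ (i : ℕ)) F ^ (p - 1))
      (MvPolynomial.eval (fun i : Fin (n + 1) => B ^ E ^ (i : ℕ)) (M * F) ^ (p - 1))) K /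
        B ^ j % B : ℕ) : ℤ) = PowerSeries.coeff j H := by
  have hdeg : ∀ {P : MvPolynomial (Fin (n + 1)) ℕ}, (∀ i, P.degreeOf i ≤ D) →
      ∀ i, (P ^ (p - 1)).degreeOf i ≤ (p - 1) * D := fun hP i =>
    (MvPolynomial.degreeOf_pow_le _ _ _).trans (Nat.mul_le_mul_left _ (hP i))
  have hs := natTrace_le (D := D) hp (P₁ := F ^ (p - 1)) (P₂ := (M * F) ^ (p - 1)) (Γ := Γ)
    (by rwa [map_pow]) (by rwa [map_pow]) hJ
  have hΓ' : Γ ≤ p * J * Γ := Nat.le_mul_of_pos_left _ (Nat.mul_pos hp hJ1)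
  have hBΓ : Γ ^ K < B := lt_of_le_of_lt ((Nat.pow_le_pow_left hΓ' K).trans
    (Nat.le_mul_of_pos_left _ (Nat.succ_pos K))) hB
  rw [← map_pow, ← map_pow, traceNum_eq hp hE (hdeg hF) (hdeg hMF) (by rwa [map_pow])
    (by rwa [map_pow]) hBΓ hΓ1]
  have hH0 : PowerSeries.coeff 0 H = 1 := ((isExpUpTo_iff_coeff).1 (hH 0)).1
  have hHrec : ∀ k : ℕ, ((k : ℤ) + 1) * PowerSeries.coeff (k + 1) H =
      ∑ i ∈ Finset.range (k + 1), PowerSeries.coeff i H *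
        (natTrace p D (F ^ (p - 1)) ((M * F) ^ (p - 1)) (k + 1 - i) : ℤ) := by
    intro k
    rw [((isExpUpTo_iff_coeff).1 (hH (k + 1))).2 k le_rfl]
    simp only [modelTrace_map p D hp]
  -- Nonnegativity of the combined traces passes through the recursion to the coefficients of H, so
  -- natural-number arithmetic computes them faithfully.
  have hnonneg : ∀ k, 0 ≤ PowerSeries.coeff k H := by
    intro k
    induction k using Nat.strong_induction_on with
    | _ k ih =>
      cases k with
      | zero => rw [hH0]; exact zero_le_one
      | succ k =>
        refine nonneg_of_mul_nonneg_right (a := (k : ℤ) + 1) ?_ (by positivity)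
        rw [hHrec]
        exact Finset.sum_nonneg fun i hi =>
          mul_nonneg (ih i (Finset.mem_range.1 hi)) (Int.natCast_nonneg _)
  have hcast : ∀ k, ((PowerSeries.coeff k H).toNat : ℤ) = PowerSeries.coeff k H := fun k =>
    Int.toNat_of_nonneg (hnonneg k)
  rw [expNum_div_mod (h := fun k => (PowerSeries.coeff k H).toNat) (by simp [hH0]) _ hs
    (hΓ1.trans hΓ') hB j hj, hcast]
  intro k
  zify
  rw [hcast, hHrec]
  exact Finset.sum_congr rfl fun i _ => by rw [hcast]

end TraceNumbers

/-! ### The explicit prime field model and the choice of parameters -/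

section PrimeFieldLift

variable {p : ℕ} [hp : Fact p.Prime] {n : ℕ} {m : (ZMod p)[X]} [hmi : Fact (Irreducible m)]

/-- The modulus, with coefficients in `[0, p)`, in the first variable. -/
noncomputable def liftModulus (n : ℕ) (m : (ZMod p)[X]) : MvPolynomial (Fin (n + 1)) ℕ :=
  ∑ b ∈ Finset.range (m.natDegree + 1),
    MvPolynomial.monomial (Finsupp.single 0 b) (m.coeff b).val

/-- The coefficients of an element of `𝔽_p[t] / (m)`. -/
noncomputable def elementCoeff (hm : m.Monic) (c : AdjoinRoot m) (b : ℕ) : ℕ :=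
  ((AdjoinRoot.modByMonicHom hm c).coeff b).val

/-- The equation, with coefficients in `[0, p)`, where `t` becomes the first variable. -/
noncomputable def liftEquation (hm : m.Monic) (f : MvPolynomial (Fin n) (AdjoinRoot m))
    (L : List (Fin n →₀ ℕ)) : MvPolynomial (Fin (n + 1)) ℕ :=
  (L.map fun e => ∑ b ∈ Finset.range m.natDegree,
    MvPolynomial.monomial (Finsupp.cons b e) (elementCoeff hm (f.coeff e) b)).sum

theorem eval₂_liftModulus {R : Type*} [CommSemiring R] (φ : ℕ →+* R) (z : Fin (n + 1) → R) :
    (liftModulus n m).eval₂ φ z =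
      ∑ b ∈ Finset.range (m.natDegree + 1), ((m.coeff b).val : R) * z 0 ^ b := by
  rw [liftModulus, MvPolynomial.eval₂_sum]
  refine Finset.sum_congr rfl fun b _ => ?_
  rw [MvPolynomial.eval₂_monomial, Finsupp.prod_single_index (by simp), eq_natCast]

theorem eval₂_liftEquation {R : Type*} [CommSemiring R] (φ : ℕ →+* R) (z : Fin (n + 1) → R)
    (hm : m.Monic) (f : MvPolynomial (Fin n) (AdjoinRoot m)) (L : List (Fin n →₀ ℕ)) :
    (liftEquation hm f L).eval₂ φ z = (L.map fun e => ∑ b ∈ Finset.range m.natDegree,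
      (elementCoeff hm (f.coeff e) b : R) * (z 0 ^ b * ∏ i : Fin n, z i.succ ^ e i)).sum := by
  rw [liftEquation, ← MvPolynomial.coe_eval₂Hom, map_list_sum, List.map_map]
  congr 1
  refine List.map_congr_left fun e _ => ?_
  rw [Function.comp_apply, map_sum]
  refine Finset.sum_congr rfl fun b _ => ?_
  rw [MvPolynomial.coe_eval₂Hom, MvPolynomial.eval₂_monomial, eq_natCast,
    Finsupp.prod_fintype _ _ (by simp), Fin.prod_univ_succ]
  simp only [Finsupp.cons_zero, Finsupp.cons_succ]

theorem natDegree_modByMonicHom_lt (hm : m.Monic) (c : AdjoinRoot m) :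
    (AdjoinRoot.modByMonicHom hm c).natDegree < m.natDegree := by
  obtain ⟨g, rfl⟩ := AdjoinRoot.mk_surjective c
  rw [AdjoinRoot.modByMonicHom_mk]
  refine Polynomial.natDegree_modByMonic_lt _ hm ?_
  rintro rfl
  exact hmi.out.not_isUnit isUnit_one

theorem rootHom_eq_sum {t : Fbar p} (h : m.eval₂ (algebraMap (ZMod p) (Fbar p)) t = 0)
    (hm : m.Monic) (c : AdjoinRoot m) :
    rootHom t h c = ∑ b ∈ Finset.range m.natDegree, (elementCoeff hm c b : Fbar p) * t ^ b := by
  conv_lhs => rw [← AdjoinRoot.mk_leftInverse hm c]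
  rw [rootHom, AdjoinRoot.lift_mk,
    Polynomial.eval₂_eq_sum_range' _ (natDegree_modByMonicHom_lt hm c)]
  refine Finset.sum_congr rfl fun b _ => ?_
  congr 1
  rw [elementCoeff, ← map_natCast (algebraMap (ZMod p) (Fbar p)), ZMod.natCast_zmod_val]

theorem eval_redPoly_map (P : MvPolynomial (Fin (n + 1)) ℕ) (z : Fin (n + 1) → Fbar p) :
    MvPolynomial.eval z (redPoly p (MvPolynomial.map (Nat.castRingHom ℤ) P)) =
      P.eval₂ (Nat.castRingHom (Fbar p)) z := by
  rw [redPoly, MvPolynomial.map_map, MvPolynomial.eval_map]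
  congr 1
  exact Subsingleton.elim _ _

theorem isPrimeFieldModel_lift (hm : m.Monic) {f : MvPolynomial (Fin n) (AdjoinRoot m)}
    {L : List (Fin n →₀ ℕ)} (hL : IsMonomialList f L) :
    IsPrimeFieldModel f (MvPolynomial.map (Nat.castRingHom ℤ) (liftModulus n m))
      (MvPolynomial.map (Nat.castRingHom ℤ) (liftEquation hm f L)) where
  eval_modulus z := by
    rw [eval_redPoly_map, eval₂_liftModulus, Polynomial.eval₂_eq_sum_range]
    refine Finset.sum_congr rfl fun b _ => ?_
    rw [← map_natCast (algebraMap (ZMod p) (Fbar p)), ZMod.natCast_zmod_val]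
  eval_equation z h := by
    classical
    rw [eval_redPoly_map, eval₂_liftEquation, MvPolynomial.eval_map, MvPolynomial.eval₂_eq',
      ← List.sum_toFinset _ hL.1]
    rw [Finset.sum_subset (s₁ := f.support) (s₂ := L.toFinset)
      (fun e he => List.mem_toFinset.2 (hL.2.1 e he))]
    · refine Finset.sum_congr rfl fun e _ => ?_
      rw [rootHom_eq_sum h hm, Finset.sum_mul]
      refine Finset.sum_congr rfl fun b _ => ?_
      rw [mul_assoc]
      rfl
    · intro e _ he
      rw [MvPolynomial.notMem_support_iff.1 he, map_zero, zero_mul]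

theorem degreeOf_list_sum_le {σ R ι : Type*} [CommSemiring R] (i : σ) (L : List ι)
    (φ : ι → MvPolynomial σ R) {D : ℕ} (h : ∀ e ∈ L, (φ e).degreeOf i ≤ D) :
    (L.map φ).sum.degreeOf i ≤ D := by
  induction L with
  | nil => simp
  | cons e L ih =>
    rw [List.map_cons, List.sum_cons]
    exact (MvPolynomial.degreeOf_add_le _ _ _).trans (max_le (h e (by simp))
      (ih fun e he => h e (by simp [he])))

theorem degreeOf_monomial_le {σ R : Type*} [CommSemiring R] (i : σ) (e : σ →₀ ℕ) (c : R) :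
    (MvPolynomial.monomial e c).degreeOf i ≤ e i := by
  classical
  rw [MvPolynomial.degreeOf_le_iff]
  intro d hd
  rw [Finset.mem_singleton.1 (MvPolynomial.support_monomial_subset hd)]

theorem degreeOf_liftModulus_zero : (liftModulus n m).degreeOf 0 ≤ m.natDegree := by
  refine (MvPolynomial.degreeOf_sum_le _ _ _).trans (Finset.sup_le fun b hb => ?_)
  refine (degreeOf_monomial_le _ _ _).trans ?_
  rw [Finsupp.single_eq_same]
  exact Nat.lt_succ_iff.1 (Finset.mem_range.1 hb)

theorem degreeOf_liftModulus_succ (i : Fin n) : (liftModulus n m).degreeOf i.succ ≤ 0 := by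
  refine (MvPolynomial.degreeOf_sum_le _ _ _).trans (Finset.sup_le fun b _ => ?_)
  refine (degreeOf_monomial_le _ _ _).trans ?_
  rw [Finsupp.single_eq_of_ne (Fin.succ_ne_zero i)]

theorem degreeOf_liftEquation_zero (hm : m.Monic) (f : MvPolynomial (Fin n) (AdjoinRoot m))
    (L : List (Fin n →₀ ℕ)) : (liftEquation hm f L).degreeOf 0 ≤ m.natDegree := by
  refine degreeOf_list_sum_le _ _ _ fun e _ => ?_
  refine (MvPolynomial.degreeOf_sum_le _ _ _).trans (Finset.sup_le fun b hb => ?_)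
  refine (degreeOf_monomial_le _ _ _).trans ?_
  rw [Finsupp.cons_zero]
  exact (Finset.mem_range.1 hb).le

theorem degreeOf_liftEquation_succ (hm : m.Monic) (f : MvPolynomial (Fin n) (AdjoinRoot m))
    (L : List (Fin n →₀ ℕ)) {D : ℕ} (hD : ∀ e ∈ L, ∀ i, e i ≤ D) (i : Fin n) :
    (liftEquation hm f L).degreeOf i.succ ≤ D := by
  refine degreeOf_list_sum_le _ _ _ fun e he => ?_
  refine (MvPolynomial.degreeOf_sum_le _ _ _).trans (Finset.sup_le fun b _ => ?_)
  refine (degreeOf_monomial_le _ _ _).trans ?_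
  rw [Finsupp.cons_succ]
  exact hD e he i

/-- The constants: D bounds all degrees, including degree 2a of the product in t, and both
coefficient sums. E = p(D + 1) exceeds the degrees pD that occur before ψ_p is applied. J = E^(n+1)
counts the codes and also dominates the degree bound D^n. K = aJ, since H is read at the positions
aj with j ≤ J. B exceeds (K + 1)(pJΓ)^K with Γ = D^(2(p-1)), the bound for the coefficient sums of
F^(p-1) and (MF)^(p-1). -/
theorem hypersurface_digits (hn : 1 ≤ n) (hm : m.Monic)
    {f : MvPolynomial (Fin n) (AdjoinRoot m)} {L : List (Fin n →₀ ℕ)} (hL : IsMonomialList f L)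
    {D E J K B M F : ℕ} (hD2 : 2 ≤ D) (ha : m.natDegree * 2 ≤ D)
    (he : ∀ e ∈ L, ∀ i, e i ≤ D)
    (hMD : ∑ b ∈ Finset.range (m.natDegree + 1), (m.coeff b).val ≤ D)
    (hFD : (L.map fun e => ∑ b ∈ Finset.range m.natDegree,
      elementCoeff hm (f.coeff e) b).sum ≤ D)
    (hE : E = p * (D + 1)) (hJ : J = E ^ (n + 1)) (hK : K = m.natDegree * J)
    (hB : B = J ^ (2 * p * (K + 1) + 3))
    (hM : M = ∑ b ∈ Finset.range (m.natDegree + 1), (m.coeff b).val * B ^ b)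
    (hF : F = (L.map fun e => ∑ b ∈ Finset.range m.natDegree,
      elementCoeff hm (f.coeff e) b * (B ^ b * ∏ i : Fin n, (B ^ E ^ ((i : ℕ) + 1)) ^ e i)).sum) :
    ∃ W : (ZMod p)[X], W.natDegree ≤ J ∧
      (∀ j ≤ J, (W.coeff j).val =
        expNum B (traceNum n D E B p K (F ^ (p - 1)) ((M * F) ^ (p - 1))) K /
          B ^ (m.natDegree * j) % B % p) ∧
      if Even n then IsReductionModP p (hypersurfaceZeta (AdjoinRoot m) p f) W 1
      else IsReductionModP p (hypersurfaceZeta (AdjoinRoot m) p f) 1 W := by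
  set a := m.natDegree with ha'
  have hp1 : 1 ≤ p := hp.out.one_le
  have hpE : p * D < E := by rw [hE]; exact Nat.mul_lt_mul_of_pos_left (Nat.lt_succ_self D) hp1
  have hEJ : E ≤ J := hJ ▸ Nat.le_self_pow (Nat.succ_ne_zero n) E
  have hDE : D ≤ E := (Nat.le_mul_of_pos_left D hp1).trans hpE.le
  have hpJ : p ≤ J := by
    refine le_trans ?_ hEJ
    rw [hE]
    exact Nat.le_mul_of_pos_right p (Nat.succ_pos D)
  have hJ2 : 2 ≤ J := hD2.trans (hDE.trans hEJ)
  have hDJ : D ^ (n + 1) ≤ J := hJ ▸ Nat.pow_le_pow_left hDE _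
  have hdegF : ∀ i, (liftEquation hm f L).degreeOf i ≤ D := by
    intro i
    refine Fin.cases ?_ (degreeOf_liftEquation_succ hm f L he) i
    exact (degreeOf_liftEquation_zero hm f L).trans (by omega)
  have hdegMF : ∀ i, (liftModulus n m * liftEquation hm f L).degreeOf i ≤ D := by
    intro i
    refine (MvPolynomial.degreeOf_mul_le _ _ _).trans ?_
    refine Fin.cases ?_ (fun i => ?_) i
    · have h1 := degreeOf_liftEquation_zero hm f L
      have h2 := degreeOf_liftModulus_zero (n := n) (m := m)
      omega
    · have h1 := degreeOf_liftEquation_succ hm f L he i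
      have h2 := degreeOf_liftModulus_succ (m := m) i
      omega
  have hM1 : MvPolynomial.eval (fun _ => 1) (liftModulus n m) ≤ D := by
    rw [MvPolynomial.eval, MvPolynomial.coe_eval₂Hom, eval₂_liftModulus]
    simpa using hMD
  have hF1 : MvPolynomial.eval (fun _ => 1) (liftEquation hm f L) ≤ D := by
    rw [MvPolynomial.eval, MvPolynomial.coe_eval₂Hom, eval₂_liftEquation]
    simpa using hFD
  have hMB : MvPolynomial.eval (fun i : Fin (n + 1) => B ^ E ^ (i : ℕ)) (liftModulus n m) = M := by
    rw [MvPolynomial.eval, MvPolynomial.coe_eval₂Hom, eval₂_liftModulus, hM]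
    simp [ha']
  have hFB : MvPolynomial.eval (fun i : Fin (n + 1) => B ^ E ^ (i : ℕ))
      (liftEquation hm f L) = F := by
    rw [MvPolynomial.eval, MvPolynomial.coe_eval₂Hom, eval₂_liftEquation, hF]
    simp [ha']
  obtain ⟨H, hH⟩ := exists_isExpUpTo_modelTrace p D
    (MvPolynomial.map (Nat.castRingHom ℤ) (liftModulus n m))
    (MvPolynomial.map (Nat.castRingHom ℤ) (liftEquation hm f L))
  have hmapdeg : ∀ (P : MvPolynomial (Fin (n + 1)) ℕ) i,
      (MvPolynomial.map (Nat.castRingHom ℤ) P).degreeOf i ≤ P.degreeOf i := by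
    intro P i
    rw [MvPolynomial.degreeOf_le_iff]
    exact fun d hd => MvPolynomial.degreeOf_le_iff.1 le_rfl d (MvPolynomial.support_map_subset _ _ hd)
  have hDpow : 1 ≤ D ^ (2 * (p - 1)) := Nat.one_le_pow _ _ (by omega)
  -- Since p ≤ J and D ≤ J, each factor is absorbed into a power of J. The base B then becomes a
  -- pure power of J, which the program can compute.
  have hΓ : p * J * D ^ (2 * (p - 1)) ≤ J ^ (2 * p) := by
    calc p * J * D ^ (2 * (p - 1)) ≤ J * J * J ^ (2 * (p - 1)) :=
          Nat.mul_le_mul (Nat.mul_le_mul_right _ hpJ) (Nat.pow_le_pow_left (hDE.trans hEJ) _)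
      _ = J ^ (2 * p) := by
          rw [← sq, ← pow_add]
          congr 1
          omega
  have hK1 : K + 1 ≤ J ^ 2 := by
    have : a + 1 ≤ J := by have := hDE.trans hEJ; omega
    calc K + 1 ≤ a * J + 1 * J := by rw [hK]; omega
      _ = (a + 1) * J := by ring
      _ ≤ J * J := Nat.mul_le_mul_right _ this
      _ = J ^ 2 := (sq J).symm
  have hBK : (K + 1) * (p * J * D ^ (2 * (p - 1))) ^ K < B := by
    calc (K + 1) * (p * J * D ^ (2 * (p - 1))) ^ K ≤ J ^ 2 * (J ^ (2 * p)) ^ K :=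
          Nat.mul_le_mul hK1 (Nat.pow_le_pow_left hΓ K)
      _ = J ^ (2 + 2 * p * K) := by rw [← pow_mul, ← pow_add]
      _ < J ^ (2 * p * (K + 1) + 3) := Nat.pow_lt_pow_right hJ2 (by rw [Nat.mul_succ]; omega)
      _ = B := hB.symm
  have hdig := expNum_traceNum_div_mod (n := n) hp1 hpE hdegF hdegMF (Γ := D ^ (2 * (p - 1)))
    (by
      refine (Nat.pow_le_pow_left hF1 _).trans (Nat.pow_le_pow_right (by omega) (by omega)))
    (by
      rw [map_mul, pow_mul, sq]
      exact Nat.pow_le_pow_left (Nat.mul_le_mul hM1 hF1) _)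
    hDpow hDJ (by omega) hBK hH
  rw [map_mul, hMB, hFB] at hdig
  refine ⟨sectionPoly p a J H, ?_, ?_, ?_⟩
  · rw [Polynomial.natDegree_le_iff_coeff_eq_zero]
    intro j hj
    rw [coeff_sectionPoly, if_neg (by omega)]
  · intro j hj
    rw [coeff_sectionPoly, if_pos hj, ← hdig (a * j) (hK ▸ Nat.mul_le_mul_left a hj),
      Int.cast_natCast, ZMod.val_natCast]
  · refine (isPrimeFieldModel_lift hm hL).isReductionModP hn
      (fun i => (hmapdeg _ i).trans (hdegF i)) ?_ ?_ hH
      (le_trans (Nat.pow_le_pow_right (by omega) (Nat.le_succ n)) hDJ)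
    · intro i
      rw [← map_mul]
      exact (hmapdeg _ i).trans (hdegMF i)
    · intro i
      rw [MvPolynomial.degreeOf_le_iff]
      exact fun e hef => he e (hL.2.1 e hef) i

end PrimeFieldLift

/-! ### Polynomial bounds, uniform over families of inputs -/

section PolyBounds

variable {ι κ : Type} {sz : ι → ℕ}

/-- `φ` is bounded by a polynomial in the size. -/
def PolyBounded (sz φ : ι → ℕ) : Prop := ∃ P : ℕ[X], ∀ i, φ i ≤ P.eval (sz i)

/-- The bit length of `φ` is bounded by a polynomial in the size. -/
def PolyBits (sz φ : ι → ℕ) : Prop := ∃ P : ℕ[X], ∀ i, φ i < 2 ^ P.eval (sz i)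

theorem PolyBounded.mono {φ ψ : ι → ℕ} (h : PolyBounded sz φ) (hψ : ∀ i, ψ i ≤ φ i) :
    PolyBounded sz ψ := by
  obtain ⟨P, hP⟩ := h
  exact ⟨P, fun i => (hψ i).trans (hP i)⟩

theorem PolyBounded.const (c : ℕ) : PolyBounded sz fun _ => c :=
  ⟨Polynomial.C c, fun i => by simp⟩

theorem PolyBounded.size : PolyBounded sz sz := ⟨Polynomial.X, fun i => by simp⟩

theorem PolyBounded.add {φ ψ : ι → ℕ} (h : PolyBounded sz φ) (h' : PolyBounded sz ψ) :
    PolyBounded sz fun i => φ i + ψ i := by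
  obtain ⟨P, hP⟩ := h
  obtain ⟨Q, hQ⟩ := h'
  exact ⟨P + Q, fun i => by rw [Polynomial.eval_add]; exact add_le_add (hP i) (hQ i)⟩

theorem PolyBounded.mul {φ ψ : ι → ℕ} (h : PolyBounded sz φ) (h' : PolyBounded sz ψ) :
    PolyBounded sz fun i => φ i * ψ i := by
  obtain ⟨P, hP⟩ := h
  obtain ⟨Q, hQ⟩ := h'
  exact ⟨P * Q, fun i => by rw [Polynomial.eval_mul]; exact Nat.mul_le_mul (hP i) (hQ i)⟩

theorem PolyBounded.pow {φ : ι → ℕ} (h : PolyBounded sz φ) (k : ℕ) :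
    PolyBounded sz fun i => φ i ^ k := by
  obtain ⟨P, hP⟩ := h
  exact ⟨P ^ k, fun i => by rw [Polynomial.eval_pow]; exact Nat.pow_le_pow_left (hP i) k⟩

theorem PolyBounded.comp {φ : ι → ℕ} (h : PolyBounded sz φ) (g : κ → ι) :
    PolyBounded (fun k => sz (g k)) fun k => φ (g k) := by
  obtain ⟨P, hP⟩ := h
  exact ⟨P, fun i => hP (g i)⟩

theorem PolyBits.mono {φ ψ : ι → ℕ} (h : PolyBits sz φ) (hψ : ∀ i, ψ i ≤ φ i) :
    PolyBits sz ψ := by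
  obtain ⟨P, hP⟩ := h
  exact ⟨P, fun i => (hψ i).trans_lt (hP i)⟩

theorem PolyBits.comp {φ : ι → ℕ} (h : PolyBits sz φ) (g : κ → ι) :
    PolyBits (fun k => sz (g k)) fun k => φ (g k) := by
  obtain ⟨P, hP⟩ := h
  exact ⟨P, fun i => hP (g i)⟩

theorem PolyBounded.bits {φ : ι → ℕ} (h : PolyBounded sz φ) : PolyBits sz φ := by
  obtain ⟨P, hP⟩ := h
  exact ⟨P, fun i => (hP i).trans_lt Nat.lt_two_pow_self⟩

theorem PolyBits.const (c : ℕ) : PolyBits sz fun _ => c := (PolyBounded.const c).bits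

theorem PolyBits.mul {φ ψ : ι → ℕ} (h : PolyBits sz φ) (h' : PolyBits sz ψ) :
    PolyBits sz fun i => φ i * ψ i := by
  obtain ⟨P, hP⟩ := h
  obtain ⟨Q, hQ⟩ := h'
  exact ⟨P + Q, fun i => by
    rw [Polynomial.eval_add, pow_add]
    exact Nat.mul_lt_mul'' (hP i) (hQ i)⟩

theorem PolyBits.add {φ ψ : ι → ℕ} (h : PolyBits sz φ) (h' : PolyBits sz ψ) :
    PolyBits sz fun i => φ i + ψ i := by
  obtain ⟨P, hP⟩ := h
  obtain ⟨Q, hQ⟩ := h'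
  refine ⟨P + Q + 1, fun i => ?_⟩
  have h1 : 2 ^ P.eval (sz i) ≤ 2 ^ (P.eval (sz i) + Q.eval (sz i)) :=
    Nat.pow_le_pow_right two_pos (Nat.le_add_right _ _)
  have h2 : 2 ^ Q.eval (sz i) ≤ 2 ^ (P.eval (sz i) + Q.eval (sz i)) :=
    Nat.pow_le_pow_right two_pos (Nat.le_add_left _ _)
  have h3 := hP i
  have h4 := hQ i
  dsimp only
  rw [Polynomial.eval_add, Polynomial.eval_add, Polynomial.eval_one, pow_succ]
  omega

theorem PolyBits.pow {φ e : ι → ℕ} (h : PolyBits sz φ) (he : PolyBounded sz e) :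
    PolyBits sz fun i => φ i ^ e i := by
  obtain ⟨P, hP⟩ := h
  obtain ⟨Q, hQ⟩ := he
  refine ⟨P * Q + 1, fun i => ?_⟩
  rw [Polynomial.eval_add, Polynomial.eval_mul, Polynomial.eval_one]
  calc φ i ^ e i ≤ (2 ^ P.eval (sz i)) ^ e i := Nat.pow_le_pow_left (hP i).le _
    _ = 2 ^ (P.eval (sz i) * e i) := by rw [pow_mul]
    _ < 2 ^ (P.eval (sz i) * Q.eval (sz i) + 1) :=
        Nat.pow_lt_pow_right one_lt_two (Nat.lt_succ_of_le (Nat.mul_le_mul_left _ (hQ i)))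

/-- The pairs of an index and a number below (or at most) a bound that depends on it. -/
abbrev Below (T : ι → ℕ) : Type := {x : ι × ℕ // x.2 < T x.1}

/-- The index of a pair. -/
abbrev Below.idx {T : ι → ℕ} (x : Below T) : ι := x.1.1

/-- The number of a pair. -/
abbrev Below.num {T : ι → ℕ} (x : Below T) : ℕ := x.1.2

/-- The bound on the summands must be one polynomial for all pairs of an index and a summation
variable, hence the hypothesis over `Below T`. -/
theorem PolyBits.sum {T : ι → ℕ} (hT : PolyBounded sz T) {φ : ι → ℕ → ℕ}
    (h : PolyBits (fun x : Below T => sz x.idx) fun x => φ x.idx x.num) :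
    PolyBits sz fun i => ∑ k ∈ Finset.range (T i), φ i k := by
  obtain ⟨P, hP⟩ := h
  obtain ⟨Q, hQ⟩ := hT.bits
  refine ⟨Q + P, fun i => ?_⟩
  have h1 : ∑ k ∈ Finset.range (T i), φ i k ≤ T i * 2 ^ P.eval (sz i) := by
    refine (Finset.sum_le_card_nsmul _ _ (2 ^ P.eval (sz i)) fun k hk => ?_).trans (by simp)
    exact (hP ⟨(i, k), Finset.mem_range.1 hk⟩).le
  refine h1.trans_lt ?_
  rw [Polynomial.eval_add, pow_add]
  exact Nat.mul_lt_mul_of_pos_right (hQ i) (by positivity)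

theorem PolyBits.partial_sum {T : ι → ℕ} (hT : PolyBounded sz T) {φ : ι → ℕ → ℕ}
    (h : PolyBits (fun x : Below T => sz x.idx) fun x => φ x.idx x.num) :
    PolyBits (fun x : Below (fun i => T i + 1) => sz x.idx)
      fun x => ∑ k ∈ Finset.range x.num, φ x.idx k :=
  ((PolyBits.sum hT h).comp (Below.idx (T := fun i => T i + 1))).mono fun x =>
    Finset.sum_le_sum_of_subset (Finset.range_subset_range.2 (Nat.lt_succ_iff.1 x.2))

theorem PolyBounded.num {T : ι → ℕ} (hT : PolyBounded sz T) :
    PolyBounded (fun x : Below T => sz x.idx) Below.num :=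
  (hT.comp Below.idx).mono fun x => x.2.le

theorem PolyBounded.num_succ {T : ι → ℕ} (hT : PolyBounded sz T) :
    PolyBounded (fun x : Below (fun i => T i + 1) => sz x.idx) Below.num :=
  PolyBounded.num (hT.add (PolyBounded.const 1))

end PolyBounds

/-! ### A calculus of polynomial-time runs -/

namespace RAM

/-- The memory whose initial cells are listed. -/
def regs (l : List ℕ) : ℕ → ℕ := fun r => l.getD r 0

/-- Overwriting an entry of a list that is padded by zeros. -/
def put : ℕ → ℕ → List ℕ → List ℕ
  | 0, v, [] => [v]
  | 0, v, _ :: l => v :: l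
  | r + 1, v, [] => 0 :: put r v []
  | r + 1, v, x :: l => x :: put r v l

theorem regs_put (r v : ℕ) (l : List ℕ) : regs (put r v l) = Function.update (regs l) r v := by
  funext s
  induction r, v, l using put.induct generalizing s with
  | case1 v => cases s <;> simp [put, regs]
  | case2 v x l => cases s <;> simp [put, regs]
  | case3 r v ih =>
    cases s with
    | zero => simp [put, regs]
    | succ s =>
      have := ih s
      simp only [regs, put, Function.update_apply, List.getD_cons_succ, List.getD_nil,
        Nat.succ_eq_add_one] at this ⊢
      rw [this]
      simp only [Nat.add_right_cancel_iff]
  | case4 r v x l ih =>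
    cases s with
    | zero => simp [put, regs]
    | succ s =>
      have := ih s
      simp only [regs, put, Function.update_apply, List.getD_cons_succ,
        Nat.succ_eq_add_one] at this ⊢
      rw [this]
      simp only [Nat.add_right_cancel_iff]

theorem put_length (v : ℕ) (l : List ℕ) : put l.length v l = l ++ [v] := by
  induction l with
  | nil => rfl
  | cons x l ih => rw [List.length_cons, put, ih, List.cons_append]

/-- A sequence of assignments to fixed cells. -/
def block : List (ℕ × Expr) → Prog
  | [] => .skip
  | x :: b => .seq (.assign (.const x.1) x.2) (block b)

/-- The effect of a sequence of assignments. -/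
def runBlock : List (ℕ × Expr) → List ℕ → List ℕ
  | [], l => l
  | x :: b, l => runBlock b (put x.1 (x.2.val (regs l)) l)

/-- For a fixed expression each operation at most adds the bit lengths of its arguments, up to a
constant. Value and cost are therefore linear in the bit bound of the memory, with a factor
depending only on the expression. -/
theorem Expr.exists_bound (e : Expr) : ∃ c : ℕ, ∀ (M : ℕ → ℕ) (b : ℕ), (∀ r, M r < 2 ^ b) →
    e.val M < 2 ^ (c * (b + 1)) ∧ e.cost M ≤ c * (b + 1) := by
  induction e with
  | const k =>
    refine ⟨k.size + 1, fun M b _ => ⟨?_, Nat.le_mul_of_pos_right _ (Nat.succ_pos b)⟩⟩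
    refine (Nat.lt_size_self k).trans_le (Nat.pow_le_pow_right two_pos ?_)
    exact (Nat.le_succ _).trans (Nat.le_mul_of_pos_right _ (Nat.succ_pos b))
  | load e ih =>
    obtain ⟨c, hc⟩ := ih
    refine ⟨c + 1, fun M b hM => ⟨(hM _).trans_le (Nat.pow_le_pow_right two_pos ?_), ?_⟩⟩
    · rw [Nat.succ_mul]
      omega
    · have h1 := (hc M b hM).2
      have h2 := Nat.size_le.2 (hM (e.val M))
      rw [Expr.cost, bitCost, Nat.succ_mul]
      omega
  | op o e₁ e₂ ih₁ ih₂ =>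
    obtain ⟨c₁, h₁⟩ := ih₁
    obtain ⟨c₂, h₂⟩ := ih₂
    have hval : ∀ (M : ℕ → ℕ) (b : ℕ), (∀ r, M r < 2 ^ b) →
        (Expr.op o e₁ e₂).val M < 2 ^ ((c₁ + c₂ + 1) * (b + 1)) := by
      intro M b hM
      have hx := (h₁ M b hM).1
      have hy := (h₂ M b hM).1
      have hA : 2 ^ (c₁ * (b + 1)) ≤ 2 ^ ((c₁ + c₂) * (b + 1)) :=
        Nat.pow_le_pow_right two_pos (Nat.mul_le_mul_right _ (Nat.le_add_right _ _))
      have hC : 2 ^ (c₂ * (b + 1)) ≤ 2 ^ ((c₁ + c₂) * (b + 1)) :=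
        Nat.pow_le_pow_right two_pos (Nat.mul_le_mul_right _ (Nat.le_add_left _ _))
      have hD : 2 * 2 ^ ((c₁ + c₂) * (b + 1)) ≤ 2 ^ ((c₁ + c₂ + 1) * (b + 1)) := by
        rw [← pow_succ']
        exact Nat.pow_le_pow_right two_pos (by rw [Nat.succ_mul]; omega)
      have hmul : e₁.val M * e₂.val M < 2 ^ ((c₁ + c₂) * (b + 1)) := by
        rw [add_mul, pow_add]
        exact Nat.mul_lt_mul'' hx hy
      have hdiv := Nat.div_le_self (e₁.val M) (e₂.val M)
      have hmod := Nat.mod_le (e₁.val M) (e₂.val M)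
      cases o <;> simp only [Expr.val, Op.apply] <;> omega
    refine ⟨2 * (c₁ + c₂) + 2, fun M b hM => ⟨(hval M b hM).trans_le ?_, ?_⟩⟩
    · exact Nat.pow_le_pow_right two_pos (Nat.mul_le_mul_right _ (by omega))
    · have h3 := Nat.size_le.2 (hval M b hM)
      have h4 := (h₁ M b hM).2
      have h5 := (h₂ M b hM).2
      rw [Expr.val] at h3
      rw [Expr.cost, bitCost]
      have : (2 * (c₁ + c₂) + 2) * (b + 1) =
        c₁ * (b + 1) + c₂ * (b + 1) + (c₁ + c₂ + 1) * (b + 1) + (b + 1) := by ring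
      omega

variable {ι κ : Type} {sz : ι → ℕ}

/-- All numbers in memory and on the input tape have polynomially bounded bit length. -/
def Bdd (sz : ι → ℕ) (s : ι → State) : Prop :=
  ∃ P : ℕ[X], ∀ i, (∀ r, (s i).mem r < 2 ^ P.eval (sz i)) ∧
    ∀ x ∈ (s i).inp, x < 2 ^ P.eval (sz i)

/-- In polynomial time, the program leads from the states `s` to the states `s'`. -/
def Runs (sz : ι → ℕ) (c : Prog) (s s' : ι → State) : Prop :=
  Bdd sz s → Bdd sz s' ∧ ∃ P : ℕ[X], ∀ i, ∃ t ≤ P.eval (sz i), Exec c (s i) t (s' i)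

theorem Bdd.comp {s : ι → State} (h : Bdd sz s) (g : κ → ι) :
    Bdd (fun k => sz (g k)) fun k => s (g k) := by
  obtain ⟨P, hP⟩ := h
  exact ⟨P, fun k => hP (g k)⟩

theorem Bdd.mem {s : ι → State} (h : Bdd sz s) (r : ι → ℕ) :
    PolyBits sz fun i => (s i).mem (r i) := by
  obtain ⟨P, hP⟩ := h
  exact ⟨P, fun i => (hP i).1 (r i)⟩

theorem Bdd.loopHead {s : ι → State} (h : Bdd sz s) (T : ι → ℕ) :
    Bdd (fun x : Below fun i => T i + 1 => sz x.idx) fun x => s x.idx :=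
  h.comp Below.idx

theorem Bdd.head {s : ι → State} (h : Bdd sz s) : PolyBits sz fun i => (s i).inp.headD 0 := by
  obtain ⟨P, hP⟩ := h
  refine ⟨P, fun i => ?_⟩
  dsimp only
  cases hi : (s i).inp with
  | nil => exact Nat.two_pow_pos _
  | cons x l => exact (hP i).2 x (by simp [hi])

theorem Bdd.change {s s' : ι → State} (h : Bdd sz s) {v : ι → ℕ} (hv : PolyBits sz v)
    (hmem : ∀ i r, (s' i).mem r = (s i).mem r ∨ (s' i).mem r = v i)
    (hinp : ∀ i, ∀ x ∈ (s' i).inp, x ∈ (s i).inp) : Bdd sz s' := by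
  obtain ⟨P, hP⟩ := h
  obtain ⟨Q, hQ⟩ := hv
  have h1 : ∀ i, 2 ^ P.eval (sz i) ≤ 2 ^ (P + Q).eval (sz i) := fun i => by
    rw [Polynomial.eval_add]
    exact Nat.pow_le_pow_right two_pos (Nat.le_add_right _ _)
  have h2 : ∀ i, 2 ^ Q.eval (sz i) ≤ 2 ^ (P + Q).eval (sz i) := fun i => by
    rw [Polynomial.eval_add]
    exact Nat.pow_le_pow_right two_pos (Nat.le_add_left _ _)
  refine ⟨P + Q, fun i => ⟨fun r => ?_, fun x hx => ?_⟩⟩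
  · rcases hmem i r with h | h
    · rw [h]
      exact ((hP i).1 r).trans_le (h1 i)
    · rw [h]
      exact (hQ i).trans_le (h2 i)
  · exact ((hP i).2 x (hinp i x hx)).trans_le (h1 i)

theorem Bdd.put {l inp out : ι → List ℕ} (h : Bdd sz fun i => ⟨regs (l i), inp i, out i⟩)
    (r : ι → ℕ) {v : ι → ℕ} (hv : PolyBits sz v) :
    Bdd sz fun i => ⟨regs (put (r i) (v i) (l i)), inp i, out i⟩ := by
  refine h.change hv (fun i s => ?_) fun i x hx => hx
  simp only [regs_put, Function.update_apply]
  split_ifs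
  · exact Or.inr rfl
  · exact Or.inl rfl

theorem Bdd.set {l inp out : ι → List ℕ} (h : Bdd sz fun i => ⟨regs (l i), inp i, out i⟩)
    (r : ℕ) {v : ι → ℕ} (hv : PolyBits sz v) :
    Bdd sz fun i => ⟨regs (RAM.put r (v i) (l i)), inp i, out i⟩ :=
  h.put (fun _ => r) hv

theorem Bdd.tail {s : ι → State} (h : Bdd sz s) {out : ι → List ℕ} :
    Bdd sz fun i => ⟨(s i).mem, (s i).inp.tail, out i⟩ :=
  h.change (PolyBits.const 0) (fun _ _ => Or.inl rfl) fun _ _ hx => List.mem_of_mem_tail hx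

theorem Bdd.val {s : ι → State} (h : Bdd sz s) (e : Expr) :
    PolyBits sz (fun i => e.val (s i).mem) ∧ PolyBounded sz fun i => e.cost (s i).mem := by
  obtain ⟨P, hP⟩ := h
  obtain ⟨c, hc⟩ := e.exists_bound
  refine ⟨⟨Polynomial.C c * (P + 1), fun i => ?_⟩, ⟨Polynomial.C c * (P + 1), fun i => ?_⟩⟩
  · have := (hc _ _ (hP i).1).1
    simpa using this
  · have := (hc _ _ (hP i).1).2
    simpa using this

theorem Runs.congr {c : Prog} {s s' s₁ s₁' : ι → State} (h : Runs sz c s s')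
    (hs : ∀ i, s i = s₁ i) (hs' : ∀ i, s' i = s₁' i) : Runs sz c s₁ s₁' := by
  obtain rfl : s = s₁ := funext hs
  obtain rfl : s' = s₁' := funext hs'
  exact h

theorem Runs.seq {c₁ c₂ : Prog} {s s' s'' : ι → State} (h₁ : Runs sz c₁ s s')
    (h₂ : Runs sz c₂ s' s'') : Runs sz (.seq c₁ c₂) s s'' := by
  intro h
  obtain ⟨hb, P, hP⟩ := h₁ h
  obtain ⟨hb', Q, hQ⟩ := h₂ hb
  refine ⟨hb', P + Q, fun i => ?_⟩
  obtain ⟨t, ht, he⟩ := hP i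
  obtain ⟨t', ht', he'⟩ := hQ i
  exact ⟨t + t', by rw [Polynomial.eval_add]; exact add_le_add ht ht', .seq he he'⟩

theorem Runs.skip {s : ι → State} : Runs sz .skip s s := fun h =>
  ⟨h, 1, fun i => ⟨1, by simp, .skip _⟩⟩

theorem Runs.assign {l inp out : ι → List ℕ} (a e : Expr) :
    Runs sz (.assign a e) (fun i => ⟨regs (l i), inp i, out i⟩)
      fun i => ⟨regs (put (a.val (regs (l i))) (e.val (regs (l i))) (l i)), inp i, out i⟩ := by
  intro h
  obtain ⟨P, hP⟩ := (h.val a).2.add (h.val e).2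
  refine ⟨h.put _ (h.val e).1, P, fun i => ⟨_, hP i, ?_⟩⟩
  dsimp only
  rw [regs_put]
  exact .assign a e _

theorem Runs.read {l inp out : ι → List ℕ} (a : Expr) :
    Runs sz (.read a) (fun i => ⟨regs (l i), inp i, out i⟩)
      fun i => ⟨regs (put (a.val (regs (l i))) ((inp i).headD 0) (l i)), (inp i).tail, out i⟩ := by
  intro h
  obtain ⟨Q, hQ⟩ := h.head
  have hcost : PolyBounded sz fun i => bitCost ((inp i).headD 0) :=
    ⟨Q + 1, fun i => by
      rw [Polynomial.eval_add, Polynomial.eval_one]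
      exact Nat.add_le_add_right (Nat.size_le.2 (hQ i)) 1⟩
  obtain ⟨P, hP⟩ := (h.val a).2.add hcost
  refine ⟨(h.put _ h.head).tail, P, fun i => ⟨_, hP i, ?_⟩⟩
  dsimp only
  rw [regs_put]
  exact .read a ⟨regs (l i), inp i, out i⟩

theorem Runs.write {l inp out : ι → List ℕ} (e : Expr) :
    Runs sz (.write e) (fun i => ⟨regs (l i), inp i, out i⟩)
      fun i => ⟨regs (l i), inp i, out i ++ [e.val (regs (l i))]⟩ := by
  intro h
  obtain ⟨P, hP⟩ := (h.val e).2
  exact ⟨h, P, fun i => ⟨_, hP i, .write e _⟩⟩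

theorem Runs.block {l inp out : ι → List ℕ} (b : List (ℕ × Expr)) :
    Runs sz (RAM.block b) (fun i => ⟨regs (l i), inp i, out i⟩)
      fun i => ⟨regs (runBlock b (l i)), inp i, out i⟩ := by
  induction b generalizing l with
  | nil => exact Runs.skip
  | cons x b ih => exact (Runs.assign (.const x.1) x.2).seq ih

/-- A while loop, where `st i k` is the state after `k` of the `T i` rounds. -/
theorem Runs.loop {e : Expr} {c : Prog} (T : ι → ℕ) (st : ι → ℕ → State)
    (hT : PolyBounded sz T) (hguard : ∀ i k, k < T i → e.val (st i k).mem ≠ 0)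
    (hexit : ∀ i, e.val (st i (T i)).mem = 0)
    (hBdd : Bdd sz (fun i => st i 0) →
      Bdd (fun x : Below fun i => T i + 1 => sz x.idx) fun x => st x.idx x.num)
    (hbody : Runs (fun x : Below T => sz x.idx) c (fun x => st x.idx x.num)
      fun x => st x.idx (x.num + 1)) :
    Runs sz (.loop e c) (fun i => st i 0) fun i => st i (T i) := by
  intro h
  -- The bit bound on all intermediate states is supplied from an explicit invariant. Passing it
  -- from round to round would compose polynomials an unbounded number of times.
  have hb := hBdd h
  obtain ⟨P, hP⟩ := hT
  obtain ⟨Q, hQ⟩ := (hb.val e).2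
  -- The body is analysed as a family indexed by pairs (input, round), so a single polynomial R
  -- bounds the cost of every round.
  obtain ⟨-, R, hR⟩ := hbody
    (hb.comp fun x : Below T => (⟨x.1, x.2.trans (Nat.lt_succ_self _)⟩ : Below fun i => T i + 1))
  refine ⟨hb.comp fun i => (⟨(i, T i), Nat.lt_succ_self _⟩ : Below fun i => T i + 1),
    P * (Q + R) + Q, fun i => ?_⟩
  have key : ∀ r k, k + r = T i →
      ∃ t ≤ r * (Q.eval (sz i) + R.eval (sz i)) + Q.eval (sz i),
        Exec (.loop e c) (st i k) t (st i (T i)) := by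
    intro r
    induction r with
    | zero =>
      intro k hk
      obtain rfl : k = T i := by omega
      refine ⟨_, ?_, .loop_false (hexit i)⟩
      rw [zero_mul, zero_add]
      exact hQ ⟨(i, T i), Nat.lt_succ_self _⟩
    | succ r ih =>
      intro k hk
      obtain ⟨t', ht', he'⟩ := ih (k + 1) (by omega)
      have hkT : k < T i := by omega
      obtain ⟨t, ht, he⟩ := hR ⟨(i, k), hkT⟩
      have hq := hQ ⟨(i, k), hkT.trans (Nat.lt_succ_self _)⟩
      refine ⟨_, ?_, .loop_true (hguard i k hkT) he he'⟩
      have ht : t ≤ R.eval (sz i) := ht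
      have hq : e.cost (st i k).mem ≤ Q.eval (sz i) := hq
      rw [Nat.succ_mul]
      omega
  obtain ⟨t, ht, he⟩ := key (T i) 0 (by omega)
  refine ⟨t, ht.trans ?_, he⟩
  rw [Polynomial.eval_add, Polynomial.eval_mul, Polynomial.eval_add]
  exact Nat.add_le_add_right (Nat.mul_le_mul_right _ (hP i)) _

end RAM

/-! ### Programs for the Cartier iteration, the traces and the exponential -/

namespace RAM

instance : Add Expr := ⟨.op .add⟩
instance : Sub Expr := ⟨.op .sub⟩
instance : Mul Expr := ⟨.op .mul⟩
instance : Div Expr := ⟨.op .div⟩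
instance : Mod Expr := ⟨.op .mod⟩
instance (k : ℕ) : OfNat Expr k := ⟨.const k⟩

/-- The content of a fixed cell. -/
def reg (k : ℕ) : Expr := .load (.const k)

theorem val_add (M : ℕ → ℕ) (x y : Expr) : (x + y).val M = x.val M + y.val M := rfl
theorem val_sub (M : ℕ → ℕ) (x y : Expr) : (x - y).val M = x.val M - y.val M := rfl
theorem val_mul (M : ℕ → ℕ) (x y : Expr) : (x * y).val M = x.val M * y.val M := rfl
theorem val_div (M : ℕ → ℕ) (x y : Expr) : (x / y).val M = x.val M / y.val M := rfl
theorem val_mod (M : ℕ → ℕ) (x y : Expr) : (x % y).val M = x.val M % y.val M := rfl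
theorem val_zero (M : ℕ → ℕ) : (0 : Expr).val M = 0 := rfl
theorem val_one (M : ℕ → ℕ) : (1 : Expr).val M = 1 := rfl
theorem val_reg (M : ℕ → ℕ) (k : ℕ) : (reg k).val M = M k := rfl
theorem val_load (M : ℕ → ℕ) (e : Expr) : (Expr.load e).val M = M (e.val M) := rfl

theorem regs_zero (x : ℕ) (l : List ℕ) : regs (x :: l) 0 = x := rfl
theorem regs_succ (x r : ℕ) (l : List ℕ) : regs (x :: l) (r + 1) = regs l r := rfl

/-- Powers of expressions. -/
def powExpr (e : Expr) : ℕ → Expr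
  | 0 => 1
  | k + 1 => powExpr e k * e

theorem val_powExpr (M : ℕ → ℕ) (e : Expr) (k : ℕ) : (powExpr e k).val M = e.val M ^ k := by
  induction k with
  | zero => rfl
  | succ k ih => rw [powExpr, val_mul, ih, pow_succ]

/-- The product in the definition of `boxIndicator`. -/
def boxProdExpr (r : ℕ) : ℕ → Expr
  | 0 => 1
  | i + 1 => boxProdExpr r i * ((reg r / powExpr (reg 4) i % reg 4) *
      (reg 3 + 1 - reg r / powExpr (reg 4) i % reg 4))

/-- The indicator `boxIndicator` of the content of a cell. -/
def boxExpr (n r : ℕ) : Expr := 1 - (1 - boxProdExpr r (n + 1))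

theorem val_boxExpr (M : ℕ → ℕ) (n r : ℕ) :
    (boxExpr n r).val M = boxIndicator n (M 3) (M 4) (M r) := by
  have h : ∀ k, (boxProdExpr r k).val M =
      ∏ i ∈ Finset.range k, (M r / M 4 ^ i % M 4) * (M 3 + 1 - M r / M 4 ^ i % M 4) := by
    intro k
    induction k with
    | zero => rfl
    | succ k ih =>
      rw [boxProdExpr, val_mul, ih, Finset.prod_range_succ]
      simp only [val_mul, val_sub, val_add, val_div, val_mod, val_reg, val_powExpr, val_one]
  rw [boxExpr, val_sub, val_sub, h, val_one, boxIndicator]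

/-- The parameters of the computation, kept in the first registers. -/
structure Consts where
  (p a cnt D E J K B F M C : ℕ)

/-- A state in which the memory begins with the parameters. -/
def cfg (c : Consts) (t inp out : List ℕ) : State :=
  ⟨regs (c.p :: c.a :: c.cnt :: c.D :: c.E :: c.J :: c.K :: c.B :: c.F :: c.M :: c.C :: t),
    inp, out⟩

/-- The operator `cartierNum`, applied to register 23, result in register 22. -/
def cartierProg (n : ℕ) : Prog :=
  .seq (block [(20, 1), (21, 1)])
  (.seq (.loop (reg 5 - reg 19) (block
    [(22, reg 22 + boxExpr n 19 * (reg 23 / reg 21 % reg 7) * reg 20), (20, reg 20 * reg 7),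
      (21, reg 21 * reg 10), (19, reg 19 + 1)]))
  (block [(19, 0), (20, 0), (21, 0)]))

variable {ι : Type} {sz : ι → ℕ} {c : ι → Consts} {inp out arr : ι → List ℕ}

theorem cartierProg_runs (n : ℕ) (hJ : PolyBounded sz fun i => (c i).J)
    (hJE : ∀ i, (c i).J = (c i).E ^ (n + 1)) (hC : ∀ i, (c i).C = (c i).B ^ (c i).p)
    {S x₁₂ x₁₃ x₁₄ x₁₅ x₁₆ x₁₇ x₁₈ g : ι → ℕ} :
    Runs sz (cartierProg n)
      (fun i => cfg (c i) (S i :: x₁₂ i :: x₁₃ i :: x₁₄ i :: x₁₅ i :: x₁₆ i :: x₁₇ i :: x₁₈ i ::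
        0 :: 0 :: 0 :: 0 :: g i :: arr i) (inp i) (out i))
      (fun i => cfg (c i) (S i :: x₁₂ i :: x₁₃ i :: x₁₄ i :: x₁₅ i :: x₁₆ i :: x₁₇ i :: x₁₈ i ::
        0 :: 0 :: 0 :: cartierNum n (c i).D (c i).E (c i).B (c i).p (g i) :: g i :: arr i)
        (inp i) (out i)) := by
  let acc : ι → ℕ → ℕ := fun i k => ∑ j ∈ Finset.range k,
    boxIndicator n (c i).D (c i).E j * (g i / (c i).C ^ j % (c i).B) * (c i).B ^ j
  -- Loop invariant: cell 19 counts rounds, cells 20 and 21 hold B^k and C^k = B^(pk), and cell 22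
  -- the partial sum. Scratch cells are zero before and after, so that states of consecutive
  -- programs match literally.
  let st : ι → ℕ → State := fun i k => cfg (c i) (S i :: x₁₂ i :: x₁₃ i :: x₁₄ i :: x₁₅ i ::
    x₁₆ i :: x₁₇ i :: x₁₈ i :: k :: (c i).B ^ k :: (c i).C ^ k :: acc i k :: g i :: arr i)
    (inp i) (out i)
  refine Runs.seq ((Runs.block _).congr (fun i => rfl) fun i => rfl)
    (Runs.seq (s' := fun i => st i (c i).J) ((Runs.loop (fun i => (c i).J) st hJ ?_ ?_ ?_ ?_).congr
      (fun i => rfl) fun i => rfl) ((Runs.block _).congr (fun i => rfl) fun i => ?_))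
  · intro i k hk
    exact (Nat.sub_pos_of_lt hk).ne'
  · intro i
    exact Nat.sub_self _
  · intro h
    have hB := h.mem fun _ => 7
    have hC := h.mem fun _ => 10
    have hg := h.mem fun _ => 23
    have hacc : PolyBits (fun x : Below fun i => (c i).J + 1 => sz x.idx)
        fun x => acc x.idx x.num :=
      PolyBits.partial_sum hJ (φ := fun i j => boxIndicator n (c i).D (c i).E j *
          (g i / (c i).C ^ j % (c i).B) * (c i).B ^ j) <|
        (((hg.comp Below.idx).mul ((hB.comp Below.idx).pow hJ.num))).mono fun x =>
          Nat.mul_le_mul_right _ ((Nat.mul_le_mul (boxIndicator_le_one _ _ _ _)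
            ((Nat.mod_le _ _).trans (Nat.div_le_self _ _))).trans (one_mul _).le)
    exact ((((h.loopHead _).set 19 hJ.num_succ.bits).set 20
      ((hB.comp Below.idx).pow hJ.num_succ)).set 21
      ((hC.comp Below.idx).pow hJ.num_succ)).set 22 hacc
  · refine (Runs.block _).congr (fun i => rfl) fun i => ?_
    simp only [st, cfg, runBlock, put, val_add, val_mul, val_div, val_mod, val_boxExpr, val_reg,
      val_one, regs_zero, regs_succ, pow_succ, acc, Finset.sum_range_succ]
  · simp only [cartierNum, ← hJE, ← hC]
    rfl


/-- Register 14 becomes the power of register 15 with exponent register 13. -/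
def powProg : Prog :=
  .seq (block [(14, 1)]) (.loop (reg 13) (block [(14, reg 14 * reg 15), (13, reg 13 - 1)]))

/-- Repeated multiplication suffices: all exponents that occur are polynomially bounded. -/
theorem powProg_runs {S x₁₂ e y b : ι → ℕ} (he : PolyBounded sz e) :
    Runs sz powProg
      (fun i => cfg (c i) (S i :: x₁₂ i :: e i :: y i :: b i :: arr i) (inp i) (out i))
      (fun i => cfg (c i) (S i :: x₁₂ i :: 0 :: b i ^ e i :: b i :: arr i) (inp i) (out i)) := by
  let st : ι → ℕ → State := fun i k =>
    cfg (c i) (S i :: x₁₂ i :: (e i - k) :: b i ^ k :: b i :: arr i) (inp i) (out i)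
  refine Runs.seq ((Runs.block _).congr (fun i => rfl) fun i => rfl)
    ((Runs.loop e st he ?_ ?_ ?_ ?_).congr (fun i => rfl) fun i => ?_)
  · intro i k hk
    exact (Nat.sub_pos_of_lt hk).ne'
  · intro i
    exact Nat.sub_self _
  · intro h
    have hb := h.mem fun _ => 15
    exact ((h.loopHead _).set 13 ((he.bits.comp Below.idx).mono fun x => Nat.sub_le _ _)).set 14
      ((hb.comp Below.idx).pow he.num_succ)
  · refine (Runs.block _).congr (fun i => rfl) fun i => ?_
    simp only [st, cfg, runBlock, put, val_sub, val_mul, val_reg, val_one, regs_zero, regs_succ,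
      pow_succ, Nat.sub_sub]
  · simp only [st, Nat.sub_self]

/-- The summand in `traceNum`. -/
def Consts.traceTerm (n : ℕ) (c : Consts) (l i : ℕ) : ℕ :=
  boxIndicator n c.D c.E l * (cartierIter n c.D c.E c.B c.p c.F l (i + 1) / c.B ^ l % c.B +
    (c.p ^ (i + 1) - 1) * (cartierIter n c.D c.E c.B c.p c.M l (i + 1) / c.B ^ l % c.B)) *
      c.B ^ (i + 1)

/-- One step of the iterations, for both equations. -/
def traceStep (n : ℕ) : Prog :=
  .seq (block [(15, reg 15 * reg 7), (16, reg 16 * reg 0), (23, reg 8 * reg 17)])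
  (.seq (cartierProg n)
  (.seq (block [(17, reg 22), (22, 0), (23, reg 9 * reg 18)])
  (.seq (cartierProg n)
  (block [(18, reg 22), (22, 0), (23, 0),
    (11, reg 11 + boxExpr n 12 * (reg 17 / reg 13 % reg 7 +
      (reg 16 - 1) * (reg 18 / reg 13 % reg 7)) * reg 15),
    (14, reg 14 + 1)]))))

theorem traceStep_runs (n : ℕ) (hJ : PolyBounded sz fun i => (c i).J)
    (hJE : ∀ i, (c i).J = (c i).E ^ (n + 1)) (hC : ∀ i, (c i).C = (c i).B ^ (c i).p)
    {S l k : ι → ℕ} :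
    Runs sz (traceStep n)
      (fun i => cfg (c i) (S i :: l i :: (c i).B ^ l i :: k i :: (c i).B ^ k i :: (c i).p ^ k i ::
        cartierIter n (c i).D (c i).E (c i).B (c i).p (c i).F (l i) (k i) ::
        cartierIter n (c i).D (c i).E (c i).B (c i).p (c i).M (l i) (k i) ::
        0 :: 0 :: 0 :: 0 :: 0 :: arr i) (inp i) (out i))
      (fun i => cfg (c i) ((S i + (c i).traceTerm n (l i) (k i)) ::
        l i :: (c i).B ^ l i :: (k i + 1) :: (c i).B ^ (k i + 1) :: (c i).p ^ (k i + 1) ::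
        cartierIter n (c i).D (c i).E (c i).B (c i).p (c i).F (l i) (k i + 1) ::
        cartierIter n (c i).D (c i).E (c i).B (c i).p (c i).M (l i) (k i + 1) ::
        0 :: 0 :: 0 :: 0 :: 0 :: arr i) (inp i) (out i)) := by
  refine Runs.seq (Runs.block _) (Runs.seq ((cartierProg_runs n hJ hJE hC).congr (fun i => rfl)
    fun i => rfl) (Runs.seq (Runs.block _) (Runs.seq ((cartierProg_runs n hJ hJE hC).congr
    (fun i => rfl) fun i => rfl) ((Runs.block _).congr (fun i => rfl) fun i => ?_))))
  simp only [cfg, runBlock, put, val_add, val_sub, val_mul, val_div, val_mod, val_boxExpr, val_reg,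
    val_one, val_zero, regs_zero, regs_succ, pow_succ, cartierIter, Consts.traceTerm]

/-- Every iterate is reassembled from at most E^(n+1) digits below B, so the bound does not depend
on the number of iterations. This keeps the intermediate numbers polynomially long. -/
theorem cartierIter_le {n D E B p G l : ℕ} (hB : 1 ≤ B) (hl : l < E ^ (n + 1)) (k : ℕ) :
    cartierIter n D E B p G l k ≤ E ^ (n + 1) * (B * B ^ E ^ (n + 1)) := by
  have hBpow : ∀ j, j < E ^ (n + 1) → B ^ j ≤ B ^ E ^ (n + 1) := fun j hj =>
    Nat.pow_le_pow_right hB hj.le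
  cases k with
  | zero =>
    rw [cartierIter]
    refine (hBpow l hl).trans ((Nat.le_mul_of_pos_left _ hB).trans
      (Nat.le_mul_of_pos_left _ (by omega)))
  | succ k =>
    rw [cartierIter, cartierNum]
    refine (Finset.sum_le_card_nsmul _ _ (B * B ^ E ^ (n + 1)) fun j hj => ?_).trans (by simp)
    refine Nat.mul_le_mul ?_ (hBpow j (Finset.mem_range.1 hj))
    refine (Nat.mul_le_mul (boxIndicator_le_one _ _ _ _) (Nat.mod_lt _ hB).le).trans ?_
    rw [one_mul]

theorem Consts.traceTerm_le (n : ℕ) (c : Consts) (hB : 1 ≤ c.B) (l i : ℕ) :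
    c.traceTerm n l i ≤ (c.B + c.p ^ (i + 1) * c.B) * c.B ^ (i + 1) := by
  refine Nat.mul_le_mul_right _ ((Nat.mul_le_mul_right _ (boxIndicator_le_one _ _ _ _)).trans ?_)
  rw [one_mul]
  exact add_le_add (Nat.mod_lt _ hB).le (Nat.mul_le_mul (Nat.sub_le _ _) (Nat.mod_lt _ hB).le)

/-- The contribution of one starting monomial. -/
def traceInner (n : ℕ) : Prog :=
  .seq (block [(15, 1), (16, 1), (17, reg 13), (18, reg 13)])
  (.seq (.loop (reg 6 - reg 14) (traceStep n))
  (block [(14, 0), (15, 0), (16, 0), (17, 0), (18, 0), (12, reg 12 + 1), (13, reg 13 * reg 7)]))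

theorem traceInner_runs (n : ℕ) (hJ : PolyBounded sz fun i => (c i).J)
    (hK : PolyBounded sz fun i => (c i).K)
    (hJE : ∀ i, (c i).J = (c i).E ^ (n + 1)) (hC : ∀ i, (c i).C = (c i).B ^ (c i).p)
    (hB : ∀ i, 1 ≤ (c i).B) {S l : ι → ℕ} (hl : ∀ i, l i < (c i).J) :
    Runs sz (traceInner n)
      (fun i => cfg (c i) (S i :: l i :: (c i).B ^ l i :: 0 :: 0 :: 0 :: 0 :: 0 ::
        0 :: 0 :: 0 :: 0 :: 0 :: arr i) (inp i) (out i))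
      (fun i => cfg (c i) ((S i + ∑ k ∈ Finset.range (c i).K, (c i).traceTerm n (l i) k) ::
        (l i + 1) :: (c i).B ^ (l i + 1) :: 0 :: 0 :: 0 :: 0 :: 0 ::
        0 :: 0 :: 0 :: 0 :: 0 :: arr i) (inp i) (out i)) := by
  let acc : ι → ℕ → ℕ := fun i k => S i + ∑ k ∈ Finset.range k, (c i).traceTerm n (l i) k
  -- Cells 11 to 18 hold the sum, l, B^l, the round k, B^k, p^k and the two iterates. Cells 19 to 23
  -- are scratch space.
  let st : ι → ℕ → State := fun i k => cfg (c i) (acc i k :: l i :: (c i).B ^ l i :: k ::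
    (c i).B ^ k :: (c i).p ^ k ::
    cartierIter n (c i).D (c i).E (c i).B (c i).p (c i).F (l i) k ::
    cartierIter n (c i).D (c i).E (c i).B (c i).p (c i).M (l i) k ::
    0 :: 0 :: 0 :: 0 :: 0 :: arr i) (inp i) (out i)
  refine Runs.seq (Runs.block _) (Runs.seq (s' := fun i => st i (c i).K)
    ((Runs.loop (fun i => (c i).K) st hK ?_ ?_ ?_ ?_).congr (fun i => rfl) fun i => rfl)
    ((Runs.block _).congr (fun i => rfl) fun i => rfl))
  · intro i k hk
    exact (Nat.sub_pos_of_lt hk).ne'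
  · intro i
    exact Nat.sub_self _
  · intro h
    have hBb := h.mem fun _ => 7
    have hpb := h.mem fun _ => 0
    have hSb := h.mem fun _ => 11
    have hk := hK.num_succ
    have hBk := (hBb.comp Below.idx).pow hk
    have hacc : PolyBits (fun x : Below fun i => (c i).K + 1 => sz x.idx)
        fun x => acc x.idx x.num := by
      refine (hSb.comp Below.idx).add (PolyBits.partial_sum hK
        (φ := fun i k => (c i).traceTerm n (l i) k) ?_)
      have hk1 := hK.num.add (PolyBounded.const 1)
      exact (((hBb.comp Below.idx).add (((hpb.comp Below.idx).pow hk1).mul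
        (hBb.comp Below.idx))).mul ((hBb.comp Below.idx).pow hk1)).mono fun x =>
          (c x.idx).traceTerm_le n (hB _) _ _
    have hiter := (hJ.bits.mul (hBb.mul (hBb.pow hJ))).comp (Below.idx (T := fun i => (c i).K + 1))
    have hle : ∀ (x : Below fun i => (c i).K + 1) G,
        cartierIter n (c x.idx).D (c x.idx).E (c x.idx).B (c x.idx).p G (l x.idx) x.num ≤
          (c x.idx).J * ((c x.idx).B * (c x.idx).B ^ (c x.idx).J) := by
      intro x G
      have h1 := hl x.idx
      rw [hJE] at h1 ⊢
      exact cartierIter_le (hB _) h1 _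
    exact ((((((h.loopHead _).set 11 hacc).set 14 hk.bits).set 15 hBk).set 16
      ((hpb.comp Below.idx).pow hk)).set 17 (hiter.mono fun x => hle x _)).set 18
      (hiter.mono fun x => hle x _)
  · refine (traceStep_runs n (hJ.comp Below.idx) (fun x => hJE x.idx) (fun x => hC x.idx)).congr
      (fun x => rfl) fun x => ?_
    simp only [st, acc, Finset.sum_range_succ, add_assoc]

/-- Register 11 becomes `traceNum`. -/
def traceProg (n : ℕ) : Prog :=
  .seq (block [(13, 1)])
  (.seq (.loop (reg 5 - reg 12) (traceInner n)) (block [(12, 0), (13, 0)]))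

theorem traceProg_runs (n : ℕ) (hJ : PolyBounded sz fun i => (c i).J)
    (hK : PolyBounded sz fun i => (c i).K)
    (hJE : ∀ i, (c i).J = (c i).E ^ (n + 1)) (hC : ∀ i, (c i).C = (c i).B ^ (c i).p)
    (hB : ∀ i, 1 ≤ (c i).B) :
    Runs sz (traceProg n)
      (fun i => cfg (c i) (0 :: 0 :: 0 :: 0 :: 0 :: 0 :: 0 :: 0 ::
        0 :: 0 :: 0 :: 0 :: 0 :: arr i) (inp i) (out i))
      (fun i => cfg (c i) (traceNum n (c i).D (c i).E (c i).B (c i).p (c i).K (c i).F (c i).M ::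
        0 :: 0 :: 0 :: 0 :: 0 :: 0 :: 0 :: 0 :: 0 :: 0 :: 0 :: 0 :: arr i) (inp i) (out i)) := by
  let acc : ι → ℕ → ℕ := fun i l => ∑ l ∈ Finset.range l, ∑ k ∈ Finset.range (c i).K,
    (c i).traceTerm n l k
  let st : ι → ℕ → State := fun i l => cfg (c i) (acc i l :: l :: (c i).B ^ l :: 0 ::
    0 :: 0 :: 0 :: 0 :: 0 :: 0 :: 0 :: 0 :: 0 :: arr i) (inp i) (out i)
  refine Runs.seq (Runs.block _) (Runs.seq (s' := fun i => st i (c i).J)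
    ((Runs.loop (fun i => (c i).J) st hJ ?_ ?_ ?_ ?_).congr (fun i => rfl) fun i => rfl)
    ((Runs.block _).congr (fun i => rfl) fun i => ?_))
  · intro i k hk
    exact (Nat.sub_pos_of_lt hk).ne'
  · intro i
    exact Nat.sub_self _
  · intro h
    have hBb := h.mem fun _ => 7
    have hpb := h.mem fun _ => 0
    have hk := hJ.num_succ
    have hacc : PolyBits (fun x : Below fun i => (c i).J + 1 => sz x.idx)
        fun x => acc x.idx x.num := by
      refine PolyBits.partial_sum hJ
        (φ := fun i l => ∑ k ∈ Finset.range (c i).K, (c i).traceTerm n l k) ?_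
      have hK' := hK.comp (Below.idx (T := fun i => (c i).J))
      refine PolyBits.sum hK' (φ := fun x k => (c x.idx).traceTerm n x.num k) ?_
      have hk1 := hK'.num.add (PolyBounded.const 1)
      have hBb' := (hBb.comp (Below.idx (T := fun i => (c i).J))).comp
        (Below.idx (T := fun x => (c x.idx).K))
      have hpb' := (hpb.comp (Below.idx (T := fun i => (c i).J))).comp
        (Below.idx (T := fun x => (c x.idx).K))
      exact ((hBb'.add ((hpb'.pow hk1).mul hBb')).mul (hBb'.pow hk1)).mono fun x =>
        (c x.idx.idx).traceTerm_le n (hB _) _ _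
    exact (((h.loopHead _).set 11 hacc).set 12 hk.bits).set 13 ((hBb.comp Below.idx).pow hk)
  · refine (traceInner_runs n (hJ.comp Below.idx) (hK.comp Below.idx) (fun x => hJE x.idx)
      (fun x => hC x.idx) (fun x => hB x.idx) (l := Below.num) fun x => x.2).congr
      (fun x => rfl) fun x => ?_
    simp only [st, acc, Finset.sum_range_succ]
  · simp only [traceNum, ← hJE]
    rfl

/-- Register 14 becomes `expNum` of register 11. -/
def expProg : Prog :=
  .seq (block [(13, 1), (14, 1)])
  (.seq (.loop (reg 6 - reg 12) (block [(13, reg 13 * reg 7), (12, reg 12 + 1),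
    (14, reg 14 + reg 11 * reg 14 / reg 13 % reg 7 / reg 12 * reg 13)]))
  (block [(12, 0), (13, 0)]))

/-- Each step adds one digit below B at position at most K; the bound does not involve S. -/
theorem expNum_le {B S : ℕ} (hB : 1 ≤ B) {k K : ℕ} (hk : k ≤ K) :
    expNum B S k ≤ 1 + K * (B * B ^ K) := by
  suffices h : expNum B S k ≤ 1 + k * (B * B ^ K) from
    h.trans (Nat.add_le_add_left (Nat.mul_le_mul_right _ hk) 1)
  induction k with
  | zero => simp [expNum]
  | succ k ih =>
    rw [expNum, Nat.succ_mul, ← add_assoc]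
    refine add_le_add (ih (by omega)) (Nat.mul_le_mul ?_ (Nat.pow_le_pow_right hB hk))
    exact (Nat.div_le_self _ _).trans (Nat.mod_lt _ hB).le

theorem expProg_runs (hK : PolyBounded sz fun i => (c i).K) (hB : ∀ i, 1 ≤ (c i).B)
    {S : ι → ℕ} :
    Runs sz expProg
      (fun i => cfg (c i) (S i :: 0 :: 0 :: 0 :: arr i) (inp i) (out i))
      (fun i => cfg (c i) (S i :: 0 :: 0 :: expNum (c i).B (S i) (c i).K :: arr i)
        (inp i) (out i)) := by
  let st : ι → ℕ → State := fun i k => cfg (c i) (S i :: k :: (c i).B ^ k ::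
    expNum (c i).B (S i) k :: arr i) (inp i) (out i)
  refine Runs.seq (Runs.block _) (Runs.seq (s' := fun i => st i (c i).K)
    ((Runs.loop (fun i => (c i).K) st hK ?_ ?_ ?_ ?_).congr (fun i => rfl) fun i => rfl)
    ((Runs.block _).congr (fun i => rfl) fun i => rfl))
  · intro i k hk
    exact (Nat.sub_pos_of_lt hk).ne'
  · intro i
    exact Nat.sub_self _
  · intro h
    have hBb := h.mem fun _ => 7
    have hk := hK.num_succ
    have hexp := ((PolyBits.const 1).add (hK.bits.mul (hBb.mul (hBb.pow hK)))).comp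
      (Below.idx (T := fun i => (c i).K + 1))
    exact (((h.loopHead _).set 12 hk.bits).set 13 ((hBb.comp Below.idx).pow hk)).set 14
      (hexp.mono fun x => expNum_le (hB _) (Nat.lt_succ_iff.1 x.2))
  · refine (Runs.block _).congr (fun i => rfl) fun i => ?_
    simp only [st, cfg, runBlock, put, val_add, val_mul, val_div, val_mod, val_reg,
      val_one, regs_zero, regs_succ, pow_succ, expNum]

end RAM

/-! ### Programs that read the input and encode the equations -/

namespace RAM

variable {ι : Type} {sz : ι → ℕ}

/-- All listed numbers have polynomially bounded bit length. -/
def ListBits (sz : ι → ℕ) (u : ι → List ℕ) : Prop :=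
  ∃ P : ℕ[X], ∀ i, ∀ x ∈ u i, x < 2 ^ P.eval (sz i)

theorem Bdd.listBits_inp {s : ι → State} (h : Bdd sz s) : ListBits sz fun i => (s i).inp := by
  obtain ⟨P, hP⟩ := h
  exact ⟨P, fun i => (hP i).2⟩

theorem ListBits.mono {κ : Type} {u : ι → List ℕ} (h : ListBits sz u) {v : κ → List ℕ} (g : κ → ι)
    (hv : ∀ k, ∀ x ∈ v k, x ∈ u (g k)) : ListBits (fun k => sz (g k)) v := by
  obtain ⟨P, hP⟩ := h
  exact ⟨P, fun k x hx => hP (g k) x (hv k x hx)⟩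

theorem regs_append (l u : List ℕ) (r : ℕ) :
    regs (l ++ u) r = regs l r ∨ regs (l ++ u) r = 0 ∨ regs (l ++ u) r ∈ u := by
  rcases lt_or_ge r l.length with h | h
  · left
    simp [regs, List.getElem?_append_left h]
  · right
    simp only [regs, List.getD_eq_getElem?_getD, List.getElem?_append_right h]
    rcases lt_or_ge (r - l.length) u.length with h' | h'
    · right
      simp [h']
    · left
      simp [h']

theorem regs_append_length (l : List ℕ) (v : ℕ) : regs (l ++ [v]) l.length = v := by
  simp [regs]

theorem Bdd.append {l inp inp' out u : ι → List ℕ} (h : Bdd sz fun i => ⟨regs (l i), inp i, out i⟩)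
    (hu : ListBits sz u) (hinp : ListBits sz inp') :
    Bdd sz fun i => ⟨regs (l i ++ u i), inp' i, out i⟩ := by
  obtain ⟨P, hP⟩ := h
  obtain ⟨Q, hQ⟩ := hu
  obtain ⟨R, hR⟩ := hinp
  have hle : ∀ i (A : ℕ[X]), A = P ∨ A = Q ∨ A = R →
      2 ^ A.eval (sz i) ≤ 2 ^ (P + Q + R).eval (sz i) := by
    intro i A hA
    refine Nat.pow_le_pow_right two_pos ?_
    rw [Polynomial.eval_add, Polynomial.eval_add]
    rcases hA with rfl | rfl | rfl <;> omega
  refine ⟨P + Q + R, fun i => ⟨fun r => ?_, fun x hx => (hR i x hx).trans_le (hle i _ (by simp))⟩⟩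
  rcases regs_append (l i) (u i) r with h | h | h
  · exact h.trans_lt (((hP i).1 r).trans_le (hle i P (by simp)))
  · exact h.trans_lt (Nat.two_pow_pos _)
  · exact (hQ i _ h).trans_le (hle i Q (by simp))

variable {c : ι → Consts} {inp out arr : ι → List ℕ}

theorem val_const (M : ℕ → ℕ) (k : ℕ) : (Expr.const k).val M = k := rfl

/-- Moves a number from the input to the cell 24 + register 13, and adds it to register 3. -/
def readStep : Prog :=
  .seq (.read (reg 13 + .const 24)) (block
    [(3, reg 3 + .load (reg 13 + .const 24)), (13, reg 13 + 1), (12, reg 12 - 1)])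

/-- The write address 24 + (length of the stored list) is the first cell after that list, so storing
appends to it. Cell 3 accumulates the sum of the entries, the main part of the parameter D. -/
theorem readStep_runs {S x v : ι → ℕ} {rest : ι → List ℕ} :
    Runs sz readStep
      (fun i => cfg (c i) (S i :: x i :: (arr i).length :: 0 :: 0 :: 0 :: 0 :: 0 ::
        0 :: 0 :: 0 :: 0 :: 0 :: arr i) (v i :: rest i) (out i))
      (fun i => cfg { c i with D := (c i).D + v i } (S i :: (x i - 1) :: ((arr i).length + 1) ::
        0 :: 0 :: 0 :: 0 :: 0 :: 0 :: 0 :: 0 :: 0 :: 0 :: (arr i ++ [v i])) (rest i) (out i)) := by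
  refine Runs.seq (s' := fun i => cfg (c i) (S i :: x i :: (arr i).length :: 0 :: 0 :: 0 :: 0 ::
      0 :: 0 :: 0 :: 0 :: 0 :: 0 :: (arr i ++ [v i])) (rest i) (out i))
    ((Runs.read _).congr (fun i => rfl) fun i => ?_)
    ((Runs.block _).congr (fun i => rfl) fun i => ?_)
  · simp only [cfg, put, val_add, val_const, val_reg, regs_zero, regs_succ, List.headD_cons,
      List.tail_cons, put_length]
  · simp only [cfg, runBlock, put, val_add, val_sub, val_load, val_const, val_reg, val_one,
      regs_zero, regs_succ, regs_append_length]

/-- Moves as many numbers as register 12 says from the input to the cells 24 + register 13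
and following, and adds them to register 3. -/
def readProg : Prog := .loop (reg 12) readStep

theorem readProg_runs {u rest : ι → List ℕ} {S : ι → ℕ}
    (hu : PolyBounded sz fun i => (u i).length) (hsum : PolyBits sz fun i => (u i).sum)
    (harr : PolyBits sz fun i => (arr i).length) :
    Runs sz readProg
      (fun i => cfg (c i) (S i :: (u i).length :: (arr i).length :: 0 :: 0 :: 0 :: 0 :: 0 ::
        0 :: 0 :: 0 :: 0 :: 0 :: arr i) (u i ++ rest i) (out i))
      (fun i => cfg { c i with D := (c i).D + (u i).sum }
        (S i :: 0 :: (arr i ++ u i).length :: 0 :: 0 :: 0 :: 0 :: 0 ::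
        0 :: 0 :: 0 :: 0 :: 0 :: (arr i ++ u i)) (rest i) (out i)) := by
  let st : ι → ℕ → State := fun i k => cfg { c i with D := (c i).D + ((u i).take k).sum }
    (S i :: ((u i).length - k) :: ((arr i).length + k) :: 0 :: 0 :: 0 :: 0 :: 0 ::
      0 :: 0 :: 0 :: 0 :: 0 :: (arr i ++ (u i).take k)) ((u i).drop k ++ rest i) (out i)
  refine (Runs.loop (fun i => (u i).length) st hu ?_ ?_ ?_ ?_).congr (fun i => ?_) fun i => ?_
  · intro i k hk
    exact (Nat.sub_pos_of_lt hk).ne'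
  · intro i
    exact Nat.sub_self _
  · intro h
    have hDb := h.mem fun _ => 3
    have h0 : Bdd sz fun i => cfg (c i) (S i :: ((u i).length - 0) :: ((arr i).length + 0) :: 0 ::
        0 :: 0 :: 0 :: 0 :: 0 :: 0 :: 0 :: 0 :: 0 :: (arr i)) ((u i).drop 0 ++ rest i) (out i) := by
      simpa only [st, List.take_zero, List.sum_nil, List.append_nil, add_zero] using h
    have hsum' : PolyBits (fun x : Below fun i => (u i).length + 1 => sz x.idx)
        fun x => (c x.idx).D + ((u x.idx).take x.num).sum :=
      ((hDb.add hsum).comp Below.idx).mono fun x => by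
        refine add_le_add (Nat.le_add_right _ _) ?_
        conv_rhs => rw [← List.take_append_drop x.num (u x.idx), List.sum_append]
        exact Nat.le_add_right _ _
    have happ := (h0.loopHead fun i => (u i).length).append
      (u := fun x => (u x.idx).take x.num) (inp' := fun x => (u x.idx).drop x.num ++ rest x.idx)
      (h.listBits_inp.mono Below.idx fun x y hy => List.mem_append_left _ (List.mem_of_mem_take hy))
      (h.listBits_inp.mono Below.idx fun x y hy => by
        rcases List.mem_append.1 hy with hy | hy
        · exact List.mem_append_left _ (List.mem_of_mem_drop hy)
        · exact List.mem_append_right _ hy)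
    exact ((happ.set 3 hsum').set 12 ((hu.bits.comp Below.idx).mono fun x => Nat.sub_le _ _)).set 13
      ((harr.comp Below.idx).add hu.num_succ.bits)
  · refine (readStep_runs (c := fun x => { c x.idx with
      D := (c x.idx).D + ((u x.idx).take x.num).sum })
      (arr := fun x => arr x.idx ++ (u x.idx).take x.num) (S := fun x => S x.idx)
      (x := fun x => (u x.idx).length - x.num)
      (v := fun x => (u x.idx)[x.num]'x.2) (rest := fun x => (u x.idx).drop (x.num + 1) ++ rest x.idx)
      (out := fun x => out x.idx)).congr (fun x => ?_) fun x => ?_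
    · simp only [st, List.length_append, List.length_take, Nat.min_eq_left x.2.le]
      rw [List.drop_eq_getElem_cons x.2]
      rfl
    · simp only [st, List.length_append, List.length_take, Nat.min_eq_left x.2.le]
      rw [List.append_assoc, add_assoc, ← List.take_append_getElem x.2, List.sum_append,
        List.sum_singleton]
      simp only [Nat.sub_sub, add_assoc]
  · simp only [st, List.take_zero, List.sum_nil, List.append_nil, List.drop_zero, add_zero,
      Nat.sub_zero]
  · simp only [st, List.take_length, List.drop_length, List.nil_append, Nat.sub_self,
      List.length_append]

/-- The encoded modulus is added to register 9. -/
def modulusProg : Prog :=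
  .seq (block [(15, 1)])
  (.seq (.loop (reg 1 + 1 - reg 14) (block
    [(9, reg 9 + .load (reg 14 + .const 24) * reg 15), (15, reg 15 * reg 7), (14, reg 14 + 1)]))
  (block [(14, 0), (15, 0)]))

theorem modulusProg_runs (ha : PolyBounded sz fun i => (c i).a)
    {w : ι → ℕ} (hw : PolyBits sz w) (harr : ∀ i r, regs (arr i) r ≤ w i) {S : ι → ℕ} :
    Runs sz modulusProg
      (fun i => cfg (c i) (S i :: 0 :: 0 :: 0 :: 0 :: 0 :: 0 :: 0 ::
        0 :: 0 :: 0 :: 0 :: 0 :: arr i) (inp i) (out i))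
      (fun i => cfg { c i with
          M := (c i).M + ∑ b ∈ Finset.range ((c i).a + 1), regs (arr i) b * (c i).B ^ b }
        (S i :: 0 :: 0 :: 0 :: 0 :: 0 :: 0 :: 0 :: 0 :: 0 :: 0 :: 0 :: 0 :: arr i)
        (inp i) (out i)) := by
  let acc : ι → ℕ → ℕ := fun i k =>
    (c i).M + ∑ b ∈ Finset.range k, regs (arr i) b * (c i).B ^ b
  let st : ι → ℕ → State := fun i k => cfg { c i with M := acc i k }
    (S i :: 0 :: 0 :: k :: (c i).B ^ k :: 0 :: 0 :: 0 :: 0 :: 0 :: 0 :: 0 :: 0 :: arr i)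
    (inp i) (out i)
  have ha1 := ha.add (PolyBounded.const 1)
  refine Runs.seq ((Runs.block _).congr (fun i => rfl) fun i => rfl)
    (Runs.seq (s' := fun i => st i ((c i).a + 1))
    ((Runs.loop (fun i => (c i).a + 1) st ha1 ?_ ?_ ?_ ?_).congr (fun i => rfl) fun i => rfl)
    ((Runs.block _).congr (fun i => rfl) fun i => rfl))
  · intro i k hk
    exact (Nat.sub_pos_of_lt hk).ne'
  · intro i
    exact Nat.sub_self _
  · intro h
    have hBb := h.mem fun _ => 7
    have hMb := h.mem fun _ => 9
    have hk := ha1.num_succ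
    have hacc : PolyBits (fun x : Below fun i => (c i).a + 1 + 1 => sz x.idx)
        fun x => acc x.idx x.num :=
      (hMb.comp Below.idx).add (PolyBits.partial_sum ha1
        (φ := fun i b => regs (arr i) b * (c i).B ^ b) <|
        ((hw.comp Below.idx).mul ((hBb.comp Below.idx).pow ha1.num)).mono fun x =>
          Nat.mul_le_mul_right _ (harr _ _))
    exact (((h.loopHead _).set 9 hacc).set 14 hk.bits).set 15 ((hBb.comp Below.idx).pow hk)
  · refine (Runs.block _).congr (fun i => rfl) fun i => ?_
    simp only [st, acc, cfg, runBlock, put, val_add, val_mul, val_load, val_const, val_reg,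
      val_one, regs_zero, regs_succ, pow_succ, Finset.sum_range_succ, add_assoc]

/-- The exponent of `B` in the encoding of the monomial whose exponents are stored at register 16. -/
def exponentExpr : ℕ → Expr
  | 0 => 0
  | i + 1 => exponentExpr i + .load (reg 16 + .const i + .const 24) * powExpr (reg 4) (i + 1)

/-- The Kronecker exponent of a stored monomial. -/
def codeExponent (n E : ℕ) (arr : List ℕ) (r : ℕ) : ℕ :=
  ∑ i ∈ Finset.range n, regs arr (r + i) * E ^ (i + 1)

theorem val_exponentExpr {M : ℕ → ℕ} {arr : List ℕ} (h : ∀ k, M (k + 24) = regs arr k) (n : ℕ) :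
    (exponentExpr n).val M = codeExponent n (M 4) arr (M 16) := by
  induction n with
  | zero => rfl
  | succ n ih =>
    rw [exponentExpr, val_add, ih, codeExponent, codeExponent, Finset.sum_range_succ, val_mul,
      val_powExpr, val_load, val_add, val_const, h]
    rfl

/-- Register 8 collects the encoded equation. -/
def equationProg (n : ℕ) : Prog :=
  .seq (.loop (reg 2 - reg 12)
    (.seq (block [(13, exponentExpr n), (15, reg 7)])
    (.seq powProg
    (.seq (block [(15, 0)])
    (.seq (.loop (reg 1 - reg 13) (block
      [(8, reg 8 + .load (reg 16 + .const n + reg 13 + .const 24) * reg 14),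
        (14, reg 14 * reg 7), (13, reg 13 + 1)]))
    (block [(13, 0), (14, 0), (16, reg 16 + (.const n + reg 1)), (12, reg 12 + 1)]))))))
  (block [(12, 0), (16, 0)])

/-- The summand of a stored monomial in the encoded equation. -/
def Consts.equationTerm (n : ℕ) (c : Consts) (arr : List ℕ) (r : ℕ) : ℕ :=
  ∑ b ∈ Finset.range c.a, regs arr (r + n + b) * (c.B ^ codeExponent n c.E arr r * c.B ^ b)

theorem equationProg_runs (n : ℕ) (ha : PolyBounded sz fun i => (c i).a)
    (hcnt : PolyBounded sz fun i => (c i).cnt) (hE : PolyBounded sz fun i => (c i).E)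
    {w : ι → ℕ} (hw : PolyBounded sz w) (harr : ∀ i r, regs (arr i) r ≤ w i) {S : ι → ℕ}
    {r₀ : ι → ℕ} (hr₀ : PolyBounded sz r₀) :
    Runs sz (equationProg n)
      (fun i => cfg (c i) (S i :: 0 :: 0 :: 0 :: 0 :: r₀ i :: 0 :: 0 ::
        0 :: 0 :: 0 :: 0 :: 0 :: arr i) (inp i) (out i))
      (fun i => cfg { c i with
          F := (c i).F + ∑ k ∈ Finset.range (c i).cnt,
            (c i).equationTerm n (arr i) (r₀ i + k * (n + (c i).a)) }
        (S i :: 0 :: 0 :: 0 :: 0 :: 0 :: 0 :: 0 :: 0 :: 0 :: 0 :: 0 :: 0 :: arr i)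
        (inp i) (out i)) := by
  let acc : ι → ℕ → ℕ := fun i k => (c i).F +
    ∑ k ∈ Finset.range k, (c i).equationTerm n (arr i) (r₀ i + k * (n + (c i).a))
  let st : ι → ℕ → State := fun i k => cfg { c i with F := acc i k }
    (S i :: k :: 0 :: 0 :: 0 :: (r₀ i + k * (n + (c i).a)) :: 0 :: 0 :: 0 :: 0 :: 0 :: 0 :: 0 ::
      arr i) (inp i) (out i)
  -- Kronecker exponents are polynomially bounded because n is fixed, so B raised to them has
  -- polynomially many bits.
  have hexp : PolyBounded sz fun i => ∑ j ∈ Finset.range n, w i * (c i).E ^ (j + 1) := by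
    induction n with
    | zero => exact PolyBounded.const 0
    | succ n ih =>
      simp only [Finset.sum_range_succ]
      exact ih.add (hw.mul (hE.pow _))
  have hcode : ∀ i r, codeExponent n (c i).E (arr i) r ≤
      ∑ j ∈ Finset.range n, w i * (c i).E ^ (j + 1) := fun i r =>
    Finset.sum_le_sum fun j _ => Nat.mul_le_mul_right _ (harr _ _)
  refine Runs.seq (s' := fun i => st i (c i).cnt)
    ((Runs.loop (fun i => (c i).cnt) st hcnt ?_ ?_ ?_ ?_).congr (fun i => ?_) fun i => rfl)
    ((Runs.block _).congr (fun i => rfl) fun i => rfl)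
  · intro i k hk
    exact (Nat.sub_pos_of_lt hk).ne'
  · intro i
    exact Nat.sub_self _
  · intro h
    have hBb := h.mem fun _ => 7
    have hFb := h.mem fun _ => 8
    have hk := hcnt.num_succ
    have hacc : PolyBits (fun x : Below fun i => (c i).cnt + 1 => sz x.idx)
        fun x => acc x.idx x.num := by
      refine (hFb.comp Below.idx).add (PolyBits.partial_sum hcnt
        (φ := fun i k => (c i).equationTerm n (arr i) (r₀ i + k * (n + (c i).a))) ?_)
      -- The base 1 + B replaces B, since monotonicity in the exponent needs a positive base and B
      -- is arbitrary here.
      have hone : PolyBits sz fun i => 1 + (c i).B := (PolyBits.const 1).add hBb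
      have hbd := hw.bits.mul ((hone.pow hexp).mul (hone.pow ha))
      refine ((ha.bits.mul hbd).comp Below.idx).mono fun x => ?_
      refine (Finset.sum_le_card_nsmul _ _ (w x.idx * ((1 + (c x.idx).B) ^
        (∑ j ∈ Finset.range n, w x.idx * (c x.idx).E ^ (j + 1)) *
          (1 + (c x.idx).B) ^ (c x.idx).a)) fun b hb => ?_).trans (by simp)
      refine Nat.mul_le_mul (harr _ _) (Nat.mul_le_mul ?_ ?_)
      · exact (Nat.pow_le_pow_left (Nat.le_add_left _ 1) _).trans
          (Nat.pow_le_pow_right (by omega) (hcode _ _))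
      · exact (Nat.pow_le_pow_left (Nat.le_add_left _ 1) _).trans
          (Nat.pow_le_pow_right (by omega) (Finset.mem_range.1 hb).le)
    exact (((h.loopHead _).set 8 hacc).set 12 hk.bits).set 16 ((hr₀.comp Below.idx).add
      (hk.mul (((PolyBounded.const n).add ha).comp Below.idx))).bits
  · have ha' := ha.comp (Below.idx (T := fun i => (c i).cnt))
    let acc' (x : Below fun i => (c i).cnt) (k : ℕ) : ℕ := acc x.idx x.num +
      ∑ b ∈ Finset.range k, regs (arr x.idx) (r₀ x.idx + x.num * (n + (c x.idx).a) + n + b) *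
        ((c x.idx).B ^ codeExponent n (c x.idx).E (arr x.idx)
          (r₀ x.idx + x.num * (n + (c x.idx).a)) * (c x.idx).B ^ b)
    let st' (x : Below fun i => (c i).cnt) (k : ℕ) : State :=
      cfg { c x.idx with F := acc' x k }
        (S x.idx :: x.num :: k :: ((c x.idx).B ^ codeExponent n (c x.idx).E (arr x.idx)
          (r₀ x.idx + x.num * (n + (c x.idx).a)) * (c x.idx).B ^ k) :: 0 ::
          (r₀ x.idx + x.num * (n + (c x.idx).a)) :: 0 :: 0 :: 0 :: 0 :: 0 :: 0 :: 0 ::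
          arr x.idx) (inp x.idx) (out x.idx)
    refine Runs.seq (Runs.block _) (Runs.seq
      ((powProg_runs (c := fun x => { c x.idx with F := acc x.idx x.num })
        (e := fun x => codeExponent n (c x.idx).E (arr x.idx)
          (r₀ x.idx + x.num * (n + (c x.idx).a))) (b := fun x => (c x.idx).B) (y := fun _ => 0)
        (S := fun x => S x.idx) (x₁₂ := fun x => x.num) (arr := fun x =>
          (r₀ x.idx + x.num * (n + (c x.idx).a)) :: 0 :: 0 :: 0 :: 0 :: 0 :: 0 :: 0 :: arr x.idx)
        (inp := fun x => inp x.idx) (out := fun x => out x.idx) ?_).congr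
        (fun x => ?_) fun x => rfl)
      (Runs.seq ((Runs.block _).congr (fun x => rfl) fun x => rfl) (Runs.seq
        (s' := fun x => st' x (c x.idx).a)
        ((Runs.loop (fun x => (c x.idx).a) st' ha' ?_ ?_ ?_ ?_).congr (fun x => ?_) fun x => rfl)
        ((Runs.block _).congr (fun x => rfl) fun x => ?_))))
    · exact (hexp.comp Below.idx).mono fun x => hcode _ _
    · simp only [runBlock, put, cfg]
      rw [val_exponentExpr (arr := arr x.idx) fun _ => rfl]
      rfl
    · intro x k hk
      exact (Nat.sub_pos_of_lt hk).ne'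
    · intro x
      exact Nat.sub_self _
    · intro h
      have hBb := h.mem fun _ => 7
      have hFb := h.mem fun _ => 8
      have hPb := h.mem fun _ => 14
      have hk := ha'.num_succ
      -- Cell 14 at round 0 holds the monomial's power of B times B^0; its bit bound is inherited
      -- from the state before the loop.
      have hPb' : PolyBits (fun x : Below fun i => (c i).cnt => sz x.idx) fun x =>
          (c x.idx).B ^ codeExponent n (c x.idx).E (arr x.idx)
            (r₀ x.idx + x.num * (n + (c x.idx).a)) :=
        hPb.mono fun x => by
          change _ ≤ _ * (c x.idx).B ^ 0
          rw [pow_zero, mul_one]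
      have hacc : PolyBits (fun x : Below fun x : Below (fun i => (c i).cnt) => (c x.idx).a + 1 =>
          sz x.idx.idx) fun x => acc' x.idx x.num := by
        refine PolyBits.add ?_ (PolyBits.partial_sum ha' (φ := fun x b => regs (arr x.idx)
          (r₀ x.idx + x.num * (n + (c x.idx).a) + n + b) *
          ((c x.idx).B ^ codeExponent n (c x.idx).E (arr x.idx)
          (r₀ x.idx + x.num * (n + (c x.idx).a)) * (c x.idx).B ^ b)) ?_)
        · exact (hFb.comp Below.idx).mono fun x => Nat.le_add_right _ _
        · exact (((hw.bits.comp Below.idx).comp Below.idx).mul ((hPb'.comp Below.idx).mul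
            ((hBb.comp Below.idx).pow ha'.num))).mono fun x =>
              Nat.mul_le_mul_right _ (harr _ _)
      exact (((h.loopHead _).set 8 hacc).set 13 hk.bits).set 14 ((hPb'.comp Below.idx).mul
        ((hBb.comp Below.idx).pow hk))
    · refine (Runs.block _).congr (fun i => rfl) fun i => ?_
      simp only [st', acc', cfg, runBlock, put, val_add, val_mul, val_load, val_const, val_reg,
        val_one, regs_zero, regs_succ, pow_succ, Finset.sum_range_succ]
      simp only [add_assoc, mul_assoc]
    · simp only [st', acc', pow_zero, mul_one, Finset.sum_range_zero, add_zero]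
      rfl
    · simp only [st, acc', acc, cfg, runBlock, put, val_add, val_const, val_reg, val_zero,
        val_one, regs_zero, regs_succ, Finset.sum_range_succ, Consts.equationTerm, add_assoc,
        Nat.succ_mul]
  · simp only [st, acc, Finset.sum_range_zero, add_zero, zero_mul]

end RAM

/-! ### Parameters, output and the whole program -/

namespace RAM

variable {ι : Type} {sz : ι → ℕ} {c : ι → Consts} {inp out arr : ι → List ℕ}

/-- Reads the input. -/
def loadProg (n : ℕ) : Prog :=
  .seq (.read (.const 0)) (.seq (.read (.const 12)) (.seq (block [(1, reg 12 - 1)])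
  (.seq readProg (.seq (.read (.const 2)) (.seq (block [(12, reg 2 * (.const n + reg 1))])
  readProg)))))

theorem loadProg_runs (n : ℕ) {p a cnt : ι → ℕ} {u v : ι → List ℕ} (ha : PolyBounded sz a)
    (hcnt : PolyBounded sz cnt) (hu : ∀ i, (u i).length = a i + 1)
    (hv : ∀ i, (v i).length = cnt i * (n + a i)) (hus : PolyBounded sz fun i => (u i).sum)
    (hvs : PolyBounded sz fun i => (v i).sum) :
    Runs sz (loadProg n)
      (fun i => cfg ⟨0, 0, 0, 0, 0, 0, 0, 0, 0, 0, 0⟩ (0 :: 0 :: 0 :: 0 :: 0 :: 0 :: 0 :: 0 ::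
        0 :: 0 :: 0 :: 0 :: 0 :: []) (p i :: (a i + 1) :: (u i ++ cnt i :: v i)) (out i))
      (fun i => cfg ⟨p i, a i, cnt i, (u i).sum + (v i).sum, 0, 0, 0, 0, 0, 0, 0⟩
        (0 :: 0 :: (u i ++ v i).length :: 0 :: 0 :: 0 :: 0 :: 0 ::
        0 :: 0 :: 0 :: 0 :: 0 :: (u i ++ v i)) [] (out i)) := by
  have hul : PolyBounded sz fun i => (u i).length := by
    simp only [hu]
    exact ha.add (PolyBounded.const 1)
  have hvl : PolyBounded sz fun i => (v i).length := by
    simp only [hv]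
    exact hcnt.mul ((PolyBounded.const n).add ha)
  refine Runs.seq ((Runs.read _).congr (fun i => rfl) fun i => rfl)
    (Runs.seq ((Runs.read _).congr (fun i => rfl) fun i => rfl)
    (Runs.seq ((Runs.block _).congr (fun i => rfl) fun i => rfl)
    (Runs.seq ((readProg_runs (c := fun i => ⟨p i, a i, 0, 0, 0, 0, 0, 0, 0, 0, 0⟩)
      (arr := fun _ => []) (u := u) (rest := fun i => cnt i :: v i) (S := fun _ => 0)
      (out := out) hul hus.bits (PolyBits.const 0)).congr (fun i => ?_) fun i => rfl)
    (Runs.seq ((Runs.read _).congr (fun i => rfl) fun i => rfl)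
    (Runs.seq ((Runs.block _).congr (fun i => rfl) fun i => rfl)
    ((readProg_runs (c := fun i => ⟨p i, a i, cnt i, (u i).sum, 0, 0, 0, 0, 0, 0, 0⟩)
      (arr := u) (u := v) (rest := fun _ => []) (S := fun _ => 0)
      (out := out) hvl hvs.bits hul.bits).congr (fun i => ?_) fun i => rfl))))))
  · simp only [hu]
    rfl
  · simp only [hv, List.append_nil]
    simp only [cfg, runBlock, put, val_add, val_mul, val_const, val_reg, regs_zero, regs_succ,
      List.headD_cons, List.tail_cons, List.nil_append, zero_add]

/-- Computes the parameters. -/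
def paramProg (n : ℕ) : Prog :=
  .seq (block [(3, reg 3 + (reg 1 + reg 1 + .const 2)), (4, reg 0 * (reg 3 + 1)),
    (5, powExpr (reg 4) (n + 1)), (6, reg 1 * reg 5),
    (13, .const 2 * reg 0 * (reg 6 + 1) + .const 3), (15, reg 5)])
  (.seq powProg (block [(7, reg 14), (14, 0), (15, 0)]))

theorem paramProg_runs (n : ℕ) {p a cnt D₀ D E J K B x : ι → ℕ} (hp : PolyBounded sz p)
    (hKb : PolyBounded sz K) (hD : ∀ i, D i = D₀ i + (a i + a i + 2))
    (hE : ∀ i, E i = p i * (D i + 1)) (hJ : ∀ i, J i = E i ^ (n + 1))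
    (hK : ∀ i, K i = a i * J i) (hB : ∀ i, B i = J i ^ (2 * p i * (K i + 1) + 3)) :
    Runs sz (paramProg n)
      (fun i => cfg ⟨p i, a i, cnt i, D₀ i, 0, 0, 0, 0, 0, 0, 0⟩ (0 :: 0 :: x i :: 0 :: 0 :: 0 ::
        0 :: 0 :: 0 :: 0 :: 0 :: 0 :: 0 :: arr i) (inp i) (out i))
      (fun i => cfg ⟨p i, a i, cnt i, D i, E i, J i, K i, B i, 0, 0, 0⟩ (0 :: 0 :: 0 :: 0 :: 0 ::
        0 :: 0 :: 0 :: 0 :: 0 :: 0 :: 0 :: 0 :: arr i) (inp i) (out i)) := by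
  refine Runs.seq ((Runs.block _).congr (fun i => rfl) fun i => rfl) (Runs.seq
    ((powProg_runs (c := fun i => ⟨p i, a i, cnt i, D i, E i, J i, K i, 0, 0, 0, 0⟩)
      (e := fun i => 2 * p i * (K i + 1) + 3) (b := J) (S := fun _ => 0) (x₁₂ := fun _ => 0)
      (y := fun _ => 0)
      (arr := fun i => 0 :: 0 :: 0 :: 0 :: 0 :: 0 :: 0 :: 0 :: arr i) (inp := inp) (out := out)
      ((((PolyBounded.const 2).mul hp).mul (hKb.add (PolyBounded.const 1))).add
        (PolyBounded.const 3))).congr (fun i => ?_) fun i => rfl)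
    ((Runs.block _).congr (fun i => rfl) fun i => ?_))
  · simp only [cfg, runBlock, put, val_add, val_mul, val_const, val_reg, val_one, val_powExpr,
      regs_zero, regs_succ, hK, hJ, hE, hD]
  · simp only [cfg, runBlock, put, val_reg, val_zero, regs_zero, regs_succ, hB]

/-- Raises the encoded equations and the base to the powers that are needed later. -/
def powersProg : Prog :=
  .seq (block [(9, reg 9 * reg 8), (13, reg 0 - 1), (15, reg 8)]) (.seq powProg
  (.seq (block [(8, reg 14), (13, reg 0 - 1), (15, reg 9)]) (.seq powProg
  (.seq (block [(9, reg 14), (13, reg 0), (15, reg 7)]) (.seq powProg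
  (block [(10, reg 14), (14, 0), (15, 0)]))))))

theorem powersProg_runs {p a cnt D E J K B F M : ι → ℕ} (hp : PolyBounded sz p) :
    Runs sz powersProg
      (fun i => cfg ⟨p i, a i, cnt i, D i, E i, J i, K i, B i, F i, M i, 0⟩ (0 :: 0 :: 0 :: 0 :: 0 ::
        arr i) (inp i) (out i))
      (fun i => cfg ⟨p i, a i, cnt i, D i, E i, J i, K i, B i, F i ^ (p i - 1),
        (M i * F i) ^ (p i - 1), B i ^ p i⟩ (0 :: 0 :: 0 :: 0 :: 0 :: arr i) (inp i) (out i)) := by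
  have hp' : PolyBounded sz fun i => p i - 1 := hp.mono fun i => Nat.sub_le _ _
  exact Runs.seq ((Runs.block _).congr (fun i => rfl) fun i => rfl) (Runs.seq
    ((powProg_runs
      (c := fun i => ⟨p i, a i, cnt i, D i, E i, J i, K i, B i, F i, M i * F i, 0⟩)
      (b := F) (S := fun _ => 0) (x₁₂ := fun _ => 0) (y := fun _ => 0) (arr := arr)
      (inp := inp) (out := out) hp').congr (fun i => rfl) fun i => rfl)
    (Runs.seq ((Runs.block _).congr (fun i => rfl) fun i => rfl) (Runs.seq
    ((powProg_runs
      (c := fun i => ⟨p i, a i, cnt i, D i, E i, J i, K i, B i, F i ^ (p i - 1), M i * F i, 0⟩)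
      (b := fun i => M i * F i) (S := fun _ => 0) (x₁₂ := fun _ => 0)
      (y := fun i => F i ^ (p i - 1)) (arr := arr)
      (inp := inp) (out := out) hp').congr (fun i => rfl) fun i => rfl)
    (Runs.seq ((Runs.block _).congr (fun i => rfl) fun i => rfl) (Runs.seq
    ((powProg_runs
      (c := fun i => ⟨p i, a i, cnt i, D i, E i, J i, K i, B i, F i ^ (p i - 1),
        (M i * F i) ^ (p i - 1), 0⟩)
      (b := B) (S := fun _ => 0) (x₁₂ := fun _ => 0) (y := fun i => (M i * F i) ^ (p i - 1))
      (arr := arr) (inp := inp) (out := out) hp).congr (fun i => rfl) fun i => rfl)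
    ((Runs.block _).congr (fun i => rfl) fun i => rfl))))))

/-- The largest `j < k` with `φ j ≠ 0`, or `0`. -/
def lastNonzero (φ : ℕ → ℕ) : ℕ → ℕ
  | 0 => 0
  -- Truncated subtraction serves as a conditional: 1 - (1 - x) is 1 for x ≠ 0 and 0 for x = 0.
  | k + 1 => (1 - (1 - φ k)) * k + (1 - (1 - (1 - φ k))) * lastNonzero φ k

theorem lastNonzero_le (φ : ℕ → ℕ) (k : ℕ) : lastNonzero φ k ≤ k := by
  induction k with
  | zero => exact le_rfl
  | succ k ih =>
    rw [lastNonzero]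
    rcases Nat.eq_zero_or_pos (φ k) with h | h
    · rw [h]
      omega
    · rw [Nat.sub_eq_zero_of_le h]
      omega

/-- The output: a polynomial that is known by a sequence of coefficients. -/
def digitWord (φ : ℕ → ℕ) (J : ℕ) : List ℕ :=
  (lastNonzero φ (J + 1) + 1) :: (List.range (lastNonzero φ (J + 1) + 1)).map φ

/-- Writes the digits of register 14 at the multiples of register 1, modulo register 0. -/
def outProg : Prog :=
  .seq (block [(17, reg 14), (13, reg 1), (15, reg 7)]) (.seq powProg
  (.seq (block [(15, reg 14), (14, reg 17), (17, 0), (13, 1)])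
  (.seq (.loop (reg 5 + 1 - reg 12) (block
    [(17, 1 - (1 - reg 14 / reg 13 % reg 7 % reg 0)),
      (16, reg 17 * reg 12 + (1 - reg 17) * reg 16), (17, 0),
      (13, reg 13 * reg 15), (12, reg 12 + 1)]))
  (.seq (block [(12, 0), (13, 1), (16, reg 16 + 1)])
  (.seq (.write (reg 16))
  (.loop (reg 16 - reg 12) (.seq (.write (reg 14 / reg 13 % reg 7 % reg 0))
    (block [(13, reg 13 * reg 15), (12, reg 12 + 1)]))))))))

theorem Bdd.changeOut {s : ι → State} (h : Bdd sz s) (out : ι → List ℕ) :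
    Bdd sz fun i => ⟨(s i).mem, (s i).inp, out i⟩ := h

theorem outProg_runs (ha : PolyBounded sz fun i => (c i).a)
    (hJ : PolyBounded sz fun i => (c i).J) {S H : ι → ℕ} :
    ∃ l : ι → List ℕ, Runs sz outProg
      (fun i => cfg (c i) (S i :: 0 :: 0 :: H i :: 0 :: 0 :: 0 :: arr i) (inp i) (out i))
      (fun i => ⟨regs (l i), inp i, out i ++
        digitWord (fun j => H i / (c i).B ^ ((c i).a * j) % (c i).B % (c i).p) (c i).J⟩) := by
  let φ : ι → ℕ → ℕ := fun i j => H i / ((c i).B ^ (c i).a) ^ j % (c i).B % (c i).p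
  have hφ : ∀ i, (fun j => H i / (c i).B ^ ((c i).a * j) % (c i).B % (c i).p) = φ i := by
    intro i
    simp only [φ, pow_mul]
  simp only [hφ]
  -- The first pass records in cell 16 the last nonzero digit seen, because the output must begin
  -- with the number of coefficients. A second pass then writes the digits.
  let st : ι → ℕ → State := fun i k => cfg (c i) (S i :: k :: ((c i).B ^ (c i).a) ^ k :: H i ::
    (c i).B ^ (c i).a :: lastNonzero (φ i) k :: 0 :: arr i) (inp i) (out i)
  let L : ι → ℕ := fun i => lastNonzero (φ i) ((c i).J + 1) + 1
  let mem' : ι → ℕ → List ℕ := fun i k => (c i).p :: (c i).a :: (c i).cnt :: (c i).D :: (c i).E ::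
    (c i).J :: (c i).K :: (c i).B :: (c i).F :: (c i).M :: (c i).C :: S i :: k ::
    ((c i).B ^ (c i).a) ^ k :: H i :: (c i).B ^ (c i).a :: L i :: 0 :: arr i
  let st' : ι → ℕ → State := fun i k => ⟨regs (mem' i k), inp i,
    out i ++ L i :: (List.range k).map (φ i)⟩
  have hJ1 := hJ.add (PolyBounded.const 1)
  have hL : PolyBounded sz L := (hJ1.add (PolyBounded.const 1)).mono fun i =>
    Nat.succ_le_succ (lastNonzero_le _ _)
  refine ⟨fun i => mem' i (L i), Runs.seq ((Runs.block _).congr (fun i => rfl) fun i => rfl)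
    (Runs.seq ((powProg_runs (c := c) (e := fun i => (c i).a) (b := fun i => (c i).B) (S := S)
      (x₁₂ := fun _ => 0) (y := H) (arr := fun i => 0 :: H i :: arr i) (inp := inp)
      (out := out) ha).congr (fun i => rfl) fun i => rfl)
    (Runs.seq ((Runs.block _).congr (fun i => rfl) fun i => rfl)
    (Runs.seq (s' := fun i => st i ((c i).J + 1))
      ((Runs.loop (fun i => (c i).J + 1) st hJ1 ?_ ?_ ?_ ?_).congr (fun i => rfl) fun i => rfl)
    (Runs.seq ((Runs.block _).congr (fun i => rfl) fun i => rfl)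
    (Runs.seq ((Runs.write _).congr (fun i => rfl) fun i => rfl)
      ((Runs.loop L st' hL ?_ ?_ ?_ ?_).congr (fun i => rfl) fun i => rfl))))))⟩
  · intro i k hk
    exact (Nat.sub_pos_of_lt hk).ne'
  · intro i
    exact Nat.sub_self _
  · intro h
    have hPb := h.mem fun _ => 15
    have hk := hJ1.num_succ
    exact (((h.loopHead _).set 12 hk.bits).set 13 ((hPb.comp Below.idx).pow hk)).set 16
      (hk.bits.mono fun x => lastNonzero_le _ _)
  · refine (Runs.block _).congr (fun i => rfl) fun i => ?_
    simp only [st, cfg, runBlock, put, val_add, val_sub, val_mul, val_div, val_mod, val_reg,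
      val_zero, val_one, regs_zero, regs_succ, pow_succ, lastNonzero, φ]
  · intro i k hk
    exact (Nat.sub_pos_of_lt hk).ne'
  · intro i
    exact Nat.sub_self _
  · intro h
    have hPb := h.mem fun _ => 15
    have hk := hL.num_succ
    exact (((h.loopHead _).set 12 hk.bits).set 13 ((hPb.comp Below.idx).pow hk)).changeOut _
  · refine Runs.seq ((Runs.write _).congr (fun i => rfl) fun i => rfl)
      ((Runs.block _).congr (fun i => rfl) fun i => ?_)
    simp only [st', mem', runBlock, put, val_add, val_mul, val_div, val_mod, val_reg,
      val_one, regs_zero, regs_succ, pow_succ, φ, List.range_succ, List.map_append, List.map_cons,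
      List.map_nil, List.append_assoc, List.cons_append]

/-- The whole computation. -/
def mainProg (n : ℕ) : Prog :=
  .seq (loadProg n) (.seq (paramProg n) (.seq modulusProg (.seq (block [(16, reg 1 + 1)])
  (.seq (equationProg n) (.seq powersProg (.seq (traceProg n) (.seq expProg outProg)))))))

theorem regs_le_sum (l : List ℕ) (r : ℕ) : regs l r ≤ l.sum := by
  rcases lt_or_ge r l.length with h | h
  · rw [regs, List.getD_eq_getElem _ _ h]
    exact List.le_sum_of_mem (List.getElem_mem h)
  · rw [regs, List.getD_eq_default _ _ h]
    exact Nat.zero_le _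

theorem mainProg_runs (n : ℕ) {p a cnt D E J K B F M : ι → ℕ} {u v : ι → List ℕ}
    (hp : PolyBounded sz p) (hp1 : ∀ i, 1 ≤ p i) (ha : PolyBounded sz a)
    (hcnt : PolyBounded sz cnt) (hu : ∀ i, (u i).length = a i + 1)
    (hv : ∀ i, (v i).length = cnt i * (n + a i)) (hus : PolyBounded sz fun i => (u i).sum)
    (hvs : PolyBounded sz fun i => (v i).sum)
    (hD : ∀ i, D i = (u i).sum + (v i).sum + (a i + a i + 2))
    (hE : ∀ i, E i = p i * (D i + 1)) (hJ : ∀ i, J i = E i ^ (n + 1))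
    (hK : ∀ i, K i = a i * J i) (hB : ∀ i, B i = J i ^ (2 * p i * (K i + 1) + 3))
    (hM : ∀ i, M i = ∑ b ∈ Finset.range (a i + 1), regs (u i ++ v i) b * B i ^ b)
    (hF : ∀ i, F i = ∑ k ∈ Finset.range (cnt i), ∑ b ∈ Finset.range (a i),
      regs (u i ++ v i) (a i + 1 + k * (n + a i) + n + b) *
        (B i ^ codeExponent n (E i) (u i ++ v i) (a i + 1 + k * (n + a i)) * B i ^ b)) :
    ∃ l : ι → List ℕ, Runs sz (mainProg n)
      (fun i => ⟨regs [], p i :: (a i + 1) :: (u i ++ cnt i :: v i), out i⟩)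
      (fun i => ⟨regs (l i), [], out i ++ digitWord (fun j =>
        expNum (B i) (traceNum n (D i) (E i) (B i) (p i) (K i) (F i ^ (p i - 1))
          ((M i * F i) ^ (p i - 1))) (K i) / B i ^ (a i * j) % B i % p i) (J i)⟩) := by
  have hDb : PolyBounded sz D := ((hus.add hvs).add ((ha.add ha).add (PolyBounded.const 2))).mono
    fun i => (hD i).le
  have hEb : PolyBounded sz E := (hp.mul (hDb.add (PolyBounded.const 1))).mono fun i => (hE i).le
  have hJb : PolyBounded sz J := (hEb.pow (n + 1)).mono fun i => (hJ i).le
  have hKb : PolyBounded sz K := (ha.mul hJb).mono fun i => (hK i).le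
  have hB1 : ∀ i, 1 ≤ B i := by
    intro i
    rw [hB, hJ, hE]
    exact Nat.one_le_pow _ _ (Nat.pow_pos (Nat.mul_pos (hp1 i) (Nat.succ_pos _)))
  have hreg : ∀ i r, regs (u i ++ v i) r ≤ D i := fun i r => by
    refine (regs_le_sum _ r).trans ?_
    rw [hD, List.sum_append]
    exact Nat.le_add_right _ _
  obtain ⟨l, hl⟩ := outProg_runs (sz := sz) (c := fun i => ⟨p i, a i, cnt i, D i, E i, J i, K i, B i,
    F i ^ (p i - 1), (M i * F i) ^ (p i - 1), B i ^ p i⟩)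
    (S := fun i => traceNum n (D i) (E i) (B i) (p i) (K i) (F i ^ (p i - 1))
      ((M i * F i) ^ (p i - 1)))
    (H := fun i => expNum (B i) (traceNum n (D i) (E i) (B i) (p i) (K i) (F i ^ (p i - 1))
      ((M i * F i) ^ (p i - 1))) (K i))
    (arr := fun i => 0 :: 0 :: 0 :: 0 :: 0 :: 0 :: (u i ++ v i)) (inp := fun _ => []) (out := out)
    ha hJb
  refine ⟨l, Runs.seq ((loadProg_runs n (out := out) ha hcnt hu hv hus hvs).congr
    (fun i => ?_) fun i => rfl) (Runs.seq ((paramProg_runs n (D := D) (E := E) (J := J) (K := K)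
      (B := B) hp hKb hD hE hJ hK hB).congr (fun i => rfl) fun i => rfl)
    (Runs.seq ((modulusProg_runs
      (c := fun i => ⟨p i, a i, cnt i, D i, E i, J i, K i, B i, 0, 0, 0⟩) ha hDb.bits hreg).congr
      (fun i => rfl) fun i => rfl)
    (Runs.seq (s' := fun i => cfg ⟨p i, a i, cnt i, D i, E i, J i, K i, B i, 0, M i, 0⟩
        (0 :: 0 :: 0 :: 0 :: 0 :: (a i + 1) :: 0 :: 0 :: 0 :: 0 :: 0 :: 0 :: 0 :: (u i ++ v i))
        [] (out i)) ((Runs.block _).congr (fun i => rfl) fun i => ?_)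
    (Runs.seq (s' := fun i => cfg ⟨p i, a i, cnt i, D i, E i, J i, K i, B i, F i, M i, 0⟩
        (0 :: 0 :: 0 :: 0 :: 0 :: 0 :: 0 :: 0 :: 0 :: 0 :: 0 :: 0 :: 0 :: (u i ++ v i))
        [] (out i)) ((equationProg_runs n
      (c := fun i => ⟨p i, a i, cnt i, D i, E i, J i, K i, B i, 0, M i, 0⟩) ha hcnt hEb hDb hreg
      (ha.add (PolyBounded.const 1))).congr (fun i => rfl) fun i => ?_)
    (Runs.seq (powersProg_runs hp)
    (Runs.seq (traceProg_runs n hJb hKb hJ (fun i => rfl) hB1)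
    (Runs.seq (expProg_runs hKb hB1) hl)))))))⟩
  -- Empty memory and a memory listing 24 zeros agree cell by cell, as cells beyond a list read as
  -- 0.
  · simp only [cfg]
    congr 1
    funext r
    rcases lt_or_ge r 24 with h | h
    · interval_cases r <;> rfl
    · obtain ⟨r, rfl⟩ := Nat.exists_eq_add_of_le' h
      rfl
  · simp only [cfg, runBlock, put, val_add, val_reg, val_one, regs_zero, regs_succ, zero_add, hM]
  · simp only [Consts.equationTerm, zero_add, hF]

end RAM

/-! ### Words, lists and the output format -/

section Words

theorem sum_map_range (φ : ℕ → ℕ) (k : ℕ) :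
    ((List.range k).map φ).sum = ∑ j ∈ Finset.range k, φ j := by
  induction k with
  | zero => rfl
  | succ k ih => simp [List.range_succ, Finset.sum_range_succ, ih]

theorem sum_range_length_eq {α : Type*} (L : List α) (φ : α → ℕ) (ψ : ℕ → ℕ)
    (h : ∀ k (hk : k < L.length), ψ k = φ L[k]) :
    ∑ k ∈ Finset.range L.length, ψ k = (L.map φ).sum := by
  induction L generalizing ψ with
  | nil => rfl
  | cons x L ih =>
    rw [List.length_cons, Finset.sum_range_succ', List.map_cons, List.sum_cons, add_comm,
      h 0 (by simp), ih (fun k => ψ (k + 1)) fun k hk => h (k + 1) (by simpa using hk)]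
    rfl

theorem length_flatMap_const {α : Type*} (L : List α) (g : α → List ℕ) {w : ℕ}
    (hg : ∀ x, (g x).length = w) : (L.flatMap g).length = L.length * w := by
  induction L with
  | nil => simp
  | cons x L ih => rw [List.flatMap_cons, List.length_append, ih, hg, List.length_cons]; ring

theorem le_sum_flatMap {α : Type*} (L : List α) (g : α → List ℕ) (φ : α → ℕ)
    (h : ∀ x, φ x ≤ (g x).sum) : (L.map φ).sum ≤ (L.flatMap g).sum := by
  induction L with
  | nil => simp
  | cons x L ih =>
    rw [List.flatMap_cons, List.sum_append, List.map_cons, List.sum_cons]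
    exact add_le_add (h x) ih

theorem polyWord_one (p : ℕ) [Fact p.Prime] : polyWord (1 : (ZMod p)[X]) = [1, 1] := by
  simp [polyWord, ZMod.val_one]

namespace RAM

theorem regs_append_left (u v : List ℕ) {r : ℕ} (hr : r < u.length) :
    regs (u ++ v) r = regs u r := by
  simp [regs, List.getElem?_append_left hr]

theorem regs_append_right (u v : List ℕ) (r : ℕ) : regs (u ++ v) (u.length + r) = regs v r := by
  simp [regs, List.getElem?_append_right]

theorem regs_flatMap {α : Type*} (L : List α) (g : α → List ℕ) {w : ℕ}
    (hg : ∀ x, (g x).length = w) (k : ℕ) (hk : k < L.length) {r : ℕ} (hr : r < w) :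
    regs (L.flatMap g) (k * w + r) = regs (g L[k]) r := by
  induction L generalizing k with
  | nil => simp at hk
  | cons x L ih =>
    rw [List.flatMap_cons]
    cases k with
    | zero =>
      rw [zero_mul, zero_add, regs_append_left _ _ (hg x ▸ hr)]
      rfl
    | succ k =>
      rw [show (k + 1) * w + r = (g x).length + (k * w + r) by rw [hg]; ring, regs_append_right,
        ih k (by simpa using hk)]
      rfl

theorem regs_map_range (φ : ℕ → ℕ) {k r : ℕ} (hr : r < k) :
    regs ((List.range k).map φ) r = φ r := by
  simp [regs, hr]

theorem regs_ofFn {n : ℕ} (φ : Fin n → ℕ) (i : Fin n) : regs (List.ofFn φ) i = φ i := by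
  simp [regs]

/-- The alternative d = 0 covers the zero polynomial, whose degree is 0 by convention while its
coefficient there vanishes. -/
theorem lastNonzero_eq {φ : ℕ → ℕ} {d k : ℕ} (hd : d < k) (h0 : d = 0 ∨ φ d ≠ 0)
    (h : ∀ j, d < j → j < k → φ j = 0) : lastNonzero φ k = d := by
  induction k with
  | zero => omega
  | succ k ih =>
    rw [lastNonzero]
    rcases Nat.eq_zero_or_pos (φ k) with hk | hk
    · rw [hk]
      rcases Nat.lt_succ_iff_lt_or_eq.1 hd with hd' | rfl
      · rw [ih hd' fun j h1 h2 => h j h1 (h2.trans (Nat.lt_succ_self k))]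
        omega
      · rcases h0 with rfl | h0
        · simp [lastNonzero]
        · exact absurd hk h0
    · obtain rfl : d = k := by
        by_contra hne
        exact hk.ne' (h k (by omega) (Nat.lt_succ_self k))
      rw [Nat.sub_eq_zero_of_le hk]
      omega

theorem digitWord_eq_polyWord {p : ℕ} [Fact p.Prime] {W : (ZMod p)[X]} {φ : ℕ → ℕ} {J : ℕ}
    (hW : W.natDegree ≤ J) (h : ∀ j ≤ J, (W.coeff j).val = φ j) : digitWord φ J = polyWord W := by
  have hlast : lastNonzero φ (J + 1) = W.natDegree := by
    refine lastNonzero_eq (by omega) ?_ fun j h1 h2 => ?_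
    · by_cases h0 : W = 0
      · left
        rw [h0, Polynomial.natDegree_zero]
      · right
        rw [← h _ hW, Ne, ZMod.val_eq_zero]
        exact Polynomial.leadingCoeff_ne_zero.2 h0
    · rw [← h j (by omega), Polynomial.coeff_eq_zero_of_natDegree_lt h1, ZMod.val_zero]
  rw [digitWord, polyWord, hlast]
  congr 1
  refine List.map_congr_left fun j hj => (h j ?_).symm
  rw [List.mem_range] at hj
  omega

end RAM

end Words

/-! ### The family of all inputs and its size estimates -/

section Instances

open RAM

variable {n : ℕ}

/-- The inputs of the algorithm. -/
structure HypersurfaceInput (n : ℕ) : Type where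
  p : ℕ
  prime : Fact p.Prime
  m : (ZMod p)[X]
  irreducible : Fact (Irreducible m)
  monic : m.Monic
  f : MvPolynomial (Fin n) (AdjoinRoot m)
  L : List (Fin n →₀ ℕ)
  admissible : IsMonomialList f L

namespace HypersurfaceInput

attribute [instance] prime irreducible

/-- The size of an input. -/
noncomputable def size (x : HypersurfaceInput n) : ℕ :=
  x.p * max 1 (x.f.totalDegree.choose n) * Nat.log 2 (x.p ^ x.m.natDegree)

/-- The degree of the field. -/
noncomputable def a (x : HypersurfaceInput n) : ℕ := x.m.natDegree

/-- The coefficients of the modulus. -/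
noncomputable def modulusWord (x : HypersurfaceInput n) : List ℕ :=
  (List.range (x.a + 1)).map fun i => (x.m.coeff i).val

/-- A monomial of the equation. -/
noncomputable def monomialWord (x : HypersurfaceInput n) (e : Fin n →₀ ℕ) : List ℕ :=
  List.ofFn (fun i => e i) ++ elementWord x.monic (x.f.coeff e)

/-- The monomials of the equation. -/
noncomputable def equationWord (x : HypersurfaceInput n) : List ℕ := x.L.flatMap x.monomialWord

theorem word_eq (x : HypersurfaceInput n) : hypersurfaceWord x.monic x.f x.L =
    x.p :: (x.a + 1) :: (x.modulusWord ++ x.L.length :: x.equationWord) := rfl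

theorem a_ne_zero (x : HypersurfaceInput n) : x.a ≠ 0 :=
  natDegree_ne_zero_of_fact_irreducible x.m

theorem length_modulusWord (x : HypersurfaceInput n) : x.modulusWord.length = x.a + 1 := by
  simp [modulusWord]

theorem length_monomialWord (x : HypersurfaceInput n) (e : Fin n →₀ ℕ) :
    (x.monomialWord e).length = n + x.a := by
  simp [monomialWord, elementWord, a]

theorem length_equationWord (x : HypersurfaceInput n) :
    x.equationWord.length = x.L.length * (n + x.a) :=
  length_flatMap_const _ _ x.length_monomialWord

theorem one_le_log (x : HypersurfaceInput n) : 1 ≤ Nat.log 2 (x.p ^ x.m.natDegree) ∧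
    x.a ≤ Nat.log 2 (x.p ^ x.m.natDegree) := by
  have h : x.a ≤ Nat.log 2 (x.p ^ x.m.natDegree) :=
    Nat.le_log_of_pow_le one_lt_two (Nat.pow_le_pow_left x.prime.out.two_le _)
  exact ⟨(Nat.one_le_iff_ne_zero.2 x.a_ne_zero).trans h, h⟩

theorem p_le_size (x : HypersurfaceInput n) : x.p ≤ x.size := by
  rw [size, mul_assoc]
  exact Nat.le_mul_of_pos_right _ (Nat.mul_pos (by omega) x.one_le_log.1)

theorem a_le_size (x : HypersurfaceInput n) : x.a ≤ x.size :=
  x.one_le_log.2.trans (Nat.le_mul_of_pos_left _ (Nat.mul_pos x.prime.out.pos (by omega)))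

theorem add_one_le_choose (hn : 1 ≤ n) (d : ℕ) : d + 1 ≤ (d + n).choose n := by
  induction d with
  | zero => simp
  | succ d ih =>
    obtain ⟨k, rfl⟩ := Nat.exists_eq_add_of_le' hn
    rw [show d + 1 + (k + 1) = d + (k + 1) + 1 by ring, Nat.choose_succ_succ]
    have : 0 < (d + (k + 1)).choose k := Nat.choose_pos (by omega)
    simp only [Nat.succ_eq_add_one] at *
    omega

/-- For d ≥ n ≥ 1 one has d - n + 1 ≤ C(d, n), so the degree is at most the size up to the constant
n. The term n covers d < n. -/
theorem totalDegree_le_size (hn : 1 ≤ n) (x : HypersurfaceInput n) :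
    x.f.totalDegree ≤ x.size + n := by
  have h1 : x.f.totalDegree.choose n ≤ x.size := by
    rw [size, mul_comm x.p, mul_assoc]
    exact (le_max_right 1 _).trans
      (Nat.le_mul_of_pos_right _ (Nat.mul_pos x.prime.out.pos x.one_le_log.1))
  rcases le_total x.f.totalDegree n with h | h
  · omega
  · have h2 := add_one_le_choose hn (x.f.totalDegree - n)
    rw [Nat.sub_add_cancel h] at h2
    omega

theorem exponent_le (x : HypersurfaceInput n) {e : Fin n →₀ ℕ} (he : e ∈ x.L) (i : Fin n) :
    e i ≤ x.f.totalDegree :=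
  (Finsupp.le_degree i e).trans (x.admissible.2.2 e he)

/-- The listed monomials are distinct points of the box [0, d]^n, so for fixed n their number is
polynomial in d. -/
theorem length_le (x : HypersurfaceInput n) : x.L.length ≤ (x.f.totalDegree + 1) ^ n := by
  classical
  rw [← List.toFinset_card_of_nodup x.admissible.1]
  calc x.L.toFinset.card
      ≤ (Fintype.piFinset fun _ : Fin n => Finset.range (x.f.totalDegree + 1)).card := by
        refine Finset.card_le_card_of_injOn (fun e => (e : Fin n → ℕ)) (fun e he => ?_)
          (DFunLike.coe_injective.injOn)
        rw [Finset.mem_coe, Fintype.mem_piFinset]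
        intro i
        rw [Finset.mem_range, Nat.lt_succ_iff]
        exact x.exponent_le (List.mem_toFinset.1 he) i
    _ = (x.f.totalDegree + 1) ^ n := by simp

theorem polyBounded_p : PolyBounded (size (n := n)) p := PolyBounded.size.mono p_le_size

theorem polyBounded_a : PolyBounded (size (n := n)) a := PolyBounded.size.mono a_le_size

theorem polyBounded_totalDegree (hn : 1 ≤ n) :
    PolyBounded (size (n := n)) fun x => x.f.totalDegree :=
  (PolyBounded.size.add (PolyBounded.const n)).mono (totalDegree_le_size hn)

theorem polyBounded_length (hn : 1 ≤ n) : PolyBounded (size (n := n)) fun x => x.L.length :=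
  (((polyBounded_totalDegree hn).add (PolyBounded.const 1)).pow n).mono length_le

theorem polyBounded_sum_modulusWord :
    PolyBounded (size (n := n)) fun x => x.modulusWord.sum := by
  refine ((polyBounded_a.add (PolyBounded.const 1)).mul polyBounded_p).mono fun x => ?_
  refine (List.sum_le_card_nsmul _ x.p fun y hy => ?_).trans_eq ?_
  · obtain ⟨i, -, rfl⟩ := List.mem_map.1 hy
    exact (ZMod.val_lt _).le
  · rw [length_modulusWord, smul_eq_mul]

theorem polyBounded_sum_equationWord (hn : 1 ≤ n) :
    PolyBounded (size (n := n)) fun x => x.equationWord.sum := by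
  refine (((polyBounded_length hn).mul ((PolyBounded.const n).add polyBounded_a)).mul
    ((polyBounded_totalDegree hn).add polyBounded_p)).mono fun x => ?_
  refine (List.sum_le_card_nsmul _ (x.f.totalDegree + x.p) fun y hy => ?_).trans_eq ?_
  · obtain ⟨e, he, hy⟩ := List.mem_flatMap.1 hy
    rcases List.mem_append.1 hy with hy | hy
    · obtain ⟨i, rfl⟩ := List.mem_ofFn.1 hy
      exact (x.exponent_le he i).trans (Nat.le_add_right _ _)
    · obtain ⟨i, -, rfl⟩ := List.mem_map.1 hy
      exact (ZMod.val_lt _).le.trans (Nat.le_add_left _ _)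
  · rw [length_equationWord, smul_eq_mul]

theorem bdd_start (hn : 1 ≤ n) (out : HypersurfaceInput n → List ℕ) :
    Bdd size fun x : HypersurfaceInput n =>
      ⟨regs [], hypersurfaceWord x.monic x.f x.L, out x⟩ := by
  obtain ⟨P, hP⟩ := (polyBounded_p (n := n)).add ((polyBounded_a.add (PolyBounded.const 1)).add
    (polyBounded_sum_modulusWord.add ((polyBounded_length hn).add
      (polyBounded_sum_equationWord hn))))
  refine ⟨P, fun x => ⟨fun r => Nat.two_pow_pos _, fun y hy => ?_⟩⟩
  -- All input entries are even bounded in value by a polynomial in the size, since p itself enters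
  -- the size; their bit lengths are then bounded as well.
  refine lt_of_le_of_lt (le_trans ?_ (hP x)) Nat.lt_two_pow_self
  dsimp only
  simp only [word_eq, List.mem_cons, List.mem_append] at hy
  rcases hy with rfl | rfl | hy | rfl | hy
  · omega
  · omega
  · have := List.le_sum_of_mem hy
    omega
  · omega
  · have := List.le_sum_of_mem hy
    omega

/-- The parameter `D` of the computation. -/
noncomputable def D (x : HypersurfaceInput n) : ℕ :=
  x.modulusWord.sum + x.equationWord.sum + (x.a + x.a + 2)

/-- The parameter `E` of the computation. -/
noncomputable def E (x : HypersurfaceInput n) : ℕ := x.p * (x.D + 1)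

/-- The parameter `J` of the computation. -/
noncomputable def J (x : HypersurfaceInput n) : ℕ := x.E ^ (n + 1)

/-- The parameter `K` of the computation. -/
noncomputable def K (x : HypersurfaceInput n) : ℕ := x.a * x.J

/-- The base of the computation. -/
noncomputable def B (x : HypersurfaceInput n) : ℕ := x.J ^ (2 * x.p * (x.K + 1) + 3)

/-- The encoded modulus, as it is computed from the input. -/
noncomputable def M (x : HypersurfaceInput n) : ℕ :=
  ∑ b ∈ Finset.range (x.a + 1), regs (x.modulusWord ++ x.equationWord) b * x.B ^ b

/-- The encoded equation, as it is computed from the input. -/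
noncomputable def F (x : HypersurfaceInput n) : ℕ :=
  ∑ k ∈ Finset.range x.L.length, ∑ b ∈ Finset.range x.a,
    regs (x.modulusWord ++ x.equationWord) (x.a + 1 + k * (n + x.a) + n + b) *
      (x.B ^ codeExponent n x.E (x.modulusWord ++ x.equationWord) (x.a + 1 + k * (n + x.a)) *
        x.B ^ b)

theorem M_eq (x : HypersurfaceInput n) :
    x.M = ∑ b ∈ Finset.range (x.m.natDegree + 1), (x.m.coeff b).val * x.B ^ b := by
  refine Finset.sum_congr rfl fun b hb => ?_
  rw [Finset.mem_range] at hb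
  rw [regs_append_left _ _ (by rwa [length_modulusWord])]
  exact congrArg (· * _) (regs_map_range _ hb)

theorem regs_exponent (x : HypersurfaceInput n) {k : ℕ} (hk : k < x.L.length) (i : Fin n) :
    regs (x.modulusWord ++ x.equationWord) (x.a + 1 + k * (n + x.a) + i) = x.L[k] i := by
  have hi := i.2
  rw [← length_modulusWord, add_assoc, regs_append_right, equationWord,
    regs_flatMap _ _ x.length_monomialWord k hk (by omega), monomialWord,
    regs_append_left _ _ (by simp), regs_ofFn]

theorem regs_elementCoeff (x : HypersurfaceInput n) {k : ℕ} (hk : k < x.L.length) {b : ℕ}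
    (hb : b < x.a) :
    regs (x.modulusWord ++ x.equationWord) (x.a + 1 + k * (n + x.a) + n + b) =
      elementCoeff x.monic (x.f.coeff x.L[k]) b := by
  have h := regs_append_right (List.ofFn fun i => x.L[k] i)
    (elementWord x.monic (x.f.coeff x.L[k])) b
  rw [List.length_ofFn] at h
  rw [← length_modulusWord, add_assoc, add_assoc, regs_append_right, equationWord,
    regs_flatMap _ _ x.length_monomialWord k hk (by omega), monomialWord, h]
  exact regs_map_range _ hb

theorem F_eq (x : HypersurfaceInput n) :
    x.F = (x.L.map fun e => ∑ b ∈ Finset.range x.m.natDegree,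
      elementCoeff x.monic (x.f.coeff e) b *
        (x.B ^ b * ∏ i : Fin n, (x.B ^ x.E ^ ((i : ℕ) + 1)) ^ e i)).sum := by
  refine sum_range_length_eq _ _ _ fun k hk => Finset.sum_congr rfl fun b hb => ?_
  rw [regs_elementCoeff x hk (Finset.mem_range.1 hb), mul_comm (x.B ^ codeExponent _ _ _ _)]
  congr 2
  rw [codeExponent, Finset.sum_range, ← Finset.prod_pow_eq_pow_sum]
  refine Finset.prod_congr rfl fun i _ => ?_
  rw [regs_exponent x hk i, mul_comm, pow_mul]

/-- The sum of all coefficients and exponents in the input bounds every exponent and both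
coefficient sums. This is why the machine can take it, plus 2a + 2, as D. -/
theorem exists_digits (hn : 1 ≤ n) (x : HypersurfaceInput n) :
    ∃ W : (ZMod x.p)[X],
      digitWord (fun j => expNum x.B (traceNum n x.D x.E x.B x.p x.K (x.F ^ (x.p - 1))
        ((x.M * x.F) ^ (x.p - 1))) x.K / x.B ^ (x.a * j) % x.B % x.p) x.J = polyWord W ∧
      if Even n then IsReductionModP x.p (hypersurfaceZeta (AdjoinRoot x.m) x.p x.f) W 1
      else IsReductionModP x.p (hypersurfaceZeta (AdjoinRoot x.m) x.p x.f) 1 W := by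
  have hmod : ∑ b ∈ Finset.range (x.m.natDegree + 1), (x.m.coeff b).val ≤ x.D := by
    rw [← sum_map_range]
    exact (Nat.le_add_right _ _).trans (Nat.le_add_right _ _)
  have heq : x.equationWord.sum ≤ x.D := (Nat.le_add_left _ _).trans (Nat.le_add_right _ _)
  have hcoeff : ∀ e, ∑ b ∈ Finset.range x.m.natDegree, elementCoeff x.monic (x.f.coeff e) b ≤
      (x.monomialWord e).sum := by
    intro e
    rw [monomialWord, List.sum_append, ← sum_map_range]
    exact Nat.le_add_left _ _
  obtain ⟨W, hJ, hW, hred⟩ := hypersurface_digits (D := x.D) (E := x.E) (J := x.J) (K := x.K)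
    (B := x.B) (M := x.M) (F := x.F) hn x.monic x.admissible
    ((Nat.le_add_left _ _).trans (Nat.le_add_left _ _))
    (by change x.a * 2 ≤ _; rw [D]; omega)
    (fun e he i => le_trans (List.le_sum_of_mem (List.mem_flatMap.2
      ⟨e, he, List.mem_append_left _ (List.mem_ofFn.2 ⟨i, rfl⟩)⟩)) heq)
    hmod ((le_sum_flatMap _ _ _ hcoeff).trans heq) rfl rfl rfl rfl x.M_eq x.F_eq
  exact ⟨W, digitWord_eq_polyWord hJ hW, hred⟩

end HypersurfaceInput

end Instances

/-! ### Assembling the algorithm -/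

theorem RAM.Runs.write_one_one {ι : Type} {sz : ι → ℕ} {l inp out : ι → List ℕ} :
    RAM.Runs sz (.seq (.write (.const 1)) (.write (.const 1)))
      (fun i => ⟨RAM.regs (l i), inp i, out i⟩)
      fun i => ⟨RAM.regs (l i), inp i, out i ++ [1, 1]⟩ :=
  .seq (.write _) ((RAM.Runs.write _).congr (fun _ => rfl) fun i => by
    rw [List.append_assoc]
    rfl)

theorem exists_hypersurface_program (n : ℕ) (hn : 1 ≤ n) :
    ∃ (A : RAM.Prog) (P : Polynomial ℕ), ∀ x : HypersurfaceInput n,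
      ∃ g h : Polynomial (ZMod x.p),
        IsReductionModP x.p (hypersurfaceZeta (AdjoinRoot x.m) x.p x.f) g h ∧
        A.OutputsWithin (hypersurfaceWord x.monic x.f x.L) (polyWord g ++ polyWord h)
          (P.eval x.size) := by
  have key : ∀ out : HypersurfaceInput n → List ℕ, ∃ l : HypersurfaceInput n → List ℕ, _ :=
    fun out => RAM.mainProg_runs (sz := HypersurfaceInput.size) (out := out) n
      HypersurfaceInput.polyBounded_p (fun x => x.prime.out.one_le)
      HypersurfaceInput.polyBounded_a (HypersurfaceInput.polyBounded_length hn)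
      HypersurfaceInput.length_modulusWord HypersurfaceInput.length_equationWord
      HypersurfaceInput.polyBounded_sum_modulusWord
      (HypersurfaceInput.polyBounded_sum_equationWord hn) (fun _ => rfl)
      (E := HypersurfaceInput.E) (fun _ => rfl) (J := HypersurfaceInput.J) (fun _ => rfl)
      (K := HypersurfaceInput.K) (fun _ => rfl) (B := HypersurfaceInput.B) (fun _ => rfl)
      (M := HypersurfaceInput.M) (fun _ => rfl) (F := HypersurfaceInput.F) (fun _ => rfl)
  choose W hW hred using HypersurfaceInput.exists_digits (n := n) hn
  have hW' : ∀ x : HypersurfaceInput n, polyWord (1 : (ZMod x.p)[X]) = [1, 1] := fun x =>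
    polyWord_one x.p
  -- As n is fixed, its parity selects the program rather than being tested at run time: the
  -- constant polynomial 1, whose word is [1, 1], is the denominator for even n and the numerator
  -- for odd n.
  by_cases hpar : Even n
  · obtain ⟨l, hl⟩ := key fun _ => []
    obtain ⟨-, P, hP⟩ := (hl.seq RAM.Runs.write_one_one)
      (HypersurfaceInput.bdd_start hn fun _ => [])
    refine ⟨.seq (RAM.mainProg n) (.seq (.write (.const 1)) (.write (.const 1))), P,
      fun x => ⟨W x, 1, by simpa only [if_pos hpar] using hred x, ?_⟩⟩
    obtain ⟨t, ht, he⟩ := hP x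
    refine ⟨t, _, he, ?_, ht⟩
    rw [hW', ← hW x]
    rfl
  · obtain ⟨l, hl⟩ := key fun _ => [] ++ [1, 1]
    obtain ⟨-, P, hP⟩ := (RAM.Runs.write_one_one.seq hl)
      (HypersurfaceInput.bdd_start hn fun _ => [])
    refine ⟨.seq (.seq (.write (.const 1)) (.write (.const 1))) (RAM.mainProg n), P,
      fun x => ⟨1, W x, by simpa only [if_neg hpar] using hred x, ?_⟩⟩
    obtain ⟨t, ht, he⟩ := hP x
    refine ⟨t, _, he, ?_, ht⟩
    rw [hW', ← hW x]
    rfl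

theorem corollary4p3 (n : ℕ) (hn : 1 ≤ n) :
    ∃ (A : RAM.Prog) (P : Polynomial ℕ),
      ∀ (p : ℕ) [Fact p.Prime] (m : Polynomial (ZMod p)) [Fact (Irreducible m)] (hm : m.Monic)
        (f : MvPolynomial (Fin n) (AdjoinRoot m)) (L : List (Fin n →₀ ℕ)),
        IsMonomialList f L →
        ∃ g h : Polynomial (ZMod p),
          IsReductionModP p (hypersurfaceZeta (AdjoinRoot m) p f) g h ∧
          A.OutputsWithin (hypersurfaceWord hm f L) (polyWord g ++ polyWord h)
            (P.eval (p * max 1 (f.totalDegree.choose n) * Nat.log 2 (p ^ m.natDegree))) := by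
  obtain ⟨A, P, h⟩ := exists_hypersurface_program n hn
  exact ⟨A, P, fun p hp m hmi hm f L hL => h ⟨p, hp, m, hmi, hm, f, L, hL⟩⟩
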